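/- **Theorem.** Let $S\subseteq\mathbb R^{d_s}$, $A\subseteq\mathbb R^{d_a}$ be state and action spaces, $d=d_s+d_a$, $H\ge 1$ the episode length, $\rho$ an initial state distribution on $S$, and $\sigma_r,\sigma_f>0$. For an MDP $M$ with mean reward $\bar r^M$ and transition function $f^M$, in state $s_i$ with action $a_i$ the agent receives $r_i=\bar r^M(s_i,a_i)+\epsilon_r$, $\epsilon_r\sim N(0,\sigma_r^2)$, the environment produces $y_{i+1}=f^M(s_i,a_i)+\epsilon_f$, $\epsilon_f\sim N(0,\sigma_f^2I_{d_s})$, and the next state is $s_{i+1}=\kappa(y_{i+1})$; all noises are independent. Here $\kappa:\mathbb R^{d_s}\to S$ is a fixed, known measurable map with $\kappa(s)=s$ for $s\in S$; if $S=\mathbb R^{d_s}$, then $\kappa$ is the identity and $s_{i+1}=f^M(s_i,a_i)+\epsilon_f$. The unknown MDP $M^*$ is random, with a Bayesian linear regression prior $\phi$ (Gaussian processes with linear kernels): writing $x=(s,a)\in\mathbb R^d$, $$\bar r^*(s,a)=w^\top x,\qquad f^*_j(s,a)=w_j^\top x\quad(1\le j\le d_s),$$ with independent $w\sim N(0,\Sigma_r)$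 and $w_1,\dots,w_{d_s}\sim N(0,\Sigma_f)$, where $\Sigma_r,\Sigma_f$ are positive semidefinite. Assume $$\mathbb E\Big[\sup_{s\in S,\,a\in A}|\bar r^*(s,a)|^2\Big]\le R_{\max}^2\qquad\text{and}\qquad x^\top\Sigma_f\,x\le C_1\ \text{ for all } x=(s,a)\in S\times A .$$ Let $V^M_{\mu,i}(s)=\mathbb E\big[\sum_{j=i}^H\bar r^M(s_j,a_j)\mid s_i=s\big]$ be the value of a deterministic (step-dependent) policy $\mu$ with values in $A$, and let $M\mapsto\mu^M$ be a measurable choice, for $\phi$-almost every $M$, of a policy that maximizes $V^M_{\mu,i}(s)$ over $\mu$ for all $i$ and all $s\in S$. Posterior sampling $\pi^{PS}$ draws, at the start of each episode $k$, an MDP $M^k$ from the posterior distribution of $M^*$ given the history of episodes $1,\dots,k-1$ (for each of the $H$ steps: the noisy state $y_i$, with $y_1=s_1\sim\rho$, the action $a_i$ and the reward $r_i$), and follows $\mu^k=\mu^{M^k}$ during the episode. With $\mu^*=\mu^{M^*}$ let $$\mathrm{BayesRegret}(T,\pi^{PS},\phi)=\mathbb E\Big[\sum_{k=1}^{\lceil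 T/H\rceil}\int\big(V^{M^*}_{\mu^*,1}(s_1)-V^{M^*}_{\mu^k,1}(s_1)\big)\,\rho(ds_1)\Big].$$ Then the regret is integrable and $\mathrm{BayesRegret}(T,\pi^{PS},\phi)=\tilde O(H^{3/2}d\sqrt T)$. Precisely, there are a natural number $p$ and a function $C$ of $(R_{\max},C_1,\sigma_r,\sigma_f)$ only, such that for all such problems and all integers $T\ge0$, $$\mathrm{BayesRegret}(T,\pi^{PS},\phi)\le C(R_{\max},C_1,\sigma_r,\sigma_f)\,H^{3/2}\,d\,\sqrt T\,(1+\log T)^p$$ (with $\log 0$ read as $0$). -/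

import Mathlib

open MeasureTheory ProbabilityTheory
open scoped ENNReal

/-- `ℝⁿ` with the Euclidean norm. -/
abbrev Vec (n : ℕ) : Type := EuclideanSpace ℝ (Fin n)

/-- State-action vectors `(s, a) ∈ ℝ^{ds + da}`; coordinates are indexed by `Fin ds ⊕ Fin da`. -/
abbrev SAVec (ds da : ℕ) : Type := EuclideanSpace ℝ (Fin ds ⊕ Fin da)

/-- The state-action vector with state block `s` and action block `a`. -/
noncomputable def stateAction {ds da : ℕ} (s : Vec ds) (a : Vec da) : SAVec ds da :=
  WithLp.toLp 2 (Sum.elim (fun i => s i) (fun j => a j))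

/-- The known data of an episodic continuous control problem with state space `S ⊆ ℝ^{ds}` and
action space `A ⊆ ℝ^{da}`. If `S` is not all of `ℝ^{ds}`, a noisy transition `f(s,a) + ε` can fall
outside `S`; then the next state is `proj (f(s,a) + ε)`, where `proj` is a fixed measurable
retraction onto `S`. If `S = ℝ^{ds}`, then `proj` is the identity. -/
structure ControlProblem (ds da : ℕ) where
  /-- state space -/
  S : Set (Vec ds)
  /-- action space -/
  A : Set (Vec da)
  /-- retraction onto the state space -/
  proj : Vec ds → Vec ds
  measurable_proj : Measurable proj
  proj_mem : ∀ y, proj y ∈ S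
  proj_eq_self : ∀ s ∈ S, proj s = s
  /-- initial state distribution -/
  ρ : Measure (Vec ds)
  isProb_ρ : IsProbabilityMeasure ρ
  ρ_mem : ∀ᵐ s ∂ρ, s ∈ S
  /-- episode length -/
  H : ℕ
  H_pos : 1 ≤ H
  /-- standard deviation of the reward noise -/
  σr : ℝ
  σr_pos : 0 < σr
  /-- standard deviation of the transition noise, in each coordinate -/
  σf : ℝ
  σf_pos : 0 < σf

/-- The unknown part of the MDP: the weight vector of the mean reward, and one weight vector for
each coordinate of the transition function. -/
abbrev Param (ds da : ℕ) : Type := SAVec ds da × (Fin ds → SAVec ds da)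

/-- Mean reward `r̄(s,a) = w ⬝ (s,a)`. -/
noncomputable def meanReward {ds da : ℕ} (θ : Param ds da) (s : Vec ds) (a : Vec da) : ℝ :=
  inner ℝ θ.1 (stateAction s a)

/-- Mean transition `f(s,a)`, with coordinates `f_j(s,a) = w_j ⬝ (s,a)`. -/
noncomputable def meanNext {ds da : ℕ} (θ : Param ds da) (s : Vec ds) (a : Vec da) : Vec ds :=
  WithLp.toLp 2 (fun j => inner ℝ (θ.2 j) (stateAction s a))

/-- The Bayesian linear regression prior: all weight vectors are independent, the reward weights are
`N(0, Kr)` and the weights of every transition coordinate are `N(0, Kf)`. So `r̄` and the `f_j` are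
independent centred Gaussian processes with the linear kernels `xᵀ Kr x'` and `xᵀ Kf x'`. -/
noncomputable def blrPrior {ds da : ℕ} (Kr Kf : Matrix (Fin ds ⊕ Fin da) (Fin ds ⊕ Fin da) ℝ) :
    Measure (Param ds da) :=
  (multivariateGaussian 0 Kr).prod (Measure.pi fun _ : Fin ds => multivariateGaussian 0 Kf)

/-- The linear kernel `xᵀ C x'`. -/
noncomputable def linearKernel {ds da : ℕ} (C : Matrix (Fin ds ⊕ Fin da) (Fin ds ⊕ Fin da) ℝ)
    (x x' : SAVec ds da) : ℝ :=
  ∑ i, ∑ j, x i * C i j * x' j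

namespace ControlProblem

variable {ds da : ℕ} (M : ControlProblem ds da)

/-- Law of the transition noise, `N(0, σf² I)`. -/
noncomputable def noiseF : Measure (Vec ds) :=
  multivariateGaussian 0 (M.σf ^ 2 • (1 : Matrix (Fin ds) (Fin ds) ℝ))

/-- Law of the reward noise, `N(0, σr²)`. -/
noncomputable def noiseR : Measure ℝ := gaussianReal 0 (M.σr ^ 2).toNNReal

/-- A deterministic policy: the action at step `i` of an episode (steps are numbered from `0`) in
state `s` is `μ i s`. -/
def IsPolicy (μ : ℕ → Vec ds → Vec da) : Prop :=
  ∀ i, Measurable (μ i) ∧ ∀ s ∈ M.S, μ i s ∈ M.A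

/-- Sum of the mean rewards of `n` steps, starting from state `s` at step `i`, when policy `μ` is
followed in the MDP with parameter `θ` and the transition noises are `z 0, z 1, …`. -/
noncomputable def returnFrom (θ : Param ds da) (μ : ℕ → Vec ds → Vec da) :
    (n : ℕ) → ℕ → Vec ds → (Fin n → Vec ds) → ℝ
  | 0, _, _, _ => 0
  | n + 1, i, s, z => meanReward θ s (μ i s) +
      returnFrom θ μ n (i + 1) (M.proj (meanNext θ s (μ i s) + z 0)) (Fin.tail z)

/-- The value function `V_{μ,i}(s)` of the MDP with parameter `θ`: the expected sum of the mean
rewards from step `i` to the end of the episode. -/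
noncomputable def value (θ : Param ds da) (μ : ℕ → Vec ds → Vec da) (i : ℕ) (s : Vec ds) : ℝ :=
  ∫ z, M.returnFrom θ μ (M.H - i) i s z ∂(Measure.pi fun _ : Fin (M.H - i) => M.noiseF)

/-- `μ` is an optimal policy of the MDP with parameter `θ`. -/
def IsOptimal (θ : Param ds da) (μ : ℕ → Vec ds → Vec da) : Prop :=
  M.IsPolicy μ ∧ ∀ μ', M.IsPolicy μ' → ∀ i < M.H, ∀ s ∈ M.S, M.value θ μ' i s ≤ M.value θ μ i s

/-- A planner for the prior `π`: a measurable choice `θ ↦ μ^θ` of an optimal policy, for `π`-almost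
every parameter. -/
def IsPlanner (π : Measure (Param ds da)) (plan : Param ds da → ℕ → Vec ds → Vec da) : Prop :=
  (∀ i, Measurable fun p : Param ds da × Vec ds => plan p.1 i p.2) ∧
    ∀ᵐ θ ∂π, M.IsOptimal θ (plan θ)

/-- The randomness of the environment in one episode: the initial state, and for each step the
transition noise and the reward noise. (Only the first `H` steps are used.) -/
abbrev EpisodeNoise (ds : ℕ) : Type := Vec ds × (ℕ → Vec ds × ℝ)

instance isProbabilityMeasure_noiseF : IsProbabilityMeasure M.noiseF := by
  unfold noiseF; infer_instance

instance isProbabilityMeasure_noiseR : IsProbabilityMeasure M.noiseR := by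
  unfold noiseR; infer_instance

/-- Law of the randomness of one episode: everything is independent. -/
noncomputable def episodeLaw : Measure (EpisodeNoise ds) :=
  M.ρ.prod (Measure.infinitePi fun _ : ℕ => M.noiseF.prod M.noiseR)

/-- Noisy state at step `i` of an episode in the MDP `θ` under policy `μ` (before `proj`): the
initial state for `i = 0`, and `f(s,a) + ε` afterwards. -/
noncomputable def rawState (θ : Param ds da) (μ : ℕ → Vec ds → Vec da) (ξ : EpisodeNoise ds) :
    ℕ → Vec ds
  | 0 => ξ.1
  | i + 1 =>
      let s := M.proj (rawState θ μ ξ i)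
      meanNext θ s (μ i s) + (ξ.2 i).1

/-- What the agent observes at step `i` of an episode: the noisy state (which determines the state),
the action it takes, and the noisy reward. -/
noncomputable def observation (θ : Param ds da) (μ : ℕ → Vec ds → Vec da) (ξ : EpisodeNoise ds)
    (i : ℕ) : Vec ds × Vec da × ℝ :=
  let y := M.rawState θ μ ξ i
  let s := M.proj y
  (y, μ i s, meanReward θ s (μ i s) + (ξ.2 i).2)

section Interaction

variable {Ω : Type*} (plan : Param ds da → ℕ → Vec ds → Vec da)
  (θ : Ω → Param ds da) (θs : ℕ → Ω → Param ds da) (ξ : ℕ → Ω → EpisodeNoise ds)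

/-- The history prior to episode `k` (episodes are numbered from `0`): all observations of the
earlier episodes, when the agent follows the policy `μ^{θs j}` in episode `j` and the true parameter
is `θ`. -/
noncomputable def history (k : ℕ) (ω : Ω) : Fin k → Fin M.H → Vec ds × Vec da × ℝ :=
  fun j i => M.observation (θ ω) (plan (θs j ω)) (ξ j ω) i

/-- Regret of episode `k`: `∫ ρ(ds₁) (V^{M*}_{μ*,1}(s₁) - V^{M*}_{μ^k,1}(s₁))`. -/
noncomputable def episodeRegret (k : ℕ) (ω : Ω) : ℝ :=
  ∫ s, (M.value (θ ω) (plan (θ ω)) 0 s - M.value (θ ω) (plan (θs k ω)) 0 s) ∂M.ρ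

/-- Regret up to time `T`: the sum of the regrets of the first `⌈T/H⌉` episodes. -/
noncomputable def regret (T : ℕ) (ω : Ω) : ℝ :=
  ∑ k ∈ Finset.range ⌈(T : ℝ) / M.H⌉₊, M.episodeRegret plan θ θs k ω

/-- Posterior sampling with prior `π`: the true parameter `θ` has law `π`, the environment's
randomness `ξ 0, ξ 1, …` is i.i.d. and independent of `θ`, and the parameter `θs k` used in episode
`k` is drawn afresh from the posterior distribution of `θ` given the history prior to episode `k`:
its conditional law, given the true parameter, all the randomness of the environment and the earlier
samples, is the conditional law of `θ` given that history. -/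
structure IsPSRL (π : Measure (Param ds da)) [MeasurableSpace Ω] (P : Measure Ω) : Prop where
  measurable_θ : Measurable θ
  measurable_θs : ∀ k, Measurable (θs k)
  measurable_ξ : ∀ k, Measurable (ξ k)
  law_θ : P.map θ = π
  law_ξ : ∀ k, P.map (ξ k) = M.episodeLaw
  indep_ξ : iIndepFun ξ P
  indep_θ_ξ : IndepFun θ (fun ω k => ξ k ω) P
  posterior_sample : ∀ (k : ℕ) (B : Set (Param ds da)), MeasurableSet B →
    P⟦θs k ⁻¹' B |
        MeasurableSpace.comap (fun ω => (θ ω, (fun j => ξ j ω), fun j : Fin k => θs j ω))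
          inferInstance⟧ =ᵐ[P]
      P⟦θ ⁻¹' B | MeasurableSpace.comap (M.history plan θ θs ξ k) inferInstance⟧

end Interaction

end ControlProblem

/-! Given the history, the sampled and the true parameter have the same conditional law. Hence the
optimal value in the true model and the value of `μ^k` in the sampled model have equal means, and
the expected regret of an episode is the expected difference of the values of one policy, `μ^k`, in
two models.

By the simulation lemma (`lintegral_enorm_value_sub_le`) this is at most the sum, along the actual
trajectory, of the one-step errors in the mean reward and in the mean transition. No smoothness of
the value function is needed: the Gaussian transition noise makes the mean of a bounded function
Lipschitz in the shift (`abs_integral_shift_sub_le`), with a constant given by the range of the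
remaining return. That range is at most `H` times the supremum of the sampled mean reward, a
seminorm of a Gaussian vector, whose fourth moment is controlled by its second
(`lintegral_pow_four_le_of_rotation`).

Both errors are errors of a Bayesian linear regression. In whitened coordinates let `W` be the
coefficient matrix, `V` the regularised Gram matrix of the features and `N = W - ∑ residual ⊗
feature`. When predictions are linear, `N` is `W` minus its ridge estimate, times `V`, so for two
parameters `W' - W = (N' - N) V⁻¹`. At the true parameter the residuals are noises and `exp(s u·Nq -
s²|u|²|q|²_V / 2)` has mean at most one. A sum over a grid of pairs `(u, q)` bounds `N` in the
`V`-norm by a random width of order `√d` up to logarithms, with fourth moments. Exchanging sample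
and truth given the history shows that the width at the sampled parameter has the same law.

A prediction error is therefore at most the sum of two widths times `√(x·V⁻¹x)`. The elliptical
potential lemma (`sum_inv_gram_quad_le`) sums `x·V⁻¹x` to order `Hd` up to logarithms, the factor
`H` being the price of updating `V` only between episodes. With `K ≈ T/H` episodes and return range
of order `H`, the transition part gives `H · Hd√K ≈ H^{3/2} d √T`, and the reward part is smaller.
Horizons shorter than `d` or `H` are covered by the trivial bound on the rewards. -/

/-! ### Regularised Gram matrices and the elliptical potential lemma. -/

section LinearAlgebra

open Matrix

variable {ι κ : Type*} [Fintype ι]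

/-- The regularised Gram matrix `1 + ∑ z zᵀ` of the features of the first `k` batches of `n`
vectors. -/
noncomputable def gramMat [DecidableEq ι] (n : ℕ) (z : ℕ → ℕ → ι → ℝ) (k : ℕ) : Matrix ι ι ℝ :=
  1 + ∑ j ∈ Finset.range k, ∑ i ∈ Finset.range n, vecMulVec (z j i) (z j i)

/-- The quadratic form of `gramMat`. -/
noncomputable def gramQuad (n : ℕ) (z : ℕ → ℕ → ι → ℝ) (k : ℕ) (q : ι → ℝ) : ℝ :=
  q ⬝ᵥ q + ∑ j ∈ Finset.range k, ∑ i ∈ Finset.range n, (q ⬝ᵥ z j i) ^ 2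

theorem dotProduct_self_nonneg' (q : ι → ℝ) : 0 ≤ q ⬝ᵥ q :=
  Finset.sum_nonneg fun i _ => mul_self_nonneg (q i)

theorem dotProduct_sq_le (p q : ι → ℝ) : (p ⬝ᵥ q) ^ 2 ≤ (p ⬝ᵥ p) * (q ⬝ᵥ q) := by
  have := Finset.sum_mul_sq_le_sq_mul_sq Finset.univ p q
  simpa [dotProduct, sq] using this

theorem dotProduct_vecMulVec_mulVec (p q z : ι → ℝ) :
    p ⬝ᵥ (vecMulVec z z *ᵥ q) = (p ⬝ᵥ z) * (q ⬝ᵥ z) := by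
  rw [vecMulVec_mulVec]
  simp [dotProduct_comm z q, mul_comm]

theorem dotProduct_gram_mulVec [DecidableEq ι] (n : ℕ) (z : ℕ → ℕ → ι → ℝ) (k : ℕ)
    (p q : ι → ℝ) : p ⬝ᵥ (gramMat n z k *ᵥ q) =
      p ⬝ᵥ q + ∑ j ∈ Finset.range k, ∑ i ∈ Finset.range n, (p ⬝ᵥ z j i) * (q ⬝ᵥ z j i) := by
  simp only [gramMat, add_mulVec, one_mulVec, dotProduct_add, sum_mulVec, dotProduct_sum,
    dotProduct_vecMulVec_mulVec]

theorem gram_quad [DecidableEq ι] (n : ℕ) (z : ℕ → ℕ → ι → ℝ) (k : ℕ) (q : ι → ℝ) :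
    q ⬝ᵥ (gramMat n z k *ᵥ q) = gramQuad n z k q := by
  rw [dotProduct_gram_mulVec, gramQuad]
  simp [sq]

theorem dotProduct_self_le_gramQuad (n : ℕ) (z : ℕ → ℕ → ι → ℝ) (k : ℕ) (q : ι → ℝ) :
    q ⬝ᵥ q ≤ gramQuad n z k q := by
  have : 0 ≤ ∑ j ∈ Finset.range k, ∑ i ∈ Finset.range n, (q ⬝ᵥ z j i) ^ 2 :=
    Finset.sum_nonneg fun _ _ => Finset.sum_nonneg fun _ _ => sq_nonneg _
  unfold gramQuad; linarith

theorem gramQuad_nonneg (n : ℕ) (z : ℕ → ℕ → ι → ℝ) (k : ℕ) (q : ι → ℝ) :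
    0 ≤ gramQuad n z k q :=
  (dotProduct_self_nonneg' q).trans (dotProduct_self_le_gramQuad n z k q)

theorem gramQuad_le {n : ℕ} {z : ℕ → ℕ → ι → ℝ} {k : ℕ} {c : ℝ}
    (hz : ∀ j < k, ∀ i < n, z j i ⬝ᵥ z j i ≤ c) (q : ι → ℝ) :
    gramQuad n z k q ≤ (1 + k * n * c) * (q ⬝ᵥ q) := by
  have : ∑ j ∈ Finset.range k, ∑ i ∈ Finset.range n, (q ⬝ᵥ z j i) ^ 2 ≤
      ∑ j ∈ Finset.range k, ∑ i ∈ Finset.range n, (q ⬝ᵥ q) * c := by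
    refine Finset.sum_le_sum fun j hj => Finset.sum_le_sum fun i hi => ?_
    exact (dotProduct_sq_le _ _).trans (mul_le_mul_of_nonneg_left
      (hz j (Finset.mem_range.1 hj) i (Finset.mem_range.1 hi)) (dotProduct_self_nonneg' q))
  simp only [Finset.sum_const, Finset.card_range, nsmul_eq_mul] at this
  unfold gramQuad; nlinarith

theorem gramQuad_smul (n : ℕ) (z : ℕ → ℕ → ι → ℝ) (k : ℕ) (a : ℝ) (q : ι → ℝ) :
    gramQuad n z k (a • q) = a ^ 2 * gramQuad n z k q := by
  simp only [gramQuad, smul_dotProduct, dotProduct_smul, smul_eq_mul, mul_add, Finset.mul_sum,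
    mul_pow]
  ring

theorem gramQuad_add_le (n : ℕ) (z : ℕ → ℕ → ι → ℝ) (k : ℕ) (p q : ι → ℝ) :
    gramQuad n z k (p + q) ≤ 2 * gramQuad n z k p + 2 * gramQuad n z k q := by
  have h1 : (p + q) ⬝ᵥ (p + q) ≤ 2 * (p ⬝ᵥ p) + 2 * (q ⬝ᵥ q) := by
    have := dotProduct_self_nonneg' (p - q)
    simp only [sub_dotProduct, dotProduct_sub, add_dotProduct, dotProduct_add] at *
    linarith
  have h2 : ∑ j ∈ Finset.range k, ∑ i ∈ Finset.range n, ((p + q) ⬝ᵥ z j i) ^ 2 ≤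
      2 * ∑ j ∈ Finset.range k, ∑ i ∈ Finset.range n, (p ⬝ᵥ z j i) ^ 2 +
      2 * ∑ j ∈ Finset.range k, ∑ i ∈ Finset.range n, (q ⬝ᵥ z j i) ^ 2 := by
    simp only [Finset.mul_sum, ← Finset.sum_add_distrib, add_dotProduct]
    refine Finset.sum_le_sum fun j _ => Finset.sum_le_sum fun i _ => ?_
    nlinarith [sq_nonneg (p ⬝ᵥ z j i - q ⬝ᵥ z j i)]
  unfold gramQuad; linarith

section PosDef

variable [DecidableEq ι]

theorem posDef_of_le_quad {A : Matrix ι ι ℝ} (hA : A.IsHermitian)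
    (h : ∀ q : ι → ℝ, q ⬝ᵥ q ≤ q ⬝ᵥ (A *ᵥ q)) : A.PosDef := by
  refine PosDef.of_dotProduct_mulVec_pos hA fun q hq => ?_
  refine lt_of_lt_of_le ?_ (h q)
  refine lt_of_le_of_ne (dotProduct_self_nonneg' q) fun h0 => hq ?_
  exact dotProduct_self_eq_zero.1 h0.symm

theorem isHermitian_gram (n : ℕ) (z : ℕ → ℕ → ι → ℝ) (k : ℕ) : (gramMat n z k).IsHermitian := by
  unfold gramMat IsHermitian
  simp [conjTranspose_eq_transpose_of_trivial, transpose_sum, transpose_vecMulVec]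

theorem posDef_gram (n : ℕ) (z : ℕ → ℕ → ι → ℝ) (k : ℕ) : (gramMat n z k).PosDef :=
  posDef_of_le_quad (isHermitian_gram n z k) fun q => by
    rw [gram_quad]; exact dotProduct_self_le_gramQuad n z k q

theorem mulVec_inv_mulVec {A : Matrix ι ι ℝ} (hA : A.PosDef) (z : ι → ℝ) :
    A *ᵥ (A⁻¹ *ᵥ z) = z := by
  rw [mulVec_mulVec, mul_nonsing_inv _ hA.det_pos.ne'.isUnit, one_mulVec]

theorem dotProduct_mulVec_symm {A : Matrix ι ι ℝ} (hA : A.IsHermitian) (p q : ι → ℝ) :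
    p ⬝ᵥ (A *ᵥ q) = q ⬝ᵥ (A *ᵥ p) := by
  have : Aᵀ = A := by simpa [IsHermitian, conjTranspose_eq_transpose_of_trivial] using hA
  rw [dotProduct_mulVec, ← mulVec_transpose, this, dotProduct_comm]

theorem inv_quad_nonneg {A : Matrix ι ι ℝ} (hA : A.PosDef) (z : ι → ℝ) :
    0 ≤ z ⬝ᵥ (A⁻¹ *ᵥ z) := by
  simpa using hA.inv.posSemidef.dotProduct_mulVec_nonneg z

/-- Inversion reverses the Loewner order. Expanding the nonnegative `B`-form at `A⁻¹z - r B⁻¹z` and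
bounding its leading term by the hypothesis leaves the claim, without matrix square roots. -/
theorem inv_quad_le_of_quad_le {A B : Matrix ι ι ℝ} (hA : A.PosDef) (hB : B.PosDef) {r : ℝ}
    (hr : 0 < r) (h : ∀ q : ι → ℝ, q ⬝ᵥ (B *ᵥ q) ≤ r * (q ⬝ᵥ (A *ᵥ q))) (z : ι → ℝ) :
    z ⬝ᵥ (A⁻¹ *ᵥ z) ≤ r * (z ⬝ᵥ (B⁻¹ *ᵥ z)) := by
  set q := A⁻¹ *ᵥ z with hq
  set p := B⁻¹ *ᵥ z with hp
  have hAq : A *ᵥ q = z := mulVec_inv_mulVec hA z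
  have hBp : B *ᵥ p = z := mulVec_inv_mulVec hB z
  have h0 : 0 ≤ (q - r • p) ⬝ᵥ (B *ᵥ (q - r • p)) := by
    simpa using hB.posSemidef.dotProduct_mulVec_nonneg (q - r • p)
  have h1 := h q
  rw [hAq] at h1
  have h2 : p ⬝ᵥ (B *ᵥ q) = q ⬝ᵥ z := by rw [dotProduct_mulVec_symm hB.isHermitian, hBp]
  simp only [mulVec_sub, mulVec_smul, sub_dotProduct, dotProduct_sub, smul_dotProduct,
    dotProduct_smul, hBp, h2, smul_eq_mul] at h0
  rw [dotProduct_comm z q, dotProduct_comm z p]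
  have : r * (q ⬝ᵥ z) ≤ r * (r * (p ⬝ᵥ z)) := by linarith
  exact le_of_mul_le_mul_left this hr

theorem inv_quad_le_dotProduct_self {A : Matrix ι ι ℝ} (hA : A.PosDef)
    (h : ∀ q : ι → ℝ, q ⬝ᵥ q ≤ q ⬝ᵥ (A *ᵥ q)) (z : ι → ℝ) :
    z ⬝ᵥ (A⁻¹ *ᵥ z) ≤ z ⬝ᵥ z := by
  have := inv_quad_le_of_quad_le hA PosDef.one one_pos (fun q => by simpa using h q) z
  simpa using this

theorem det_add_vecMulVec {A : Matrix ι ι ℝ} (hA : A.PosDef) (z : ι → ℝ) :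
    (A + vecMulVec z z).det = A.det * (1 + z ⬝ᵥ (A⁻¹ *ᵥ z)) := by
  have h := det_add_replicateCol_mul_replicateRow (ι := Unit) hA.det_pos.ne'.isUnit z z
  rw [← vecMulVec_eq Unit] at h
  rw [h, det_unique (n := Unit)]
  simp [Matrix.add_apply, Matrix.mul_assoc, Matrix.mul_apply, dotProduct, mulVec]

theorem det_le_pow_of_quad_le {A : Matrix ι ι ℝ} (hA : A.PosDef) {r : ℝ}
    (h : ∀ q : ι → ℝ, q ⬝ᵥ (A *ᵥ q) ≤ r * (q ⬝ᵥ q)) : A.det ≤ r ^ Fintype.card ι := by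
  rw [hA.isHermitian.det_eq_prod_eigenvalues, ← Finset.card_univ, ← Finset.prod_const]
  refine Finset.prod_le_prod (fun i _ => by simpa using (hA.eigenvalues_pos i).le) fun i _ => ?_
  set v : EuclideanSpace ℝ ι := hA.isHermitian.eigenvectorBasis i with hv
  have h1 := h v.ofLp
  have h2 : v.ofLp ⬝ᵥ v.ofLp = 1 := by
    have h3 : ‖v‖ = 1 := hA.isHermitian.eigenvectorBasis.orthonormal.1 i
    have h4 := EuclideanSpace.real_norm_sq_eq v
    rw [h3] at h4
    simp only [dotProduct, ← sq]
    linarith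
  rw [hv, hA.isHermitian.mulVec_eigenvectorBasis i, ← hv, dotProduct_smul, h2] at h1
  simpa using h1

end PosDef

theorem le_mul_log_one_add {b c : ℝ} (hb : 0 ≤ b) (hbc : b ≤ c) :
    b ≤ (1 + c) * Real.log (1 + b) := by
  have h1 : 1 - (1 + b)⁻¹ ≤ Real.log (1 + b) := Real.one_sub_inv_le_log_of_pos (by linarith)
  have h2 : b = (1 + b) * (1 - (1 + b)⁻¹) := by field_simp; ring
  have h3 : 0 ≤ Real.log (1 + b) := Real.log_nonneg (by linarith)
  calc b = (1 + b) * (1 - (1 + b)⁻¹) := h2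
    _ ≤ (1 + b) * Real.log (1 + b) := by gcongr
    _ ≤ (1 + c) * Real.log (1 + b) := by gcongr

/-- The elliptical potential lemma for a Gram matrix that is updated after each batch of `n`
vectors. -/
theorem sum_inv_gram_quad_le [DecidableEq ι] {n : ℕ} {z : ℕ → ℕ → ι → ℝ} {c : ℝ} (hc : 0 ≤ c)
    (K : ℕ) (hz : ∀ j < K, ∀ i < n, z j i ⬝ᵥ z j i ≤ c) :
    ∑ k ∈ Finset.range K, ∑ i ∈ Finset.range n, z k i ⬝ᵥ ((gramMat n z k)⁻¹ *ᵥ z k i) ≤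
      (1 + n * c) * (1 + c) * (Fintype.card ι * Real.log (1 + K * n * c)) := by
  have hnc : 0 ≤ n * c := by positivity
  -- Within batch `k` the matrix in the quadratic form is frozen while the determinant grows with
  -- each vector. The growing matrix `U` is at most `1 + n c` times the frozen one, so freezing
  -- costs this factor; for `U` itself a term `b ≤ c` is at most `(1 + c) log(1 + b)`, and `log(1 +
  -- b)` is the increment of `log det`.
  have batch : ∀ k < K, ∀ m ≤ n,
      ∑ i ∈ Finset.range m, z k i ⬝ᵥ ((gramMat n z k)⁻¹ *ᵥ z k i) ≤
        (1 + n * c) * (1 + c) * (Real.log (gramMat n z k +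
          ∑ i ∈ Finset.range m, vecMulVec (z k i) (z k i)).det - Real.log (gramMat n z k).det) := by
    intro k hk m hm
    induction m with
    | zero => simp
    | succ m ih =>
      set U := gramMat n z k + ∑ i ∈ Finset.range m, vecMulVec (z k i) (z k i) with hU
      have hquad : ∀ q : ι → ℝ, q ⬝ᵥ (U *ᵥ q) =
          gramQuad n z k q + ∑ i ∈ Finset.range m, (q ⬝ᵥ z k i) ^ 2 := by
        intro q
        rw [hU, add_mulVec, dotProduct_add, gram_quad, sum_mulVec, dotProduct_sum]
        simp only [dotProduct_vecMulVec_mulVec, sq]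
      have hge : ∀ q : ι → ℝ, q ⬝ᵥ q ≤ q ⬝ᵥ (U *ᵥ q) := by
        intro q
        rw [hquad]
        have : 0 ≤ ∑ i ∈ Finset.range m, (q ⬝ᵥ z k i) ^ 2 :=
          Finset.sum_nonneg fun _ _ => sq_nonneg _
        linarith [dotProduct_self_le_gramQuad n z k q]
      have hherm : U.IsHermitian := by
        refine (isHermitian_gram n z k).add ?_
        simp [IsHermitian, conjTranspose_eq_transpose_of_trivial, transpose_sum,
          transpose_vecMulVec]
      have hpos : U.PosDef := posDef_of_le_quad hherm hge
      have hle : ∀ q : ι → ℝ, q ⬝ᵥ (U *ᵥ q) ≤ (1 + n * c) * (q ⬝ᵥ (gramMat n z k *ᵥ q)) := by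
        intro q
        rw [hquad, gram_quad]
        have h1 : ∑ i ∈ Finset.range m, (q ⬝ᵥ z k i) ^ 2 ≤
            ∑ i ∈ Finset.range m, (q ⬝ᵥ q) * c := by
          refine Finset.sum_le_sum fun i hi => ?_
          exact (dotProduct_sq_le _ _).trans (mul_le_mul_of_nonneg_left
            (hz k hk i (by have := Finset.mem_range.1 hi; omega)) (dotProduct_self_nonneg' q))
        simp only [Finset.sum_const, Finset.card_range, nsmul_eq_mul] at h1
        have h2 : (m : ℝ) ≤ n := by exact_mod_cast (by omega : m ≤ n)
        have h3 : (m : ℝ) * ((q ⬝ᵥ q) * c) ≤ n * (gramQuad n z k q * c) := by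
          gcongr
          · exact mul_nonneg (dotProduct_self_nonneg' q) hc
          · exact dotProduct_self_le_gramQuad n z k q
        nlinarith
      set b := z k m ⬝ᵥ (U⁻¹ *ᵥ z k m) with hb
      have hb0 : 0 ≤ b := inv_quad_nonneg hpos _
      have hbc : b ≤ c := (inv_quad_le_dotProduct_self hpos hge _).trans (hz k hk m (by omega))
      have h1 := inv_quad_le_of_quad_le (posDef_gram n z k) hpos (by positivity) hle (z k m)
      have hlog : Real.log (U + vecMulVec (z k m) (z k m)).det =
          Real.log U.det + Real.log (1 + b) := by
        rw [det_add_vecMulVec hpos, Real.log_mul hpos.det_pos.ne' (by positivity)]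
      rw [Finset.sum_range_succ, Finset.sum_range_succ, ← add_assoc, ← hU, hlog]
      have h2 := ih (by omega)
      have h3 : (1 + n * c) * b ≤ (1 + n * c) * ((1 + c) * Real.log (1 + b)) := by
        have := le_mul_log_one_add hb0 hbc
        gcongr
      linarith
  have total : ∀ k ≤ K,
      ∑ j ∈ Finset.range k, ∑ i ∈ Finset.range n, z j i ⬝ᵥ ((gramMat n z j)⁻¹ *ᵥ z j i) ≤
        (1 + n * c) * (1 + c) * Real.log (gramMat n z k).det := by
    intro k hk
    induction k with
    | zero => simp [gramMat]
    | succ k ih =>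
      have h1 := ih (by omega)
      have h2 := batch k (by omega) n le_rfl
      have h3 : gramMat n z (k + 1) =
          gramMat n z k + ∑ i ∈ Finset.range n, vecMulVec (z k i) (z k i) := by
        simp [gramMat, Finset.sum_range_succ, add_assoc]
      rw [Finset.sum_range_succ, h3]
      linarith
  refine (total K le_rfl).trans ?_
  have hpd := posDef_gram n z K
  have : Real.log (gramMat n z K).det ≤ Fintype.card ι * Real.log (1 + K * n * c) := by
    rw [← Real.log_pow]
    refine Real.log_le_log hpd.det_pos (det_le_pow_of_quad_le hpd fun q => ?_)
    rw [gram_quad]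
    exact gramQuad_le hz q
  gcongr

/-! ### Discretisation of bilinear forms on a product of ellipsoids. -/

section Grid

/-- The points `-1, …, -1/n, 0, 1/n, …, 1`. -/
noncomputable def gridPoint (n : ℕ) (k : Fin (2 * n + 1)) : ℝ := ((k : ℝ) - n) / n

/-- Rounding goes up when `c ≥ 0` and down when `c ≤ 0`, so that a linear function with slope `c`
does not decrease. -/
theorem exists_gridPoint {n : ℕ} (hn : 0 < n) {t : ℝ} (ht : |t| ≤ 1) (c : ℝ) :
    ∃ k : Fin (2 * n + 1), t * c ≤ gridPoint n k * c ∧ |gridPoint n k - t| ≤ 1 / n := by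
  have hn' : (0 : ℝ) < n := by exact_mod_cast hn
  obtain ⟨h1, h2⟩ := abs_le.1 ht
  have hnt : 0 ≤ n * t + n := by nlinarith
  have hnt2 : n * t + n ≤ ((2 * n : ℕ) : ℝ) := by push_cast; nlinarith
  rcases le_total 0 c with hc | hc
  · have hk : ⌈n * t + n⌉₊ ≤ 2 * n := Nat.ceil_le.2 hnt2
    refine ⟨⟨⌈n * t + n⌉₊, by omega⟩, ?_, ?_⟩
    · refine mul_le_mul_of_nonneg_right ?_ hc
      have := Nat.le_ceil (n * t + n)
      simp only [gridPoint]
      rw [le_div_iff₀ hn']; linarith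
    · have h3 := Nat.le_ceil (n * t + n)
      have h4 := Nat.ceil_lt_add_one hnt
      simp only [gridPoint]
      rw [abs_le, div_sub' hn'.ne', le_div_iff₀ hn', div_le_div_iff_of_pos_right hn']
      have : -(1 / (n : ℝ)) * n = -1 := by field_simp
      rw [this]
      constructor <;> linarith
  · have hk : ⌊n * t + n⌋₊ ≤ 2 * n := by
      have := Nat.floor_le hnt
      exact_mod_cast this.trans hnt2
    refine ⟨⟨⌊n * t + n⌋₊, by omega⟩, ?_, ?_⟩
    · refine mul_le_mul_of_nonpos_right ?_ hc
      have := Nat.floor_le hnt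
      simp only [gridPoint]
      rw [div_le_iff₀ hn']; linarith
    · have h3 := Nat.floor_le hnt
      have h4 := Nat.lt_floor_add_one (n * t + n)
      simp only [gridPoint]
      rw [abs_le, div_sub' hn'.ne', le_div_iff₀ hn', div_le_div_iff_of_pos_right hn']
      have : -(1 / (n : ℝ)) * n = -1 := by field_simp
      rw [this]
      constructor <;> linarith

/-- A vector with entries in the grid. -/
noncomputable def gridVec (n : ℕ) (k : ι → Fin (2 * n + 1)) : ι → ℝ := fun i => gridPoint n (k i)

theorem exists_gridVec {n : ℕ} (hn : 0 < n) {q : ι → ℝ} (hq : ∀ i, |q i| ≤ 1) (c : ι → ℝ) :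
    ∃ k : ι → Fin (2 * n + 1), q ⬝ᵥ c ≤ gridVec n k ⬝ᵥ c ∧
      (gridVec n k - q) ⬝ᵥ (gridVec n k - q) ≤ Fintype.card ι / n := by
  choose k hk1 hk2 using fun i => exists_gridPoint hn (hq i) (c i)
  refine ⟨k, Finset.sum_le_sum fun i _ => hk1 i, ?_⟩
  have hn' : (1 : ℝ) ≤ n := by exact_mod_cast hn
  have : ∀ i ∈ Finset.univ, (gridVec n k - q) i * (gridVec n k - q) i ≤ 1 / n := by
    intro i _
    have h := hk2 i
    simp only [Pi.sub_apply, gridVec]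
    rw [← abs_mul_abs_self]
    calc _ ≤ (1 / (n : ℝ)) * (1 / n) := by gcongr
      _ ≤ (1 / (n : ℝ)) * 1 := by
        gcongr
        rw [div_le_one (by linarith)]; exact hn'
      _ = 1 / n := mul_one _
  refine (Finset.sum_le_sum this).trans ?_
  simp [div_eq_mul_inv]

variable [Fintype κ]

theorem abs_le_one_of_dotProduct_self_le {q : ι → ℝ} (h : q ⬝ᵥ q ≤ 1) (i : ι) : |q i| ≤ 1 := by
  have h1 : q i * q i ≤ q ⬝ᵥ q :=
    Finset.single_le_sum (f := fun i => q i * q i) (fun i _ => mul_self_nonneg (q i))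
      (Finset.mem_univ i)
  rw [abs_le]; constructor <;> nlinarith

/-- A bilinear form is bounded on a product of ellipsoids by its exponential sum over a grid. -/
theorem bilin_le_of_grid [DecidableEq ι] [DecidableEq κ] {m k n : ℕ}
    {z : ℕ → ℕ → ι → ℝ} {c : ℝ} (hc : 0 ≤ c)
    (hz : ∀ j < k, ∀ i < n, z j i ⬝ᵥ z j i ≤ c) (hm : 0 < m)
    (hm1 : Fintype.card ι * (1 + k * n * c) ≤ m) (hκ : (Fintype.card κ : ℝ) ≤ m)
    (N : Matrix κ ι ℝ) {s : ℝ} (hs : 0 ≤ s) {u : κ → ℝ} {q : ι → ℝ} (hu : u ⬝ᵥ u ≤ 1)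
    (hq : gramQuad n z k q ≤ 1) :
    s * (u ⬝ᵥ (N *ᵥ q)) ≤ 8 * s ^ 2 + Real.log (∑ p : κ → Fin (2 * m + 1),
      ∑ l : ι → Fin (2 * m + 1), Real.exp (s * (gridVec m p ⬝ᵥ (N *ᵥ gridVec m l)) -
        s ^ 2 / 2 * (gridVec m p ⬝ᵥ gridVec m p) * gramQuad n z k (gridVec m l))) := by
  have hm' : (0 : ℝ) < m := by exact_mod_cast hm
  have hknc : 0 ≤ k * n * c := by positivity
  -- `q` is rounded in favour of `u·Nq`, then `u` in favour of the form at the rounded `q`. The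
  -- value never decreases, so no error term involving the size of `N` arises.
  obtain ⟨l, hl1, hl2⟩ := exists_gridVec hm (abs_le_one_of_dotProduct_self_le
    ((dotProduct_self_le_gramQuad n z k q).trans hq)) (u ᵥ* N)
  obtain ⟨p, hp1, hp2⟩ := exists_gridVec hm (abs_le_one_of_dotProduct_self_le hu)
    (N *ᵥ gridVec m l)
  set q' := gridVec m l
  set u' := gridVec m p
  have hval : u ⬝ᵥ (N *ᵥ q) ≤ u' ⬝ᵥ (N *ᵥ q') := by
    refine le_trans ?_ hp1
    rw [dotProduct_mulVec, dotProduct_mulVec, dotProduct_comm, dotProduct_comm (u ᵥ* N)]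
    exact hl1
  -- The grid is so fine that rounding moves each vector by at most one in its norm. Both rounded
  -- vectors have norm at most two, and the compensator is at most `s²/2 · 16`, the source of `8
  -- s²`.
  have hQ : gramQuad n z k q' ≤ 4 := by
    have h1 := gramQuad_add_le n z k q (q' - q)
    have h2 := gramQuad_le hz (q' - q)
    have h3 : (1 + k * n * c) * ((q' - q) ⬝ᵥ (q' - q)) ≤
        (1 + k * n * c) * (Fintype.card ι / m) := by gcongr
    have h4 : (1 + k * n * c) * (Fintype.card ι / m) ≤ 1 := by
      rw [mul_div_assoc', div_le_one hm']; linarith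
    rw [add_sub_cancel] at h1
    linarith
  have hU : u' ⬝ᵥ u' ≤ 4 := by
    have h1 : (u' - u) ⬝ᵥ (u' - u) ≤ 1 := hp2.trans (by rw [div_le_one hm']; exact hκ)
    have h2 := dotProduct_self_nonneg' ((u' - u) - u)
    simp only [sub_dotProduct, dotProduct_sub] at h1 h2
    have := dotProduct_comm u u'
    linarith
  have hU0 := dotProduct_self_nonneg' u'
  have hprod : (u' ⬝ᵥ u') * gramQuad n z k q' ≤ 16 := by
    nlinarith [gramQuad_nonneg n z k q']
  have hexp : s * (u' ⬝ᵥ (N *ᵥ q')) - s ^ 2 / 2 * (u' ⬝ᵥ u') * gramQuad n z k q' ≤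
      Real.log (∑ p : κ → Fin (2 * m + 1),
      ∑ l : ι → Fin (2 * m + 1), Real.exp (s * (gridVec m p ⬝ᵥ (N *ᵥ gridVec m l)) -
        s ^ 2 / 2 * (gridVec m p ⬝ᵥ gridVec m p) * gramQuad n z k (gridVec m l))) := by
    rw [← Real.log_exp (s * (u' ⬝ᵥ (N *ᵥ q')) - s ^ 2 / 2 * (u' ⬝ᵥ u') * gramQuad n z k q')]
    refine Real.log_le_log (Real.exp_pos _) ?_
    refine le_trans ?_ (Finset.single_le_sum (f := fun p : κ → Fin (2 * m + 1) =>
      ∑ l : ι → Fin (2 * m + 1), Real.exp (s * (gridVec m p ⬝ᵥ (N *ᵥ gridVec m l)) -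
        s ^ 2 / 2 * (gridVec m p ⬝ᵥ gridVec m p) * gramQuad n z k (gridVec m l)))
      (fun _ _ => by positivity) (Finset.mem_univ p))
    exact Finset.single_le_sum (f := fun l : ι → Fin (2 * m + 1) =>
      Real.exp (s * (gridVec m p ⬝ᵥ (N *ᵥ gridVec m l)) -
        s ^ 2 / 2 * (gridVec m p ⬝ᵥ gridVec m p) * gramQuad n z k (gridVec m l)))
      (fun _ _ => by positivity) (Finset.mem_univ l)
  have h5 : s * (u ⬝ᵥ (N *ᵥ q)) ≤ s * (u' ⬝ᵥ (N *ᵥ q')) := by gcongr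
  have h6 : s ^ 2 / 2 * (u' ⬝ᵥ u') * gramQuad n z k q' ≤ s ^ 2 / 2 * 16 := by
    rw [mul_assoc]; gcongr
  linarith

end Grid

end LinearAlgebra

/-! ### Gaussian laws: shifts, exponential moments, fourth moments of seminorms. -/

section GaussianTools

open scoped NNReal RealInnerProductSpace

theorem pi_eq_withDensity {ι : Type*} [Fintype ι] {X : ι → Type*} [∀ i, MeasurableSpace (X i)]
    (μ ν : ∀ i, Measure (X i)) [∀ i, IsProbabilityMeasure (μ i)] [∀ i, IsProbabilityMeasure (ν i)]
    (g : ∀ i, X i → ℝ) (hg : ∀ i, Measurable (g i)) (hg0 : ∀ i x, 0 ≤ g i x)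
    (hν : ∀ i, ν i = (μ i).withDensity fun x => ENNReal.ofReal (g i x)) :
    Measure.pi ν = (Measure.pi μ).withDensity fun x => ENNReal.ofReal (∏ i, g i (x i)) := by
  have hint : ∀ i, Integrable (g i) (μ i) := by
    intro i
    refine ⟨(hg i).aestronglyMeasurable, ?_⟩
    rw [hasFiniteIntegral_iff_ofReal (Filter.Eventually.of_forall (hg0 i))]
    have := measure_univ (μ := ν i)
    rw [hν i, withDensity_apply _ MeasurableSet.univ, Measure.restrict_univ] at this
    rw [this]; exact ENNReal.one_lt_top
  refine Measure.pi_eq fun s hs => ?_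
  rw [withDensity_apply _ (MeasurableSet.univ_pi hs), Measure.restrict_pi_pi,
    ← ofReal_integral_eq_lintegral_ofReal, integral_fintype_prod_eq_prod,
    ENNReal.ofReal_prod_of_nonneg (fun i _ => integral_nonneg (hg0 i))]
  · refine Finset.prod_congr rfl fun i _ => ?_
    rw [hν i, withDensity_apply _ (hs i), ofReal_integral_eq_lintegral_ofReal]
    · exact (hint i).restrict
    · exact Filter.Eventually.of_forall (hg0 i)
  · exact Integrable.fintype_prod_dep fun i => (hint i).restrict
  · exact Filter.Eventually.of_forall fun x => Finset.prod_nonneg fun i _ => hg0 i _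

theorem gaussianReal_eq_withDensity {v : ℝ≥0} (hv : v ≠ 0) (h : ℝ) :
    gaussianReal h v = (gaussianReal 0 v).withDensity
      fun x => ENNReal.ofReal (Real.exp (h * x / v - h ^ 2 / (2 * v))) := by
  rw [gaussianReal_of_var_ne_zero _ hv, gaussianReal_of_var_ne_zero _ hv,
    ← withDensity_mul _ (measurable_gaussianPDF 0 v) (by fun_prop)]
  congr 1
  ext x
  simp only [Pi.mul_apply, gaussianPDF_def]
  rw [← ENNReal.ofReal_mul (gaussianPDFReal_nonneg _ _ _)]
  congr 1
  simp only [gaussianPDFReal_def, mul_assoc, ← Real.exp_add]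
  congr 2
  have : (v : ℝ) ≠ 0 := by exact_mod_cast hv
  field_simp
  ring

/-- The law of independent centred Gaussian coordinates of standard deviation `σ`. -/
noncomputable def isoGaussian (n : ℕ) (σ : ℝ) : Measure (Vec n) :=
  multivariateGaussian 0 (σ ^ 2 • (1 : Matrix (Fin n) (Fin n) ℝ))

theorem isoGaussian_eq_map_pi (n : ℕ) (σ : ℝ) :
    isoGaussian n σ =
      (Measure.pi fun _ : Fin n => gaussianReal 0 (σ ^ 2).toNNReal).map (WithLp.toLp 2) := by
  unfold isoGaussian
  have hS : (σ ^ 2 • (1 : Matrix (Fin n) (Fin n) ℝ)).PosSemidef :=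
    Matrix.PosSemidef.one.smul (sq_nonneg σ)
  have : IsProbabilityMeasure ((Measure.pi fun _ : Fin n =>
      gaussianReal 0 (σ ^ 2).toNNReal).map (WithLp.toLp 2)) :=
    Measure.isProbabilityMeasure_map (by fun_prop)
  apply Measure.ext_of_charFun (E := EuclideanSpace ℝ (Fin n))
  ext t
  rw [charFun_multivariateGaussian hS, charFun_pi]
  simp_rw [charFun_gaussianReal]
  rw [← Complex.exp_sum]
  congr 1
  simp [Matrix.smul_mulVec, dotProduct, Real.coe_toNNReal _ (sq_nonneg σ),
    Finset.sum_div, ← sq, Finset.sum_neg_distrib, mul_comm, mul_left_comm]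

/-- The Cameron–Martin density, assembled from the one-dimensional tilts of the coordinates. -/
theorem isoGaussian_map_add {n : ℕ} {σ : ℝ} (hσ : 0 < σ) (h : Vec n) :
    (isoGaussian n σ).map (fun z => h + z) = (isoGaussian n σ).withDensity
      fun z => ENNReal.ofReal (Real.exp (⟪h, z⟫ / σ ^ 2 - ‖h‖ ^ 2 / (2 * σ ^ 2))) := by
  set v : ℝ≥0 := (σ ^ 2).toNNReal with hv
  have hvr : (v : ℝ) = σ ^ 2 := Real.coe_toNNReal _ (sq_nonneg σ)
  have hv0 : v ≠ 0 := by
    rw [← NNReal.coe_ne_zero, hvr]; positivity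
  have h1 : (Measure.pi fun _ : Fin n => gaussianReal 0 v).map (fun x i => h i + x i) =
      Measure.pi fun i : Fin n => gaussianReal (h i) v := by
    have := Measure.pi_map_pi (μ := fun _ : Fin n => gaussianReal 0 v)
      (f := fun i x => h i + x) (fun i => by fun_prop)
    rw [this]
    simp_rw [gaussianReal_map_const_add, zero_add]
  have h2 := pi_eq_withDensity (fun _ : Fin n => gaussianReal 0 v)
    (fun i : Fin n => gaussianReal (h i) v)
    (fun i x => Real.exp (h i * x / v - h i ^ 2 / (2 * v))) (fun i => by fun_prop)
    (fun i x => (Real.exp_pos _).le) (fun i => gaussianReal_eq_withDensity hv0 (h i))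
  have hm : Measurable (WithLp.toLp 2 : (Fin n → ℝ) → Vec n) := by fun_prop
  rw [isoGaussian_eq_map_pi, Measure.map_map (by fun_prop) hm]
  have h3 : (fun z : Vec n => h + z) ∘ (WithLp.toLp 2 : (Fin n → ℝ) → Vec n) =
      (WithLp.toLp 2) ∘ (fun (x : Fin n → ℝ) i => h i + x i) := by
    ext x i; simp
  rw [h3, ← Measure.map_map hm (by fun_prop), h1, h2]
  ext s hs
  rw [Measure.map_apply hm hs, withDensity_apply _ (hm hs), withDensity_apply _ hs,
    setLIntegral_map hs (by fun_prop) hm]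
  refine lintegral_congr fun x => ?_
  congr 1
  rw [← Real.exp_sum]
  congr 1
  rw [Finset.sum_sub_distrib, hvr, ← Finset.sum_div, ← Finset.sum_div,
    EuclideanSpace.real_norm_sq_eq]
  simp [PiLp.inner_apply, mul_comm]

variable {ι : Type*} [Fintype ι] [DecidableEq ι]

theorem multivariateGaussian_map_inner {K : Matrix ι ι ℝ} (hK : K.PosSemidef)
    (a : EuclideanSpace ℝ ι) :
    (multivariateGaussian 0 K).map (fun x => ⟪a, x⟫) =
      gaussianReal 0 (a.ofLp ⬝ᵥ (K.mulVec a.ofLp)).toNNReal := by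
  have h := IsGaussian.map_eq_gaussianReal (μ := multivariateGaussian 0 K) (innerSL ℝ a)
  have h1 : ⇑(innerSL ℝ a) = fun x => ⟪a, x⟫ := by ext; simp
  rw [h1] at h
  rw [h]
  have h2 : ∫ x, ⟪a, x⟫ ∂(multivariateGaussian 0 K) = 0 := by
    rw [← h1, IsGaussian.integral_dual]; simp
  have h3 : Var[fun x => ⟪a, x⟫; multivariateGaussian 0 K] =
      a.ofLp ⬝ᵥ (K.mulVec a.ofLp) := by
    rw [← covarianceBilin_multivariateGaussian (μ := 0) hK a a,
      covarianceBilin_self IsGaussian.memLp_two_id]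
  rw [h2, h3]

theorem lintegral_exp_gaussianReal (v : ℝ≥0) (t : ℝ) :
    ∫⁻ x, ENNReal.ofReal (Real.exp (t * x)) ∂(gaussianReal 0 v) =
      ENNReal.ofReal (Real.exp (v * t ^ 2 / 2)) := by
  rw [← ofReal_integral_eq_lintegral_ofReal (integrable_exp_mul_gaussianReal t)
    (Filter.Eventually.of_forall fun x => (Real.exp_pos _).le)]
  have := mgf_gaussianReal (p := gaussianReal 0 v) (X := id) (by rw [Measure.map_id]) t
  rw [mgf] at this
  simp only [id] at this
  rw [this]; simp

theorem lintegral_exp_inner_multivariateGaussian {K : Matrix ι ι ℝ} (hK : K.PosSemidef)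
    (a : EuclideanSpace ℝ ι) :
    ∫⁻ x, ENNReal.ofReal (Real.exp ⟪a, x⟫) ∂(multivariateGaussian 0 K) =
      ENNReal.ofReal (Real.exp ((a.ofLp ⬝ᵥ (K.mulVec a.ofLp)) / 2)) := by
  have h := lintegral_exp_gaussianReal (a.ofLp ⬝ᵥ (K.mulVec a.ofLp)).toNNReal 1
  rw [← multivariateGaussian_map_inner hK, lintegral_map (by fun_prop) (by fun_prop)] at h
  have h0 : 0 ≤ a.ofLp ⬝ᵥ (K.mulVec a.ofLp) := by
    simpa using hK.dotProduct_mulVec_nonneg a.ofLp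
  simpa [Real.coe_toNNReal _ h0] using h

theorem lintegral_enorm_inner_sq_multivariateGaussian {K : Matrix ι ι ℝ} (hK : K.PosSemidef)
    (a : EuclideanSpace ℝ ι) :
    ∫⁻ x, ‖⟪a, x⟫‖ₑ ^ 2 ∂(multivariateGaussian 0 K) =
      ENNReal.ofReal (a.ofLp ⬝ᵥ (K.mulVec a.ofLp)) := by
  set v := (a.ofLp ⬝ᵥ (K.mulVec a.ofLp)).toNNReal
  have h : ∫⁻ x, ‖⟪a, x⟫‖ₑ ^ 2 ∂(multivariateGaussian 0 K) =
      ∫⁻ y, ‖y‖ₑ ^ 2 ∂(gaussianReal 0 v) := by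
    rw [← multivariateGaussian_map_inner hK, lintegral_map (by fun_prop) (by fun_prop)]
  rw [h]
  have h1 := variance_id_gaussianReal (μ := 0) (v := v)
  have h2 : evariance id (gaussianReal 0 v) = ENNReal.ofReal Var[id; gaussianReal 0 v] :=
    (MemLp.ofReal_variance_eq (memLp_id_gaussianReal 2)).symm
  rw [evariance, h1] at h2
  simp only [id, integral_id_gaussianReal, sub_zero] at h2
  have h0 : 0 ≤ a.ofLp ⬝ᵥ (K.mulVec a.ofLp) := by
    simpa using hK.dotProduct_mulVec_nonneg a.ofLp
  rw [h2, Real.coe_toNNReal _ h0]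

theorem isoGaussian_map_inner {n : ℕ} (σ : ℝ) (a : Vec n) :
    (isoGaussian n σ).map (fun x => ⟪a, x⟫) = gaussianReal 0 (σ ^ 2 * ‖a‖ ^ 2).toNNReal := by
  unfold isoGaussian
  rw [multivariateGaussian_map_inner (Matrix.PosSemidef.one.smul (sq_nonneg σ))]
  congr 2
  rw [Matrix.smul_mulVec, Matrix.one_mulVec, dotProduct_smul, EuclideanSpace.real_norm_sq_eq]
  simp [dotProduct, sq]

theorem lintegral_exp_inner_isoGaussian {n : ℕ} (σ : ℝ) (a : Vec n) :
    ∫⁻ x, ENNReal.ofReal (Real.exp ⟪a, x⟫) ∂(isoGaussian n σ) =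
      ENNReal.ofReal (Real.exp (σ ^ 2 * ‖a‖ ^ 2 / 2)) := by
  have h := lintegral_exp_gaussianReal (σ ^ 2 * ‖a‖ ^ 2).toNNReal 1
  rw [← isoGaussian_map_inner, lintegral_map (by fun_prop) (by fun_prop)] at h
  simpa [Real.coe_toNNReal _ (by positivity : 0 ≤ σ ^ 2 * ‖a‖ ^ 2)] using h

instance isProbabilityMeasure_isoGaussian (n : ℕ) (σ : ℝ) :
    IsProbabilityMeasure (isoGaussian n σ) := by
  unfold isoGaussian; infer_instance

theorem integrable_exp_inner_isoGaussian {n : ℕ} (σ : ℝ) (a : Vec n) :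
    Integrable (fun x => Real.exp ⟪a, x⟫) (isoGaussian n σ) := by
  refine ⟨by fun_prop, ?_⟩
  rw [hasFiniteIntegral_iff_ofReal (Filter.Eventually.of_forall fun x => (Real.exp_pos _).le),
    lintegral_exp_inner_isoGaussian]
  exact ENNReal.ofReal_lt_top

theorem integral_exp_inner_isoGaussian {n : ℕ} (σ : ℝ) (a : Vec n) :
    ∫ x, Real.exp ⟪a, x⟫ ∂(isoGaussian n σ) = Real.exp (σ ^ 2 * ‖a‖ ^ 2 / 2) := by
  rw [integral_eq_lintegral_of_nonneg_ae (Filter.Eventually.of_forall fun x => (Real.exp_pos _).le)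
    (by fun_prop), lintegral_exp_inner_isoGaussian, ENNReal.toReal_ofReal (Real.exp_pos _).le]

/-- The means of a bounded function under two shifts of an isotropic Gaussian law differ by at most
a multiple of the distance between the shifts. -/
theorem abs_integral_shift_sub_le {n : ℕ} {σ : ℝ} (hσ : 0 < σ) {φ : Vec n → ℝ}
    (hφ : Measurable φ) {B : ℝ} (hB : ∀ x, |φ x| ≤ B) (a b : Vec n) :
    |∫ z, φ (a + z) ∂(isoGaussian n σ) - ∫ z, φ (b + z) ∂(isoGaussian n σ)| ≤
      2 * B * (‖a - b‖ / σ) := by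
  have hB0 : 0 ≤ B := (abs_nonneg _).trans (hB 0)
  set h := a - b with hh
  set t := ‖h‖ / σ with ht
  have ht0 : 0 ≤ t := by positivity
  set μ := isoGaussian n σ
  have hbd : ∀ c : Vec n, |∫ z, φ (c + z) ∂μ| ≤ B := by
    intro c
    have := norm_integral_le_of_norm_le_const (μ := μ) (f := fun z => φ (c + z)) (C := B)
      (Filter.Eventually.of_forall fun z => hB _)
    simpa using this
  -- For `t ≥ 1` the trivial bound `2B` is enough; only small shifts need the density.
  rcases le_or_gt 1 t with h1 | h1
  · have h2 := abs_sub (∫ z, φ (a + z) ∂μ) (∫ z, φ (b + z) ∂μ)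
    nlinarith [hbd a, hbd b]
  rcases eq_or_lt_of_le ht0 with h0 | h0
  · have : h = 0 := by
      rw [ht] at h0
      rcases div_eq_zero_iff.1 h0.symm with h3 | h3
      · exact norm_eq_zero.1 h3
      · exact absurd h3 hσ.ne'
    have hab : a = b := sub_eq_zero.1 this
    rw [hab]; simp; positivity
  set w : Vec n → ℝ := fun z => Real.exp (⟪h, z⟫ / σ ^ 2 - ‖h‖ ^ 2 / (2 * σ ^ 2)) with hw
  have hwm : Measurable w := by fun_prop
  have hw_eq : ∀ z, w z = Real.exp ⟪(σ ^ 2)⁻¹ • h, z⟫ * Real.exp (-(t ^ 2 / 2)) := by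
    intro z
    simp only [hw]
    rw [← Real.exp_add]
    congr 1
    rw [real_inner_smul_left, ht]
    field_simp
    ring
  have hw2_eq : ∀ z, w z ^ 2 = Real.exp ⟪(2 * (σ ^ 2)⁻¹) • h, z⟫ * Real.exp (-t ^ 2) := by
    intro z
    rw [hw_eq, mul_pow, ← Real.exp_nat_mul, ← Real.exp_nat_mul, mul_smul,
      real_inner_smul_left _ _ 2]
    congr 2
    push_cast; ring
  have hnorm : ∀ c : ℝ, σ ^ 2 * ‖(c * (σ ^ 2)⁻¹) • h‖ ^ 2 / 2 = c ^ 2 * t ^ 2 / 2 := by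
    intro c
    rw [norm_smul, mul_pow, Real.norm_eq_abs, sq_abs, ht]
    field_simp
  have hwint : Integrable w μ := by
    simp_rw [funext hw_eq]
    exact (integrable_exp_inner_isoGaussian σ _).mul_const _
  have hw2int : Integrable (fun z => w z ^ 2) μ := by
    simp_rw [hw2_eq]
    exact (integrable_exp_inner_isoGaussian σ _).mul_const _
  have hw1 : ∫ z, w z ∂μ = 1 := by
    simp_rw [hw_eq]
    rw [integral_mul_const, integral_exp_inner_isoGaussian, ← Real.exp_add]
    have := hnorm 1
    rw [one_mul] at this
    rw [this]; simp
  have hw2 : ∫ z, w z ^ 2 ∂μ = Real.exp (t ^ 2) := by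
    simp_rw [hw2_eq]
    rw [integral_mul_const, integral_exp_inner_isoGaussian, ← Real.exp_add, hnorm 2]
    congr 1; ring
  have key : ∫ z, φ (a + z) ∂μ = ∫ z, w z * φ (b + z) ∂μ := by
    have e1 : ∫ z, φ (a + z) ∂μ = ∫ y, φ (b + y) ∂(μ.map fun z => h + z) := by
      rw [integral_map (f := fun y => φ (b + y)) (by fun_prop)
        (hφ.comp (measurable_const_add b)).aestronglyMeasurable]
      refine integral_congr_ae (Filter.Eventually.of_forall fun z => ?_)
      simp only [hh]
      congr 1; abel
    rw [e1, isoGaussian_map_add hσ, integral_withDensity_eq_integral_toReal_smul (by fun_prop)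
      (Filter.Eventually.of_forall fun _ => ENNReal.ofReal_lt_top)]
    refine integral_congr_ae (Filter.Eventually.of_forall fun z => ?_)
    simp only [smul_eq_mul]
    rw [ENNReal.toReal_ofReal (Real.exp_pos _).le]
  have hφint : Integrable (fun z => φ (b + z)) μ :=
    Integrable.of_bound (hφ.comp (measurable_const_add b)).aestronglyMeasurable B
      (Filter.Eventually.of_forall fun z => hB _)
  have hwφ : Integrable (fun z => w z * φ (b + z)) μ :=
    hwint.mul_bdd (c := B) (hφ.comp (measurable_const_add b)).aestronglyMeasurable
      (Filter.Eventually.of_forall fun z => hB _)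
  -- The χ²-distance of the two shifted laws, at most `2t²` for `t ≤ 1`. Below, `|w - 1| ≤ ((w -
  -- 1)²/t + t)/2` takes the place of the Cauchy–Schwarz inequality.
  have hsq : ∫ z, (w z - 1) ^ 2 ∂μ = Real.exp (t ^ 2) - 1 := by
    have : ∀ z, (w z - 1) ^ 2 = w z ^ 2 - 2 * w z + 1 := fun z => by ring
    simp_rw [this]
    rw [integral_add (f := fun z => w z ^ 2 - 2 * w z) (hw2int.sub (hwint.const_mul 2))
      (integrable_const _),
      integral_sub hw2int (hwint.const_mul 2), integral_const_mul, hw1, hw2]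
    simp; ring
  have hsqint : Integrable (fun z => (w z - 1) ^ 2) μ := by
    have : ∀ z, (w z - 1) ^ 2 = w z ^ 2 - 2 * w z + 1 := fun z => by ring
    simp_rw [this]
    exact (hw2int.sub (hwint.const_mul 2)).add (integrable_const _)
  have hexp : Real.exp (t ^ 2) - 1 ≤ 2 * t ^ 2 := by
    have h3 : |t ^ 2| ≤ 1 := by rw [abs_of_nonneg (sq_nonneg t)]; nlinarith
    have := Real.abs_exp_sub_one_le h3
    rw [abs_of_nonneg (sq_nonneg t)] at this
    exact (le_abs_self _).trans this
  rw [key, ← integral_sub hwφ hφint]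
  calc |∫ z, (w z * φ (b + z) - φ (b + z)) ∂μ|
      ≤ ∫ z, B * (((w z - 1) ^ 2 / t + t) / 2) ∂μ := by
        rw [← Real.norm_eq_abs]
        refine norm_integral_le_of_norm_le
          ((((hsqint.div_const t).add (integrable_const t)).div_const 2).const_mul B)
          (Filter.Eventually.of_forall fun z => ?_)
        have e : w z * φ (b + z) - φ (b + z) = φ (b + z) * (w z - 1) := by ring
        rw [e, norm_mul]
        refine mul_le_mul (hB _) ?_ (norm_nonneg _) hB0
        rw [Real.norm_eq_abs, le_div_iff₀ two_pos, div_add' _ _ _ h0.ne', le_div_iff₀ h0]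
        nlinarith [sq_nonneg (|w z - 1| - t), sq_abs (w z - 1)]
    _ = B * (((Real.exp (t ^ 2) - 1) / t + t) / 2) := by
        rw [integral_const_mul, integral_div, integral_add (hsqint.div_const t)
          (integrable_const t), integral_div, hsq]
        simp
    _ ≤ B * ((2 * t ^ 2 / t + t) / 2) := by gcongr
    _ ≤ 2 * B * t := by
        have : 2 * t ^ 2 / t = 2 * t := by field_simp
        rw [this]; nlinarith [mul_nonneg hB0 ht0]

section Moments

variable {E : Type*} [NormedAddCommGroup E] [NormedSpace ℝ E] [SecondCountableTopology E]
  [MeasurableSpace E] [BorelSpace E]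

/-- The fourth moment of a seminorm of a centred Gaussian vector is controlled by its second
moment. -/
theorem lintegral_pow_four_le_of_rotation {μ : Measure E} [IsProbabilityMeasure μ]
    (hμ : (μ.prod μ).map (ContinuousLinearMap.rotation (-(Real.pi / 4))) = μ.prod μ)
    {N : E → ℝ≥0∞} (hN : Measurable N) (hadd : ∀ x y, N (x + y) ≤ N x + N y)
    (hsmul : ∀ (c : ℝ) x, N (c • x) = ‖c‖ₑ * N x) {b : ℝ≥0∞} (hb0 : b ≠ 0) (hb : b ≠ ∞)
    (h2 : ∫⁻ x, N x ^ 2 ∂μ ≤ b ^ 2) :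
    ∫⁻ x, N x ^ 4 ∂μ ≤ (4 * b) ^ 4 := by
  -- Fernique's argument: by Chebyshev an independent copy `y` lies in the ball of radius `2b` with
  -- probability at least `3/4`.
  have hmarkov : μ {x | 2 * b < N x} ≤ 1 / 4 := by
    have h1 : (2 * b) ^ 2 * μ {x | 2 * b < N x} ≤ b ^ 2 := by
      refine le_trans ?_ h2
      refine le_trans ?_ (mul_meas_ge_le_lintegral (hN.pow_const 2) ((2 * b) ^ 2))
      gcongr
      rename_i x
      intro hx
      exact pow_le_pow_left' (le_of_lt hx) 2
    have hb2 : b ^ 2 ≠ 0 := pow_ne_zero 2 hb0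
    have hb2' : b ^ 2 ≠ ∞ := ENNReal.pow_ne_top hb
    rw [mul_pow, mul_comm (2 ^ 2 : ℝ≥0∞), mul_assoc] at h1
    have h3 : 2 ^ 2 * μ {x | 2 * b < N x} ≤ 1 := by
      rw [← ENNReal.mul_le_mul_iff_right hb2 hb2', mul_one]; exact h1
    rw [ENNReal.le_div_iff_mul_le (by simp) (by simp), mul_comm]
    norm_num at h3 ⊢
    exact h3
  have hcompl : 3 / 4 ≤ μ {x | N x ≤ 2 * b} := by
    have h1 : {x | N x ≤ 2 * b} = {x | 2 * b < N x}ᶜ := by ext; simp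
    rw [h1, prob_compl_eq_one_sub (measurableSet_lt measurable_const hN)]
    refine le_trans ?_ (tsub_le_tsub_left hmarkov 1)
    rw [ENNReal.le_sub_iff_add_le_right (by simp) (by simp)]
    rw [ENNReal.div_add_div_same, show (3 + 1 : ℝ≥0∞) = 4 by norm_num]
    exact ENNReal.div_self_le_one
  have hrot : ∀ x y : E, (ContinuousLinearMap.rotation (-(Real.pi / 4))) (x, y) =
      ((√2)⁻¹ • (x - y), (√2)⁻¹ • (x + y)) := by
    intro x y
    have : (2⁻¹ : ℝ) * √2 = (√2)⁻¹ := by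
      rw [eq_comm, inv_eq_iff_eq_inv, mul_inv, inv_inv]
      have h2 := Real.mul_self_sqrt (show (0 : ℝ) ≤ 2 by norm_num)
      field_simp; rw [sq]; linarith
    rw [ContinuousLinearMap.rotation_apply]
    simp only [Real.cos_neg, Real.cos_pi_div_four, Real.sin_neg, Real.sin_pi_div_four, neg_neg]
    simp only [div_eq_inv_mul, this, neg_smul, smul_neg, smul_add, sub_eq_add_neg]
  have hs2 : ‖√2‖ₑ ^ 2 = 2 := by
    rw [← enorm_pow, Real.sq_sqrt (by norm_num), Real.enorm_eq_ofReal (by norm_num)]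
    simp
  -- If `N y ≤ 2b`, the truncated difference `N x - 2b` is at most both `N (x - y)` and `N (x + y)`.
  -- The factor `4` comes from normalising both arguments by `√2`.
  have hpt : ∀ x y : E, {y | N y ≤ 2 * b}.indicator (fun _ => (N x - 2 * b) ^ 4) y ≤
      4 * (N ((√2)⁻¹ • (x - y)) ^ 2 * N ((√2)⁻¹ • (x + y)) ^ 2) := by
    intro x y
    by_cases hy : N y ≤ 2 * b
    swap
    · simp [hy]
    have hmem : y ∈ {y | N y ≤ 2 * b} := hy
    rw [Set.indicator_of_mem hmem]
    have hs : ∀ v : E, v = √2 • ((√2)⁻¹ • v) := by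
      intro v
      rw [smul_smul, mul_inv_cancel₀ (by positivity), one_smul]
    have hneg : N (-y) = N y := by
      have := hsmul (-1) y
      simpa using this
    have h1 : N x - 2 * b ≤ ‖√2‖ₑ * N ((√2)⁻¹ • (x - y)) := by
      rw [← hsmul, ← hs, tsub_le_iff_right]
      calc N x = N ((x - y) + y) := by rw [sub_add_cancel]
        _ ≤ N (x - y) + N y := hadd _ _
        _ ≤ _ := by gcongr
    have h3 : N x - 2 * b ≤ ‖√2‖ₑ * N ((√2)⁻¹ • (x + y)) := by
      rw [← hsmul, ← hs, tsub_le_iff_right]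
      calc N x = N ((x + y) + -y) := by rw [add_neg_cancel_right]
        _ ≤ N (x + y) + N (-y) := hadd _ _
        _ ≤ _ := by rw [hneg]; gcongr
    calc (N x - 2 * b) ^ 4 = (N x - 2 * b) ^ 2 * (N x - 2 * b) ^ 2 := by ring
      _ ≤ (‖√2‖ₑ * N ((√2)⁻¹ • (x - y))) ^ 2 * (‖√2‖ₑ * N ((√2)⁻¹ • (x + y))) ^ 2 := by gcongr
      _ = _ := by rw [mul_pow, mul_pow, hs2]; ring
  -- The rotation by `π/4` preserves the product law, so the normalised difference and sum are again
  -- independent copies and the fourth-order mean factors into two second moments.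
  have hmain : (3 / 4) * ∫⁻ x, (N x - 2 * b) ^ 4 ∂μ ≤ 4 * (b ^ 2 * b ^ 2) := by
    calc (3 / 4) * ∫⁻ x, (N x - 2 * b) ^ 4 ∂μ
        ≤ (∫⁻ x, (N x - 2 * b) ^ 4 ∂μ) * μ {x | N x ≤ 2 * b} := by
          rw [mul_comm]; gcongr
      _ = ∫⁻ x, ∫⁻ y, {y | N y ≤ 2 * b}.indicator (fun _ => (N x - 2 * b) ^ 4) y ∂μ ∂μ := by
          rw [← lintegral_mul_const _ ((hN.sub_const _).pow_const 4)]
          refine lintegral_congr fun x => ?_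
          rw [lintegral_indicator_const (measurableSet_le hN measurable_const)]
      _ ≤ ∫⁻ x, ∫⁻ y, 4 * (N ((√2)⁻¹ • (x - y)) ^ 2 * N ((√2)⁻¹ • (x + y)) ^ 2) ∂μ ∂μ :=
          lintegral_mono fun x => lintegral_mono fun y => hpt x y
      _ = ∫⁻ p, 4 * (N p.1 ^ 2 * N p.2 ^ 2)
            ∂((μ.prod μ).map (ContinuousLinearMap.rotation (-(Real.pi / 4)))) := by
          rw [lintegral_map (by fun_prop) (by fun_prop), lintegral_prod _ (by fun_prop)]
          simp only [hrot]
      _ = 4 * ((∫⁻ x, N x ^ 2 ∂μ) * ∫⁻ x, N x ^ 2 ∂μ) := by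
          rw [hμ, lintegral_const_mul _ (by fun_prop),
            lintegral_prod_mul (f := fun x => N x ^ 2) (g := fun x => N x ^ 2)
              (by fun_prop) (by fun_prop)]
      _ ≤ 4 * (b ^ 2 * b ^ 2) := by gcongr
  -- The factor `3/4` is weakened to `1/4`, which makes the final constant the perfect power `8 (16
  -- + 2⁴) = 4⁴`.
  have hmain' : ∫⁻ x, (N x - 2 * b) ^ 4 ∂μ ≤ 16 * b ^ 4 := by
    have h1 : (1 / 4 : ℝ≥0∞) * ∫⁻ x, (N x - 2 * b) ^ 4 ∂μ ≤ 4 * (b ^ 2 * b ^ 2) :=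
      le_trans (by gcongr; norm_num) hmain
    rw [one_div, ← ENNReal.div_eq_inv_mul, ENNReal.div_le_iff (by simp) (by simp)] at h1
    refine h1.trans (le_of_eq ?_)
    ring
  have hfour : ∀ u v : ℝ≥0∞, (u + v) ^ 4 ≤ 8 * (u ^ 4 + v ^ 4) := by
    intro u v
    have := ENNReal.rpow_add_le_mul_rpow_add_rpow u v (p := 4) (by norm_num)
    have h3 : (2 : ℝ≥0∞) ^ ((4 : ℝ) - 1) = 8 := by
      rw [show (4 : ℝ) - 1 = ((3 : ℕ) : ℝ) by norm_num, ENNReal.rpow_natCast]; norm_num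
    rw [h3] at this
    exact_mod_cast this
  calc ∫⁻ x, N x ^ 4 ∂μ ≤ ∫⁻ x, 8 * ((N x - 2 * b) ^ 4 + (2 * b) ^ 4) ∂μ := by
        refine lintegral_mono fun x => le_trans ?_ (hfour _ _)
        gcongr
        exact le_tsub_add
    _ = 8 * (∫⁻ x, (N x - 2 * b) ^ 4 ∂μ + (2 * b) ^ 4) := by
        rw [lintegral_const_mul _ (by fun_prop), lintegral_add_right _ measurable_const]
        simp
    _ ≤ 8 * (16 * b ^ 4 + (2 * b) ^ 4) := by gcongr
    _ = (4 * b) ^ 4 := by ring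

end Moments

end GaussianTools

section Measurability

variable {ds da : ℕ} {α : Type*} [MeasurableSpace α]

theorem measurable_stateAction :
    Measurable fun p : Vec ds × Vec da => stateAction p.1 p.2 := by
  refine (WithLp.measurable_toLp 2 _).comp (measurable_pi_iff.2 fun i => ?_)
  rcases i with i | i
  · simp only [Sum.elim_inl]; fun_prop
  · simp only [Sum.elim_inr]; fun_prop

theorem Measurable.meanReward {θ : α → Param ds da} {s : α → Vec ds} {a : α → Vec da}
    (hθ : Measurable θ) (hs : Measurable s) (ha : Measurable a) :
    Measurable fun x => meanReward (θ x) (s x) (a x) :=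
  hθ.fst.inner (measurable_stateAction.comp (hs.prodMk ha))

theorem Measurable.meanNext {θ : α → Param ds da} {s : α → Vec ds} {a : α → Vec da}
    (hθ : Measurable θ) (hs : Measurable s) (ha : Measurable a) :
    Measurable fun x => meanNext (θ x) (s x) (a x) := by
  refine (WithLp.measurable_toLp 2 _).comp (measurable_pi_iff.2 fun i => ?_)
  exact ((measurable_pi_apply i).comp hθ.snd).inner
    (measurable_stateAction.comp (hs.prodMk ha))

end Measurability

/-- This is the form in which the freshness of a single step's noise is used: one coordinate of an
i.i.d. sequence may be overwritten by an independent copy. It is checked on cylinder sets. -/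
theorem measurePreserving_update_infinitePi {X : Type*} [MeasurableSpace X] (ν : Measure X)
    [IsProbabilityMeasure ν] (i : ℕ) :
    MeasurePreserving (fun p : (ℕ → X) × X => Function.update p.1 i p.2)
      ((Measure.infinitePi fun _ : ℕ => ν).prod ν) (Measure.infinitePi fun _ : ℕ => ν) := by
  have hm : Measurable fun p : (ℕ → X) × X => Function.update p.1 i p.2 := by
    refine measurable_pi_iff.2 fun j => ?_
    by_cases h : j = i
    · subst h; simpa using measurable_snd
    · simp only [Function.update_of_ne h]
      exact (measurable_pi_apply j).comp measurable_fst
  refine ⟨hm, ?_⟩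
  refine Measure.eq_infinitePi _ fun s t ht => ?_
  rw [Measure.map_apply hm (.pi s.countable_toSet fun j _ => ht j)]
  have hpre : (fun p : (ℕ → X) × X => Function.update p.1 i p.2) ⁻¹' Set.pi s t =
      (Set.pi (s.erase i : Finset ℕ) t) ×ˢ (if i ∈ s then t i else Set.univ) := by
    ext p
    simp only [Set.mem_preimage, Set.mem_pi, Set.mem_prod, Finset.mem_coe, Finset.mem_erase]
    constructor
    · intro h
      refine ⟨fun j hj => by simpa [hj.1] using h j hj.2, ?_⟩
      split_ifs with hi
      · simpa using h i hi
      · trivial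
    · rintro ⟨h1, h2⟩ j hj
      by_cases hji : j = i
      · subst hji; simpa [hj] using h2
      · simpa [hji] using h1 j ⟨hji, hj⟩
  rw [hpre, Measure.prod_prod, Measure.infinitePi_pi _ fun j _ => ht j]
  by_cases hi : i ∈ s
  · rw [if_pos hi, ← Finset.mul_prod_erase s _ hi, mul_comm]
  · rw [if_neg hi, measure_univ, mul_one, Finset.erase_eq_of_notMem hi]

namespace ControlProblem

variable {ds da : ℕ} (M : ControlProblem ds da)

/-! ### Trajectories, value functions and the Bellman equation. -/

section Dynamics

variable {α : Type*} [MeasurableSpace α] {θ : α → Param ds da} {μ : α → ℕ → Vec ds → Vec da}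

theorem measurable_policy_apply (hμ : ∀ i, Measurable fun p : α × Vec ds => μ p.1 i p.2) (i : ℕ)
    {s : α → Vec ds} (hs : Measurable s) : Measurable fun x => μ x i (s x) :=
  (hμ i).comp (measurable_id.prodMk hs)

theorem measurable_rawState (hθ : Measurable θ)
    (hμ : ∀ i, Measurable fun p : α × Vec ds => μ p.1 i p.2) {ξ : α → EpisodeNoise ds}
    (hξ : Measurable ξ) (i : ℕ) : Measurable fun x => M.rawState (θ x) (μ x) (ξ x) i := by
  induction i with
  | zero => exact hξ.fst
  | succ i ih =>
    have hs : Measurable fun x => M.proj (M.rawState (θ x) (μ x) (ξ x) i) :=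
      M.measurable_proj.comp ih
    have h1 := hθ.meanNext hs (measurable_policy_apply hμ i hs)
    exact h1.add (((measurable_pi_apply i).comp hξ.snd).fst)

theorem measurable_observation (hθ : Measurable θ)
    (hμ : ∀ i, Measurable fun p : α × Vec ds => μ p.1 i p.2) {ξ : α → EpisodeNoise ds}
    (hξ : Measurable ξ) (i : ℕ) : Measurable fun x => M.observation (θ x) (μ x) (ξ x) i := by
  have hy := M.measurable_rawState hθ hμ hξ i
  have hs : Measurable fun x => M.proj (M.rawState (θ x) (μ x) (ξ x) i) :=
    M.measurable_proj.comp hy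
  have ha := measurable_policy_apply hμ i hs
  exact hy.prodMk (ha.prodMk ((hθ.meanReward hs ha).add
    ((measurable_pi_apply i).comp hξ.snd).snd))

theorem measurable_returnFrom (n : ℕ) : ∀ {α : Type _} [MeasurableSpace α] {θ : α → Param ds da}
    {μ : α → ℕ → Vec ds → Vec da} (_ : Measurable θ)
    (_ : ∀ i, Measurable fun p : α × Vec ds => μ p.1 i p.2) (i : ℕ) {s : α → Vec ds}
    (_ : Measurable s) {z : α → Fin n → Vec ds} (_ : Measurable z),
    Measurable fun x => M.returnFrom (θ x) (μ x) n i (s x) (z x) := by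
  induction n with
  | zero => intros; exact measurable_const
  | succ n ih =>
    intro α _ θ μ hθ hμ i s hs z hz
    have ha := measurable_policy_apply hμ i hs
    have h1 := hθ.meanReward hs ha
    have h0 : Measurable fun x => z x 0 := (measurable_pi_apply 0).comp hz
    have ht : Measurable fun x => Fin.tail (z x) :=
      measurable_pi_iff.2 fun j => (measurable_pi_apply j.succ).comp hz
    exact h1.add (ih hθ hμ (i + 1)
      (M.measurable_proj.comp ((hθ.meanNext hs ha).add h0)) ht)

/-- The expected sum of the mean rewards of `n` steps, starting at step `i`. -/
noncomputable def valueSteps (θ : Param ds da) (μ : ℕ → Vec ds → Vec da) (n i : ℕ) (s : Vec ds) :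
    ℝ :=
  ∫ z, M.returnFrom θ μ n i s z ∂(Measure.pi fun _ : Fin n => M.noiseF)

theorem measurable_valueSteps (hθ : Measurable θ)
    (hμ : ∀ i, Measurable fun p : α × Vec ds => μ p.1 i p.2) (n i : ℕ) {s : α → Vec ds}
    (hs : Measurable s) : Measurable fun x => M.valueSteps (θ x) (μ x) n i (s x) := by
  have h : Measurable fun p : α × (Fin n → Vec ds) =>
      M.returnFrom (θ p.1) (μ p.1) n i (s p.1) p.2 :=
    M.measurable_returnFrom n (hθ.comp measurable_fst)
      (fun j => (hμ j).comp ((measurable_fst.comp measurable_fst).prodMk measurable_snd)) i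
      (hs.comp measurable_fst) measurable_snd
  exact (h.stronglyMeasurable.integral_prod_right
    (ν := Measure.pi fun _ : Fin n => M.noiseF)).measurable

/-- The supremum of the absolute mean reward over the state and action spaces. -/
noncomputable def supReward (θ : Param ds da) : ℝ≥0∞ :=
  ⨆ s ∈ M.S, ⨆ a ∈ M.A, ‖meanReward θ s a‖ₑ

/-- Lower semicontinuity survives uncountable suprema, so no countability or separability argument
for the state and action spaces is needed. -/
theorem measurable_supReward : Measurable M.supReward := by
  refine LowerSemicontinuous.measurable ?_
  refine lowerSemicontinuous_iSup fun s => lowerSemicontinuous_iSup fun _ =>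
    lowerSemicontinuous_iSup fun a => lowerSemicontinuous_iSup fun _ => ?_
  refine Continuous.lowerSemicontinuous ?_
  unfold meanReward
  fun_prop

variable {M}

theorem abs_meanReward_le {θ : Param ds da} (hθ : M.supReward θ ≠ ∞) {s : Vec ds} (hs : s ∈ M.S)
    {a : Vec da} (ha : a ∈ M.A) : |meanReward θ s a| ≤ (M.supReward θ).toReal := by
  have h : ‖meanReward θ s a‖ₑ ≤ M.supReward θ :=
    le_iSup₂_of_le s hs (le_iSup₂_of_le a ha le_rfl)
  rw [← Real.norm_eq_abs, ← toReal_enorm]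
  exact ENNReal.toReal_mono hθ h

theorem abs_returnFrom_le {θ : Param ds da} (hθ : M.supReward θ ≠ ∞) {μ : ℕ → Vec ds → Vec da}
    (hμ : M.IsPolicy μ) (n : ℕ) : ∀ (i : ℕ) {s : Vec ds} (_ : s ∈ M.S) (z : Fin n → Vec ds),
    |M.returnFrom θ μ n i s z| ≤ n * (M.supReward θ).toReal := by
  induction n with
  | zero => intros; simp [returnFrom]
  | succ n ih =>
    intro i s hs z
    rw [returnFrom]
    refine (abs_add_le _ _).trans ?_
    have h1 := abs_meanReward_le hθ hs ((hμ i).2 s hs)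
    have h2 := ih (i + 1) (M.proj_mem (meanNext θ s (μ i s) + z 0)) (Fin.tail z)
    push_cast; linarith

theorem abs_valueSteps_le {θ : Param ds da} (hθ : M.supReward θ ≠ ∞) {μ : ℕ → Vec ds → Vec da}
    (hμ : M.IsPolicy μ) (n i : ℕ) {s : Vec ds} (hs : s ∈ M.S) :
    |M.valueSteps θ μ n i s| ≤ n * (M.supReward θ).toReal := by
  have := norm_integral_le_of_norm_le_const (μ := Measure.pi fun _ : Fin n => M.noiseF)
    (f := fun z => M.returnFrom θ μ n i s z)
    (Filter.Eventually.of_forall fun z => abs_returnFrom_le hθ hμ n i hs z)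
  simpa [valueSteps] using this

theorem IsPolicy.measurable_uncurry {μ : ℕ → Vec ds → Vec da} (hμ : M.IsPolicy μ) (i : ℕ) :
    Measurable fun p : α × Vec ds => μ i p.2 :=
  (hμ i).1.comp measurable_snd

/-- The Bellman equation. -/
theorem valueSteps_succ {θ : Param ds da} (hθ : M.supReward θ ≠ ∞) {μ : ℕ → Vec ds → Vec da}
    (hμ : M.IsPolicy μ) (n i : ℕ) (s : Vec ds) :
    M.valueSteps θ μ (n + 1) i s = meanReward θ s (μ i s) +
      ∫ z, M.valueSteps θ μ n (i + 1) (M.proj (meanNext θ s (μ i s) + z)) ∂M.noiseF := by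
  have hmp := measurePreserving_piFinSuccAbove (fun _ : Fin (n + 1) => M.noiseF) 0
  set g : Vec ds × (Fin n → Vec ds) → ℝ := fun p => meanReward θ s (μ i s) +
    M.returnFrom θ μ n (i + 1) (M.proj (meanNext θ s (μ i s) + p.1)) p.2 with hg
  have h1 : M.valueSteps θ μ (n + 1) i s =
      ∫ p, g p ∂(M.noiseF.prod (Measure.pi fun _ : Fin n => M.noiseF)) := by
    rw [← hmp.integral_comp (MeasurableEquiv.measurableEmbedding _)]
    rfl
  have hgm : Measurable fun p : Vec ds × (Fin n → Vec ds) =>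
      M.returnFrom θ μ n (i + 1) (M.proj (meanNext θ s (μ i s) + p.1)) p.2 :=
    M.measurable_returnFrom n measurable_const (fun j => hμ.measurable_uncurry j) (i + 1)
      (M.measurable_proj.comp (measurable_const.add measurable_fst)) measurable_snd
  have hint : Integrable (fun p : Vec ds × (Fin n → Vec ds) =>
      M.returnFrom θ μ n (i + 1) (M.proj (meanNext θ s (μ i s) + p.1)) p.2)
      (M.noiseF.prod (Measure.pi fun _ : Fin n => M.noiseF)) :=
    Integrable.of_bound hgm.aestronglyMeasurable _
      (Filter.Eventually.of_forall fun p => abs_returnFrom_le hθ hμ n _ (M.proj_mem _) _)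
  rw [h1, hg, integral_add (integrable_const _) hint, integral_prod _ hint]
  simp [valueSteps]

end Dynamics

/-! ### Freshness of the noise of one step. -/

section Resampling

instance isProbabilityMeasure_initial : IsProbabilityMeasure M.ρ := M.isProb_ρ

instance isProbabilityMeasure_episodeLaw : IsProbabilityMeasure M.episodeLaw := by
  unfold episodeLaw; infer_instance

/-- The noise of step `i` can be drawn afresh. -/
theorem lintegral_episodeLaw_resample (i : ℕ) {F : EpisodeNoise ds × (Vec ds × ℝ) → ℝ≥0∞}
    (hF : Measurable F)
    (hFi : ∀ ξ e e', F ((ξ.1, Function.update ξ.2 i e'), e) = F (ξ, e)) :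
    ∫⁻ ξ, F (ξ, ξ.2 i) ∂M.episodeLaw =
      ∫⁻ ξ, ∫⁻ e, F (ξ, e) ∂(M.noiseF.prod M.noiseR) ∂M.episodeLaw := by
  have hup := measurePreserving_update_infinitePi (M.noiseF.prod M.noiseR) i
  unfold episodeLaw
  have hm : Measurable fun ξ : EpisodeNoise ds => F (ξ, ξ.2 i) :=
    hF.comp (measurable_id.prodMk ((measurable_pi_apply i).comp measurable_snd))
  rw [lintegral_prod _ hm.aemeasurable, lintegral_prod _ hF.lintegral_prod_right'.aemeasurable]
  refine lintegral_congr fun x => ?_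
  have hm' : Measurable fun ζ : ℕ → Vec ds × ℝ => F ((x, ζ), ζ i) :=
    hF.comp ((measurable_const.prodMk measurable_id).prodMk (measurable_pi_apply i))
  have hm'' := (hm'.comp hup.measurable).aemeasurable
    (μ := (Measure.infinitePi fun _ : ℕ => M.noiseF.prod M.noiseR).prod (M.noiseF.prod M.noiseR))
  rw [← hup.lintegral_comp hm']
  refine (lintegral_prod _ hm'').trans ?_
  refine lintegral_congr fun ζ => lintegral_congr fun e => ?_
  simpa using hFi (x, ζ) e e

theorem rawState_update (θ : Param ds da) (μ : ℕ → Vec ds → Vec da) (ξ : EpisodeNoise ds)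
    {i j : ℕ} (hij : j ≤ i) (e : Vec ds × ℝ) :
    M.rawState θ μ (ξ.1, Function.update ξ.2 i e) j = M.rawState θ μ ξ j := by
  induction j with
  | zero => rfl
  | succ j ih =>
    have hne : j ≠ i := by omega
    simp only [rawState, ih (by omega), Function.update_of_ne hne]

end Resampling

/-! ### The simulation lemma. -/

section Simulation

/-- The difference between the models `θ'` and `θ` in one step in state `s` that is followed by `n`
further steps. -/
noncomputable def modelGap (θ' θ : Param ds da) (μ : ℕ → Vec ds → Vec da) (n i : ℕ)
    (s : Vec ds) : ℝ≥0∞ :=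
  ENNReal.ofReal (|meanReward θ' s (μ i s) - meanReward θ s (μ i s)| +
    2 * (n * (M.supReward θ').toReal) *
      (‖meanNext θ' s (μ i s) - meanNext θ s (μ i s)‖ / M.σf))

variable {M}

/-- In the Bellman equations the continuation value of `θ'` after a transition of `θ` is added and
subtracted. One difference compares a bounded function under two Gaussian shifts, the other is the
same problem with one step less, along a transition of `θ`. -/
theorem enorm_valueSteps_sub_le {θ θ' : Param ds da} (hθ : M.supReward θ ≠ ∞)
    (hθ' : M.supReward θ' ≠ ∞) {μ : ℕ → Vec ds → Vec da} (hμ : M.IsPolicy μ) (n i : ℕ)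
    (s : Vec ds) :
    ‖M.valueSteps θ' μ (n + 1) i s - M.valueSteps θ μ (n + 1) i s‖ₑ ≤
      M.modelGap θ' θ μ n i s +
        ∫⁻ z, ‖M.valueSteps θ' μ n (i + 1) (M.proj (meanNext θ s (μ i s) + z)) -
          M.valueSteps θ μ n (i + 1) (M.proj (meanNext θ s (μ i s) + z))‖ₑ ∂M.noiseF := by
  have hmeas : ∀ ϑ : Param ds da, Measurable fun y =>
      M.valueSteps ϑ μ n (i + 1) (M.proj y) := fun ϑ =>
    M.measurable_valueSteps measurable_const (fun j => hμ.measurable_uncurry j) n (i + 1)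
      M.measurable_proj
  have hint : ∀ ϑ : Param ds da, M.supReward ϑ ≠ ∞ → ∀ x, Integrable (fun z =>
      M.valueSteps ϑ μ n (i + 1) (M.proj (x + z))) M.noiseF := fun ϑ hϑ x =>
    Integrable.of_bound ((hmeas ϑ).comp (measurable_const_add x)).aestronglyMeasurable _
      (Filter.Eventually.of_forall fun z => abs_valueSteps_le hϑ hμ n _ (M.proj_mem _))
  set f := meanNext θ s (μ i s)
  set f' := meanNext θ' s (μ i s)
  rw [valueSteps_succ hθ hμ n i s, valueSteps_succ hθ' hμ n i s]
  have hsplit : meanReward θ' s (μ i s) +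
        ∫ z, M.valueSteps θ' μ n (i + 1) (M.proj (f' + z)) ∂M.noiseF -
      (meanReward θ s (μ i s) + ∫ z, M.valueSteps θ μ n (i + 1) (M.proj (f + z)) ∂M.noiseF) =
      ((meanReward θ' s (μ i s) - meanReward θ s (μ i s)) +
        (∫ z, M.valueSteps θ' μ n (i + 1) (M.proj (f' + z)) ∂M.noiseF -
          ∫ z, M.valueSteps θ' μ n (i + 1) (M.proj (f + z)) ∂M.noiseF)) +
      ∫ z, (M.valueSteps θ' μ n (i + 1) (M.proj (f + z)) -
        M.valueSteps θ μ n (i + 1) (M.proj (f + z))) ∂M.noiseF := by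
    rw [integral_sub (hint θ' hθ' f) (hint θ hθ f)]; ring
  rw [hsplit]
  refine (enorm_add_le _ _).trans (add_le_add ?_ (enorm_integral_le_lintegral_enorm _))
  rw [Real.enorm_eq_ofReal_abs]
  refine ENNReal.ofReal_le_ofReal ((abs_add_le _ _).trans (add_le_add le_rfl ?_))
  exact abs_integral_shift_sub_le M.σf_pos (hmeas θ')
    (fun y => abs_valueSteps_le hθ' hμ n _ (M.proj_mem y)) f' f

variable (M) in
theorem measurable_modelGap {α : Type*} [MeasurableSpace α] {θ' θ : α → Param ds da}
    {μ : α → ℕ → Vec ds → Vec da} (hθ' : Measurable θ') (hθ : Measurable θ)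
    (hμ : ∀ i, Measurable fun p : α × Vec ds => μ p.1 i p.2) (n i : ℕ) {s : α → Vec ds}
    (hs : Measurable s) : Measurable fun x => M.modelGap (θ' x) (θ x) (μ x) n i (s x) := by
  have ha := measurable_policy_apply hμ i hs
  have h1 := hθ.meanReward hs ha
  have h2 := hθ'.meanReward hs ha
  have h3 := hθ.meanNext hs ha
  have h4 := hθ'.meanNext hs ha
  have h5 := M.measurable_supReward.comp hθ'
  unfold modelGap
  refine ENNReal.measurable_ofReal.comp (Measurable.add ?_ (Measurable.mul ?_ ?_))
  · exact (h2.sub h1).abs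
  · exact (h5.ennreal_toReal.const_mul _).const_mul _
  · exact (h4.sub h3).norm.div_const _

/-- The simulation lemma: the difference of the values of a policy in two models is at most the sum
of the one-step differences along a trajectory of the second model. -/
theorem lintegral_enorm_value_sub_le {θ θ' : Param ds da} (hθ : M.supReward θ ≠ ∞)
    (hθ' : M.supReward θ' ≠ ∞) {μ : ℕ → Vec ds → Vec da} (hμ : M.IsPolicy μ) :
    ∫⁻ s, ‖M.value θ' μ 0 s - M.value θ μ 0 s‖ₑ ∂M.ρ ≤
      ∫⁻ ξ, ∑ i ∈ Finset.range M.H,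
        M.modelGap θ' θ μ (M.H - 1 - i) i (M.proj (M.rawState θ μ ξ i)) ∂M.episodeLaw := by
  set D : ℕ → Vec ds → ℝ≥0∞ := fun i s =>
    ‖M.valueSteps θ' μ (M.H - i) i s - M.valueSteps θ μ (M.H - i) i s‖ₑ with hD
  have hDm : ∀ i, Measurable (D i) := fun i =>
    ((M.measurable_valueSteps measurable_const (fun j => hμ.measurable_uncurry j) _ i
      measurable_id).sub (M.measurable_valueSteps measurable_const
        (fun j => hμ.measurable_uncurry j) _ i measurable_id)).enorm
  have hraw : ∀ i, Measurable fun ξ : EpisodeNoise ds => M.rawState θ μ ξ i := fun i =>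
    M.measurable_rawState measurable_const (fun j => hμ.measurable_uncurry j) measurable_id i
  have hstate : ∀ i, Measurable fun ξ : EpisodeNoise ds => M.proj (M.rawState θ μ ξ i) := fun i =>
    M.measurable_proj.comp (hraw i)
  have hgap : ∀ i, Measurable fun ξ : EpisodeNoise ds =>
      M.modelGap θ' θ μ (M.H - 1 - i) i (M.proj (M.rawState θ μ ξ i)) := fun i =>
    M.measurable_modelGap measurable_const measurable_const
      (fun j => hμ.measurable_uncurry j) _ i (hstate i)
  have hstep : ∀ i < M.H, ∫⁻ ξ, D i (M.proj (M.rawState θ μ ξ i)) ∂M.episodeLaw ≤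
      ∫⁻ ξ, M.modelGap θ' θ μ (M.H - 1 - i) i (M.proj (M.rawState θ μ ξ i)) ∂M.episodeLaw +
        ∫⁻ ξ, D (i + 1) (M.proj (M.rawState θ μ ξ (i + 1))) ∂M.episodeLaw := by
    intro i hi
    -- The state at step `i` depends only on earlier noise, so the noise of step `i` may be drawn
    -- afresh; this matches the inner integral of the one-step comparison.
    have e1 : ∫⁻ ξ, D (i + 1) (M.proj (M.rawState θ μ ξ (i + 1))) ∂M.episodeLaw =
        ∫⁻ ξ, ∫⁻ z, D (i + 1) (M.proj (meanNext θ (M.proj (M.rawState θ μ ξ i))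
          (μ i (M.proj (M.rawState θ μ ξ i))) + z)) ∂M.noiseF ∂M.episodeLaw := by
      have hnext : Measurable fun ξ : EpisodeNoise ds =>
          meanNext θ (M.proj (M.rawState θ μ ξ i)) (μ i (M.proj (M.rawState θ μ ξ i))) :=
        (measurable_const (a := θ)).meanNext (hstate i) ((hμ i).1.comp (hstate i))
      have := M.lintegral_episodeLaw_resample i
        (F := fun p => D (i + 1) (M.proj (meanNext θ (M.proj (M.rawState θ μ p.1 i))
          (μ i (M.proj (M.rawState θ μ p.1 i))) + p.2.1)))
        ((hDm _).comp (M.measurable_proj.comp ((hnext.comp measurable_fst).add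
          (measurable_fst.comp measurable_snd))))
        (fun ξ e e' => by simp only [M.rawState_update θ μ ξ le_rfl])
      refine Eq.trans this (lintegral_congr fun ξ => ?_)
      rw [lintegral_prod _ (by
        refine Measurable.aemeasurable ?_
        exact (hDm _).comp (M.measurable_proj.comp
          ((measurable_const_add (meanNext θ (M.proj (M.rawState θ μ ξ i))
            (μ i (M.proj (M.rawState θ μ ξ i))))).comp measurable_fst)))]
      simp
    rw [e1, ← lintegral_add_left (hgap i)]
    refine lintegral_mono fun ξ => ?_
    have hH : M.H - i = M.H - 1 - i + 1 := by omega
    have hH' : M.H - (i + 1) = M.H - 1 - i := by omega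
    simp only [hD]
    rw [hH, hH']
    exact enorm_valueSteps_sub_le hθ hθ' hμ _ i _
  have htotal : ∀ m ≤ M.H, ∫⁻ ξ, D 0 (M.proj (M.rawState θ μ ξ 0)) ∂M.episodeLaw ≤
      ∑ i ∈ Finset.range m,
        ∫⁻ ξ, M.modelGap θ' θ μ (M.H - 1 - i) i (M.proj (M.rawState θ μ ξ i)) ∂M.episodeLaw +
      ∫⁻ ξ, D m (M.proj (M.rawState θ μ ξ m)) ∂M.episodeLaw := by
    intro m hm
    induction m with
    | zero => simp
    | succ m ih =>
      rw [Finset.sum_range_succ, add_assoc]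
      exact (ih (by omega)).trans (add_le_add le_rfl (hstep m (by omega)))
  have hlast : ∫⁻ ξ, D M.H (M.proj (M.rawState θ μ ξ M.H)) ∂M.episodeLaw = 0 := by
    have h : ∀ s, D M.H s = 0 := fun s => by
      simp only [hD]
      rw [Nat.sub_self]
      simp [valueSteps, returnFrom]
    simp [h]
  -- The initial state is not retracted in the regret but is in the trajectory; the two agree
  -- because `ρ` is carried by the state space, where `proj` is the identity.
  have h0 : ∫⁻ s, ‖M.value θ' μ 0 s - M.value θ μ 0 s‖ₑ ∂M.ρ =
      ∫⁻ ξ, D 0 (M.proj (M.rawState θ μ ξ 0)) ∂M.episodeLaw := by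
    unfold episodeLaw
    refine Eq.trans ?_ (lintegral_prod _ ((hDm 0).comp (hstate 0)).aemeasurable).symm
    refine lintegral_congr_ae ?_
    filter_upwards [M.ρ_mem] with s hs
    simp [rawState, M.proj_eq_self s hs, hD, value, valueSteps]
  rw [h0, lintegral_finsetSum _ fun i _ => hgap i]
  simpa [hlast] using htotal M.H le_rfl

end Simulation

end ControlProblem

/-! ### Two facts on independence of random variables. -/

section Independence

variable {Ω : Type*} [MeasurableSpace Ω] {P : Measure Ω} [IsProbabilityMeasure P]
  {α β γ : Type*} [MeasurableSpace α] [MeasurableSpace β] [MeasurableSpace γ]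

theorem ProbabilityTheory.IndepFun.prodMk_left_of_prodMk_right {X : Ω → α} {Y : Ω → β} {Z : Ω → γ}
    (hX : Measurable X) (hY : Measurable Y) (hZ : Measurable Z)
    (h : IndepFun X (fun ω => (Y ω, Z ω)) P) (hYZ : IndepFun Y Z P) :
    IndepFun (fun ω => (X ω, Y ω)) Z P := by
  rw [indepFun_iff_map_prod_eq_prod_map_map (by fun_prop) (by fun_prop)]
  have := Measure.isProbabilityMeasure_map (μ := P) hX.aemeasurable
  have := Measure.isProbabilityMeasure_map (μ := P) hZ.aemeasurable
  have := Measure.isProbabilityMeasure_map (μ := P) (hX.prodMk hY).aemeasurable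
  have := Measure.isProbabilityMeasure_map (μ := P) ((hX.prodMk hY).prodMk hZ).aemeasurable
  refine Measure.ext_prod₃' fun {s t u} hs ht hu => ?_
  rw [Measure.prod_prod, Measure.map_apply (by fun_prop) ((hs.prod ht).prod hu),
    Measure.map_apply (by fun_prop) (hs.prod ht), Measure.map_apply hZ hu]
  have h1 := h.measure_inter_preimage_eq_mul _ _ hs (ht.prod hu)
  have h2 := h.measure_inter_preimage_eq_mul _ _ hs (ht.prod MeasurableSet.univ)
  have h3 := hYZ.measure_inter_preimage_eq_mul _ _ ht hu
  have e1 : (fun ω => ((X ω, Y ω), Z ω)) ⁻¹' ((s ×ˢ t) ×ˢ u) =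
      X ⁻¹' s ∩ (fun ω => (Y ω, Z ω)) ⁻¹' (t ×ˢ u) := by ext; simp [and_assoc]
  have e2 : (fun ω => (X ω, Y ω)) ⁻¹' (s ×ˢ t) =
      X ⁻¹' s ∩ (fun ω => (Y ω, Z ω)) ⁻¹' (t ×ˢ Set.univ) := by ext; simp
  have e3 : (fun ω => (Y ω, Z ω)) ⁻¹' (t ×ˢ u) = Y ⁻¹' t ∩ Z ⁻¹' u := by ext; simp
  have e4 : (fun ω => (Y ω, Z ω)) ⁻¹' (t ×ˢ Set.univ) = Y ⁻¹' t := by ext; simp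
  rw [e1, e2, h1, h2, e3, h3, e4, mul_assoc]

theorem ProbabilityTheory.iIndepFun.indepFun_shift {X : ℕ → Ω → α} (hX : ∀ k, Measurable (X k))
    (h : iIndepFun X P) (k : ℕ) : IndepFun (X k) (fun ω j => X (k + 1 + j) ω) P := by
  have h1 := indep_iSup_of_disjoint (S := {k}) (T := Set.Ioi k) (fun i => (hX i).comap_le) h
    (by simp)
  refine indep_of_indep_of_le_left (indep_of_indep_of_le_right h1 ?_) ?_
  · have hm : @Measurable _ _ (⨆ i ∈ Set.Ioi k, MeasurableSpace.comap (X i) inferInstance) _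
        (fun ω (j : ℕ) => X (k + 1 + j) ω) := by
      refine @measurable_pi_iff _ _ _ (_) _ _ |>.2 fun j => ?_
      refine Measurable.mono (comap_measurable (X (k + 1 + j))) ?_ le_rfl
      exact le_iSup₂_of_le (k + 1 + j) (by simp only [Set.mem_Ioi]; omega) le_rfl
    exact hm.comap_le
  · exact le_iSup₂_of_le k rfl le_rfl

end Independence

namespace ControlProblem

variable {ds da : ℕ} (M : ControlProblem ds da)

/-- An observed history of `k` episodes. -/
abbrev Hist (ds da H k : ℕ) : Type := Fin k → Fin H → Vec ds × Vec da × ℝ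

/-- The history as a function of the parameter, the environment noise and the samples. -/
noncomputable def historyMap (plan : Param ds da → ℕ → Vec ds → Vec da) (k : ℕ)
    (p : Param ds da × (Fin k → EpisodeNoise ds) × (Fin k → Param ds da)) : Hist ds da M.H k :=
  fun j i => M.observation p.1 (plan (p.2.2 j)) (p.2.1 j) i

theorem measurable_historyMap {plan : Param ds da → ℕ → Vec ds → Vec da}
    (hplan : ∀ i, Measurable fun p : Param ds da × Vec ds => plan p.1 i p.2) (k : ℕ) :
    Measurable (M.historyMap plan k) := by
  refine measurable_pi_iff.2 fun j => measurable_pi_iff.2 fun i => ?_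
  refine M.measurable_observation measurable_fst (fun n => ?_) ?_ i
  · refine (hplan n).comp (Measurable.prodMk ?_ measurable_snd)
    exact (measurable_pi_apply j).comp (measurable_snd.comp (measurable_snd.comp measurable_fst))
  · exact (measurable_pi_apply j).comp (measurable_fst.comp measurable_snd)

/-! ### Probabilistic structure of posterior sampling. -/

section PSRL

variable {M} {Ω : Type*} {plan : Param ds da → ℕ → Vec ds → Vec da} {θ : Ω → Param ds da}
  {θs : ℕ → Ω → Param ds da} {ξ : ℕ → Ω → EpisodeNoise ds} {π : Measure (Param ds da)}
  [MeasurableSpace Ω] {P : Measure Ω}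

/-- Everything that happened before the sampling in episode `k`. -/
def past (θ : Ω → Param ds da) (θs : ℕ → Ω → Param ds da) (ξ : ℕ → Ω → EpisodeNoise ds) (k : ℕ)
    (ω : Ω) : Param ds da × (Fin k → EpisodeNoise ds) × (Fin k → Param ds da) :=
  (θ ω, fun j => ξ j ω, fun j => θs j ω)

theorem IsPSRL.measurable_past (hP : M.IsPSRL plan θ θs ξ π P) (k : ℕ) :
    Measurable (past θ θs ξ k) :=
  hP.measurable_θ.prodMk (Measurable.prodMk (measurable_pi_iff.2 fun _ => hP.measurable_ξ _)
    (measurable_pi_iff.2 fun _ => hP.measurable_θs _))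

theorem history_eq (k : ℕ) :
    M.history plan θ θs ξ k = M.historyMap plan k ∘ past θ θs ξ k := rfl

theorem IsPSRL.measurable_history (hP : M.IsPSRL plan θ θs ξ π P)
    (hplan : ∀ i, Measurable fun p : Param ds da × Vec ds => plan p.1 i p.2) (k : ℕ) :
    Measurable (M.history plan θ θs ξ k) :=
  (M.measurable_historyMap hplan k).comp (hP.measurable_past k)

variable [IsProbabilityMeasure P]

/-- Probability of an event of the sampled parameter and of the other randomness, in terms of the
posterior distribution. -/
theorem IsPSRL.measure_inter_eq (hP : M.IsPSRL plan θ θs ξ π P) (k : ℕ) {B : Set (Param ds da)}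
    (hB : MeasurableSet B) {E : Set Ω}
    (hE : MeasurableSet[MeasurableSpace.comap
      (fun ω => (θ ω, (fun j => ξ j ω), fun j : Fin k => θs j ω)) inferInstance] E) :
    P.real (E ∩ θs k ⁻¹' B) =
      ∫ ω in E, (P⟦θ ⁻¹' B | MeasurableSpace.comap (M.history plan θ θs ξ k) inferInstance⟧) ω
        ∂P := by
  have hle : MeasurableSpace.comap
      (fun ω => (θ ω, (fun j => ξ j ω), fun j : Fin k => θs j ω)) inferInstance ≤
      (inferInstance : MeasurableSpace Ω) := by
    refine Measurable.comap_le ?_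
    exact hP.measurable_θ.prodMk ((measurable_pi_iff.2 fun j => hP.measurable_ξ j).prodMk
      (measurable_pi_iff.2 fun j => hP.measurable_θs j))
  have hm := hP.measurable_θs k hB
  rw [← setIntegral_congr_ae (hle _ hE)
    ((hP.posterior_sample k B hB).mono fun ω h _ => h), setIntegral_condExp hle
      ((integrable_const _).indicator hm) hE, integral_indicator hm,
      Measure.restrict_restrict hm]
  simp [Set.inter_comm, Measure.real]

/-- On every event of the history, the sample and the true parameter both integrate to the posterior
probability. This exchange transfers estimates for the true parameter to the sampled one. -/
theorem IsPSRL.map_sample_history (hP : M.IsPSRL plan θ θs ξ π P)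
    (hplan : ∀ i, Measurable fun p : Param ds da × Vec ds => plan p.1 i p.2) (k : ℕ) :
    P.map (fun ω => (θs k ω, M.history plan θ θs ξ k ω)) =
      P.map (fun ω => (θ ω, M.history plan θ θs ξ k ω)) := by
  have hhist := hP.measurable_history hplan k
  have h1 := (hP.measurable_θs k).prodMk hhist
  have h2 := hP.measurable_θ.prodMk hhist
  have := Measure.isProbabilityMeasure_map (μ := P) h1.aemeasurable
  refine Measure.ext_prod fun {s t} hs ht => ?_
  rw [Measure.map_apply h1 (hs.prod ht), Measure.map_apply h2 (hs.prod ht)]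
  have hE : MeasurableSet[MeasurableSpace.comap (M.history plan θ θs ξ k) inferInstance]
      (M.history plan θ θs ξ k ⁻¹' t) := ⟨t, ht, rfl⟩
  have hE' : MeasurableSet[MeasurableSpace.comap
      (fun ω => (θ ω, (fun j => ξ j ω), fun j : Fin k => θs j ω)) inferInstance]
      (M.history plan θ θs ξ k ⁻¹' t) := by
    refine ⟨(fun p : Param ds da × (ℕ → EpisodeNoise ds) × (Fin k → Param ds da) =>
      M.historyMap plan k (p.1, fun j => p.2.1 j, p.2.2)) ⁻¹' t, ?_, rfl⟩
    have hm : Measurable fun p : Param ds da × (ℕ → EpisodeNoise ds) × (Fin k → Param ds da) =>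
        M.historyMap plan k (p.1, fun j => p.2.1 j, p.2.2) := by
      refine (M.measurable_historyMap hplan k).comp (measurable_fst.prodMk
        (Measurable.prodMk (measurable_pi_iff.2 fun j => ?_)
          (measurable_snd.comp measurable_snd)))
      exact (measurable_pi_apply _).comp (measurable_fst.comp measurable_snd)
    exact hm ht
  have e := hP.measure_inter_eq k hs hE'
  have hm := hP.measurable_θ hs
  rw [setIntegral_condExp hhist.comap_le ((integrable_const _).indicator hm) hE,
    integral_indicator hm, Measure.restrict_restrict hm] at e
  simp only [integral_const, MeasurableSet.univ, measureReal_restrict_apply, Set.univ_inter,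
    smul_eq_mul, mul_one] at e
  have e' : P (M.history plan θ θs ξ k ⁻¹' t ∩ θs k ⁻¹' s) =
      P (θ ⁻¹' s ∩ M.history plan θ θs ξ k ⁻¹' t) :=
    (ENNReal.toReal_eq_toReal_iff' (measure_ne_top _ _) (measure_ne_top _ _)).1 e
  rw [Set.inter_comm] at e'
  exact e'

/-- Given the past and all noise, future noise included, the law of the sample is a function of the
history and hence of the past alone. So adjoining the sample to the past creates no dependence on
the future. -/
theorem IsPSRL.indepFun_past_sample (hP : M.IsPSRL plan θ θs ξ π P)
    (hplan : ∀ i, Measurable fun p : Param ds da × Vec ds => plan p.1 i p.2) {k : ℕ}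
    (h : IndepFun (past θ θs ξ k) (fun ω j => ξ (k + j) ω) P) :
    IndepFun (fun ω => (past θ θs ξ k ω, θs k ω)) (fun ω j => ξ (k + j) ω) P := by
  have hhist := hP.measurable_history hplan k
  have hpast := hP.measurable_past k
  have hθs := hP.measurable_θs k
  have hfut : Measurable (fun ω (j : ℕ) => ξ (k + j) ω) :=
    measurable_pi_iff.2 fun j => hP.measurable_ξ _
  rw [indepFun_iff_map_prod_eq_prod_map_map (hpast.prodMk hθs).aemeasurable hfut.aemeasurable]
  have := Measure.isProbabilityMeasure_map (μ := P) hfut.aemeasurable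
  have := Measure.isProbabilityMeasure_map (μ := P) (hpast.prodMk hθs).aemeasurable
  have := Measure.isProbabilityMeasure_map (μ := P) ((hpast.prodMk hθs).prodMk hfut).aemeasurable
  refine Measure.ext_prod₃' fun {s t u} hs ht hu => ?_
  rw [Measure.prod_prod, Measure.map_apply ((hpast.prodMk hθs).prodMk hfut)
    ((hs.prod ht).prod hu), Measure.map_apply (hpast.prodMk hθs) (hs.prod ht),
    Measure.map_apply hfut hu]
  -- The posterior probability of `t` is written as a measurable function `g` of the history, so
  -- that the independence hypothesis applies to it.
  obtain ⟨g, hg, hgeq⟩ := (stronglyMeasurable_condExp (μ := P)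
    (m := MeasurableSpace.comap (M.history plan θ θs ξ k) inferInstance)
    (f := (θ ⁻¹' t).indicator fun _ => (1 : ℝ))).exists_eq_measurable_comp
  have key : ∀ v : Set (ℕ → EpisodeNoise ds), MeasurableSet v →
      P.real ((past θ θs ξ k ⁻¹' s ∩ (fun ω j => ξ (k + j) ω) ⁻¹' v) ∩ θs k ⁻¹' t) =
        (∫ ω, s.indicator (fun p => g (M.historyMap plan k p)) (past θ θs ξ k ω) ∂P) *
          P.real ((fun ω j => ξ (k + j) ω) ⁻¹' v) := by
    intro v hv
    have hE : MeasurableSet[MeasurableSpace.comap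
        (fun ω => (θ ω, (fun j => ξ j ω), fun j : Fin k => θs j ω)) inferInstance]
        (past θ θs ξ k ⁻¹' s ∩ (fun ω j => ξ (k + j) ω) ⁻¹' v) := by
      refine ⟨(fun p : Param ds da × (ℕ → EpisodeNoise ds) × (Fin k → Param ds da) =>
        (p.1, (fun j : Fin k => p.2.1 j), p.2.2)) ⁻¹' s ∩
        (fun p : Param ds da × (ℕ → EpisodeNoise ds) × (Fin k → Param ds da) =>
          fun j => p.2.1 (k + j)) ⁻¹' v, ?_, rfl⟩
      have hm1 : Measurable fun p : Param ds da × (ℕ → EpisodeNoise ds) × (Fin k → Param ds da) =>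
          (p.1, (fun j : Fin k => p.2.1 j), p.2.2) := by
        refine measurable_fst.prodMk (Measurable.prodMk (measurable_pi_iff.2 fun j => ?_)
          (measurable_snd.comp measurable_snd))
        exact (measurable_pi_apply _).comp (measurable_fst.comp measurable_snd)
      have hm2 : Measurable fun p : Param ds da × (ℕ → EpisodeNoise ds) × (Fin k → Param ds da) =>
          fun j : ℕ => p.2.1 (k + j) :=
        measurable_pi_iff.2 fun j =>
          (measurable_pi_apply _).comp (measurable_fst.comp measurable_snd)
      exact (hm1 hs).inter (hm2 hv)
    rw [hP.measure_inter_eq k ht hE, hgeq,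
      ← integral_indicator ((hpast hs).inter (hfut hv))]
    have hF : Measurable (s.indicator fun p => g (M.historyMap plan k p)) :=
      (hg.measurable.comp (M.measurable_historyMap hplan k)).indicator hs
    have hG : Measurable (v.indicator fun _ : ℕ → EpisodeNoise ds => (1 : ℝ)) :=
      measurable_const.indicator hv
    have hmul := h.integral_fun_comp_mul_comp hpast.aemeasurable hfut.aemeasurable
      hF.aestronglyMeasurable hG.aestronglyMeasurable
    have hr : ∫ ω, v.indicator (fun _ : ℕ → EpisodeNoise ds => (1 : ℝ))
        (fun j => ξ (k + j) ω) ∂P = P.real ((fun ω j => ξ (k + j) ω) ⁻¹' v) := by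
      have : ∀ ω, v.indicator (fun _ : ℕ → EpisodeNoise ds => (1 : ℝ)) (fun j => ξ (k + j) ω) =
          ((fun ω j => ξ (k + j) ω) ⁻¹' v).indicator (fun _ => (1 : ℝ)) ω := fun ω => rfl
      simp_rw [this]
      rw [integral_indicator (hfut hv)]; simp
    rw [← hr, ← hmul]
    refine integral_congr_ae (Filter.Eventually.of_forall fun ω => ?_)
    by_cases h1 : past θ θs ξ k ω ∈ s <;> by_cases h2 : (fun j => ξ (k + j) ω) ∈ v <;>
      simp [Set.indicator, h1, h2, history_eq]
  have k1 := key u hu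
  have k2 := key Set.univ MeasurableSet.univ
  simp only [Set.preimage_univ, Set.inter_univ, probReal_univ, mul_one] at k2
  rw [← k2] at k1
  have e1 : (fun ω => ((past θ θs ξ k ω, θs k ω), fun j => ξ (k + j) ω)) ⁻¹' ((s ×ˢ t) ×ˢ u) =
      (past θ θs ξ k ⁻¹' s ∩ (fun ω j => ξ (k + j) ω) ⁻¹' u) ∩ θs k ⁻¹' t := by
    ext; simp only [Set.mem_preimage, Set.mem_prod, Set.mem_inter_iff]; tauto
  have e2 : (fun ω => (past θ θs ξ k ω, θs k ω)) ⁻¹' (s ×ˢ t) =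
      past θ θs ξ k ⁻¹' s ∩ θs k ⁻¹' t := by
    ext; simp
  rw [e1, e2, ← ENNReal.toReal_eq_toReal_iff' (measure_ne_top _ _)
    (ENNReal.mul_ne_top (measure_ne_top _ _) (measure_ne_top _ _)), ENNReal.toReal_mul]
  exact k1

/-- One episode consists of adjoining the sample, which preserves independence from the future, and
then moving `ξ k` from the future to the past, which is allowed since the noises of different
episodes are independent. -/
theorem IsPSRL.indepFun_past (hP : M.IsPSRL plan θ θs ξ π P)
    (hplan : ∀ i, Measurable fun p : Param ds da × Vec ds => plan p.1 i p.2) (k : ℕ) :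
    IndepFun (past θ θs ξ k) (fun ω j => ξ (k + j) ω) P := by
  induction k with
  | zero =>
    have hm : Measurable fun t : Param ds da => ((t, fun j => j.elim0, fun j => j.elim0) :
        Param ds da × (Fin 0 → EpisodeNoise ds) × (Fin 0 → Param ds da)) := by fun_prop
    have hm' : Measurable (id : (ℕ → EpisodeNoise ds) → (ℕ → EpisodeNoise ds)) := measurable_id
    have h := hP.indep_θ_ξ.comp hm hm'
    convert h using 1
    · funext ω
      simp only [past, Function.comp]
      refine Prod.ext rfl (Prod.ext ?_ ?_) <;> exact Subsingleton.elim _ _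
    · simp
  | succ k ih =>
    have h1 := hP.indepFun_past_sample hplan ih
    have hpast := hP.measurable_past k
    have hθs := hP.measurable_θs k
    have hfut : Measurable (fun ω (j : ℕ) => ξ (k + 1 + j) ω) :=
      measurable_pi_iff.2 fun j => hP.measurable_ξ _
    have h2 : IndepFun (fun ω => (past θ θs ξ k ω, θs k ω))
        (fun ω => (ξ k ω, fun j => ξ (k + 1 + j) ω)) P := by
      have hm : Measurable fun f : ℕ → EpisodeNoise ds => (f 0, fun j : ℕ => f (1 + j)) := by
        fun_prop
      have := h1.comp measurable_id hm
      simpa [Function.comp_def, add_assoc] using this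
    have h3 := h2.prodMk_left_of_prodMk_right (hpast.prodMk hθs) (hP.measurable_ξ k) hfut
      (hP.indep_ξ.indepFun_shift hP.measurable_ξ k)
    let φ : ((Param ds da × (Fin k → EpisodeNoise ds) × (Fin k → Param ds da)) × Param ds da) ×
        EpisodeNoise ds → Param ds da × (Fin (k + 1) → EpisodeNoise ds) ×
          (Fin (k + 1) → Param ds da) :=
      fun p => (p.1.1.1, fun j =>
          Fin.lastCases (motive := fun _ => EpisodeNoise ds) p.2 p.1.1.2.1 j,
        fun j => Fin.lastCases (motive := fun _ => Param ds da) p.1.2 p.1.1.2.2 j)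
    have hφ : Measurable φ := by
      refine Measurable.prodMk (by fun_prop) (Measurable.prodMk (measurable_pi_iff.2 fun j => ?_)
        (measurable_pi_iff.2 fun j => ?_))
      · induction j using Fin.lastCases with
        | last => simp only [Fin.lastCases_last]; fun_prop
        | cast j => simp only [Fin.lastCases_castSucc]; fun_prop
      · induction j using Fin.lastCases with
        | last => simp only [Fin.lastCases_last]; fun_prop
        | cast j => simp only [Fin.lastCases_castSucc]; fun_prop
    have h4 := h3.comp (ψ := id) hφ measurable_id
    convert h4 using 1
    swap
    · rfl
    · funext ω
      refine Prod.ext rfl (Prod.ext ?_ ?_)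
      · funext j
        induction j using Fin.lastCases with
        | last => simp [past, φ]
        | cast j => simp [past, φ]
      · funext j
        induction j using Fin.lastCases with
        | last => simp [past, φ]
        | cast j => simp [past, φ]

/-- The noise of episode `k` is fresh. -/
theorem IsPSRL.lintegral_episode (hP : M.IsPSRL plan θ θs ξ π P)
    (hplan : ∀ i, Measurable fun p : Param ds da × Vec ds => plan p.1 i p.2) (k : ℕ)
    {F : (Param ds da × (Fin k → EpisodeNoise ds) × (Fin k → Param ds da)) × Param ds da →
      EpisodeNoise ds → ℝ≥0∞} (hF : Measurable (Function.uncurry F)) :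
    ∫⁻ ω, F (past θ θs ξ k ω, θs k ω) (ξ k ω) ∂P =
      ∫⁻ ω, ∫⁻ x, F (past θ θs ξ k ω, θs k ω) x ∂M.episodeLaw ∂P := by
  have hm : Measurable fun f : ℕ → EpisodeNoise ds => f 0 := by fun_prop
  have h1 := (hP.indepFun_past_sample hplan (hP.indepFun_past hplan k)).comp measurable_id hm
  have hX := (hP.measurable_past k).prodMk (hP.measurable_θs k)
  have h2 : IndepFun (fun ω => (past θ θs ξ k ω, θs k ω)) (ξ k) P := h1
  rw [indepFun_iff_map_prod_eq_prod_map_map hX.aemeasurable (hP.measurable_ξ k).aemeasurable,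
    hP.law_ξ k] at h2
  have e1 : ∫⁻ ω, F (past θ θs ξ k ω, θs k ω) (ξ k ω) ∂P =
      ∫⁻ p, Function.uncurry F p
        ∂(P.map fun ω => ((past θ θs ξ k ω, θs k ω), ξ k ω)) := by
    rw [lintegral_map hF (hX.prodMk (hP.measurable_ξ k))]; rfl
  have e2 := lintegral_prod (μ := P.map fun ω => (past θ θs ξ k ω, θs k ω))
    (ν := M.episodeLaw) _ hF.aemeasurable
  rw [e1, h2, e2, lintegral_map hF.lintegral_prod_right' hX]
  rfl

/-- A product over the episodes of factors whose mean over the noise of the episode is at most one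
does not increase the mean of a function of the parameter. -/
theorem IsPSRL.lintegral_mul_prod_le (hP : M.IsPSRL plan θ θs ξ π P)
    (hplan : ∀ i, Measurable fun p : Param ds da × Vec ds => plan p.1 i p.2)
    {Φ : Param ds da → ℝ≥0∞} (hΦ : Measurable Φ)
    {Γ : Param ds da → Param ds da → EpisodeNoise ds → ℝ≥0∞}
    (hΓ : Measurable fun p : Param ds da × Param ds da × EpisodeNoise ds => Γ p.1 p.2.1 p.2.2)
    (hΓ1 : ∀ t t', ∫⁻ x, Γ t t' x ∂M.episodeLaw ≤ 1) (k : ℕ) :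
    ∫⁻ ω, Φ (θ ω) * ∏ j ∈ Finset.range k, Γ (θ ω) (θs j ω) (ξ j ω) ∂P ≤ ∫⁻ t, Φ t ∂π := by
  induction k with
  | zero =>
    rw [← hP.law_θ, lintegral_map hΦ hP.measurable_θ]
    simp
  | succ k ih =>
    -- The noise of the last episode is integrated out with everything before it fixed; its factor
    -- then contributes at most one.
    refine le_trans (le_of_eq_of_le (b := ∫⁻ ω, ∫⁻ x, (Φ (θ ω) *
      ∏ j ∈ Finset.range k, Γ (θ ω) (θs j ω) (ξ j ω)) * Γ (θ ω) (θs k ω) x ∂M.episodeLaw ∂P)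
      ?_ ?_) ih
    · have hF : Measurable (Function.uncurry fun
          (p : (Param ds da × (Fin k → EpisodeNoise ds) × (Fin k → Param ds da)) × Param ds da)
          (x : EpisodeNoise ds) =>
          (Φ p.1.1 * ∏ j : Fin k, Γ p.1.1 (p.1.2.2 j) (p.1.2.1 j)) * Γ p.1.1 p.2 x) := by
        refine Measurable.mul (Measurable.mul (by fun_prop) ?_) ?_
        · refine Finset.measurable_prod _ fun j _ => ?_
          exact hΓ.comp (f := fun q : ((Param ds da × (Fin k → EpisodeNoise ds) ×
            (Fin k → Param ds da)) × Param ds da) × EpisodeNoise ds =>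
              (q.1.1.1, q.1.1.2.2 j, q.1.1.2.1 j)) (by fun_prop)
        · exact hΓ.comp (f := fun q : ((Param ds da × (Fin k → EpisodeNoise ds) ×
            (Fin k → Param ds da)) × Param ds da) × EpisodeNoise ds =>
              (q.1.1.1, q.1.2, q.2)) (by fun_prop)
      have := hP.lintegral_episode hplan k hF
      simp only [past] at this
      simp only [Finset.prod_range_succ, Finset.prod_range, ← mul_assoc] at this ⊢
      exact this
    · refine lintegral_mono fun ω => ?_
      have hm : Measurable fun x => Γ (θ ω) (θs k ω) x :=
        hΓ.comp (f := fun x => (θ ω, θs k ω, x)) (by fun_prop)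
      rw [lintegral_const_mul _ hm]
      exact (mul_le_mul_right (hΓ1 _ _) _).trans (by rw [mul_one])

end PSRL

end ControlProblem

theorem ENNReal.ofReal_exp_sum {α : Type*} (s : Finset α) (f : α → ℝ) :
    ENNReal.ofReal (Real.exp (∑ i ∈ s, f i)) = ∏ i ∈ s, ENNReal.ofReal (Real.exp (f i)) := by
  rw [Real.exp_sum, ENNReal.ofReal_prod_of_nonneg fun i _ => (Real.exp_pos _).le]

/-! ### Linear regressions in whitened coordinates and their scores. -/

namespace ControlProblem

variable {ds da : ℕ}

/-- The state-action vector of an observation. -/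
noncomputable def obsVec (M : ControlProblem ds da) (o : Vec ds × Vec da × ℝ) : SAVec ds da :=
  stateAction (M.proj o.1) o.2.1

theorem measurable_obsVec (M : ControlProblem ds da) : Measurable M.obsVec :=
  measurable_stateAction.comp
    ((M.measurable_proj.comp measurable_fst).prodMk (measurable_fst.comp measurable_snd))

/-- The observation of step `i` of episode `j` in a history, or zero if there is none. -/
noncomputable def obsAt {H k : ℕ} (h : Hist ds da H k) (j i : ℕ) : Vec ds × Vec da × ℝ :=
  if hj : j < k then if hi : i < H then h ⟨j, hj⟩ ⟨i, hi⟩ else 0 else 0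

theorem measurable_obsAt {H k : ℕ} (j i : ℕ) :
    Measurable fun h : Hist ds da H k => obsAt h j i := by
  unfold obsAt
  split_ifs
  · fun_prop
  · fun_prop
  · fun_prop

/-- A family of linear regressions with independent Gaussian noise, whose outputs have independent
Gaussian coefficient vectors with the same law, in coordinates where the coefficients and the noise
are standard Gaussian. -/
structure Regression (M : ControlProblem ds da) (π : Measure (Param ds da)) (κ ι : Type)
    [Fintype κ] [Fintype ι] where
  /-- number of steps per episode whose targets are observed in the episode -/
  steps : ℕ
  steps_le : steps ≤ M.H
  /-- regression target, in terms of two successive observations -/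
  target : Vec ds × Vec da × ℝ → Vec ds × Vec da × ℝ → κ → ℝ
  /-- prediction of the target -/
  pred : Param ds da → SAVec ds da → κ → ℝ
  /-- coefficients -/
  latent : Param ds da → Matrix κ ι ℝ
  /-- features -/
  feat : SAVec ds da → ι → ℝ
  /-- noise of the target -/
  noise : Vec ds × ℝ → κ → ℝ
  /-- bound for the squared norm of the features -/
  c : ℝ
  c_nonneg : 0 ≤ c
  measurable_target : Measurable fun p : (Vec ds × Vec da × ℝ) × (Vec ds × Vec da × ℝ) =>
    target p.1 p.2
  measurable_pred : Measurable fun p : Param ds da × SAVec ds da => pred p.1 p.2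
  measurable_latent : ∀ a b, Measurable fun θ => latent θ a b
  measurable_feat : Measurable feat
  measurable_noise : Measurable noise
  -- At the last step of an episode `o'` is arbitrary, because `obsAt` returns the default value
  -- zero there; a target that needs the next observation must have `steps < M.H`.
  target_sub : ∀ θ μ ξ, ∀ i < steps, ∀ o',
    (i + 1 < M.H → o' = M.observation θ μ ξ (i + 1)) →
    target (M.observation θ μ ξ i) o' - pred θ (M.obsVec (M.observation θ μ ξ i)) =
      noise (ξ.2 i)
  -- Only almost everywhere: whitening loses the null directions of a degenerate covariance, in
  -- which the coefficients vanish almost surely. For the same reason the exponential moment of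
  -- `latent` is only bounded above.
  pred_eq : ∀ᵐ θ ∂π, ∀ x, pred θ x = (latent θ).mulVec (feat x)
  feat_le : ∀ s ∈ M.S, ∀ a ∈ M.A, feat (stateAction s a) ⬝ᵥ feat (stateAction s a) ≤ c
  lintegral_noise : ∀ u : κ → ℝ,
    ∫⁻ e, ENNReal.ofReal (Real.exp (u ⬝ᵥ noise e)) ∂(M.noiseF.prod M.noiseR) ≤
      ENNReal.ofReal (Real.exp ((u ⬝ᵥ u) / 2))
  lintegral_latent : ∀ (u : κ → ℝ) (q : ι → ℝ),
    ∫⁻ θ, ENNReal.ofReal (Real.exp (u ⬝ᵥ (latent θ).mulVec q)) ∂π ≤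
      ENNReal.ofReal (Real.exp ((u ⬝ᵥ u) * (q ⬝ᵥ q) / 2))

namespace Regression

variable {M : ControlProblem ds da} {π : Measure (Param ds da)} {κ ι : Type} [Fintype κ]
  [Fintype ι] (R : Regression M π κ ι)

/-- Features of the observations of a history. -/
noncomputable def histFeat {k : ℕ} (h : Hist ds da M.H k) (j i : ℕ) : ι → ℝ :=
  R.feat (M.obsVec (obsAt h j i))

/-- Residuals of the observations of a history. -/
noncomputable def histResid {k : ℕ} (θ : Param ds da) (h : Hist ds da M.H k) (j i : ℕ) : κ → ℝ :=
  R.target (obsAt h j i) (obsAt h j (i + 1)) - R.pred θ (M.obsVec (obsAt h j i))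

/-- Coefficients minus the sum of the products of residuals and features. -/
noncomputable def score {k : ℕ} (θ : Param ds da) (h : Hist ds da M.H k) : Matrix κ ι ℝ :=
  R.latent θ - ∑ j ∈ Finset.range k, ∑ i ∈ Finset.range R.steps,
    Matrix.vecMulVec (R.histResid θ h j i) (R.histFeat h j i)

theorem dotProduct_score {k : ℕ} (θ : Param ds da) (h : Hist ds da M.H k) (u : κ → ℝ)
    (q : ι → ℝ) : u ⬝ᵥ (R.score θ h).mulVec q = u ⬝ᵥ (R.latent θ).mulVec q -
      ∑ j ∈ Finset.range k, ∑ i ∈ Finset.range R.steps,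
        (u ⬝ᵥ R.histResid θ h j i) * (q ⬝ᵥ R.histFeat h j i) := by
  simp only [score, Matrix.sub_mulVec, dotProduct_sub, Matrix.sum_mulVec, dotProduct_sum,
    Matrix.vecMulVec_mulVec]
  congr 1
  refine Finset.sum_congr rfl fun j _ => Finset.sum_congr rfl fun i _ => ?_
  simp [dotProduct_comm q, mul_comm]

/-- The exponential of the score in given directions, compensated by its quadratic variation. -/
noncomputable def expScore {k : ℕ} (s : ℝ) (u : κ → ℝ) (q : ι → ℝ) (θ : Param ds da)
    (h : Hist ds da M.H k) : ℝ :=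
  Real.exp (s * (u ⬝ᵥ (R.score θ h).mulVec q) -
    s ^ 2 / 2 * (u ⬝ᵥ u) * gramQuad R.steps (R.histFeat h) k q)

section Measurability

variable {k : ℕ}

theorem measurable_histFeat (j i : ℕ) :
    Measurable fun h : Hist ds da M.H k => R.histFeat h j i :=
  R.measurable_feat.comp (M.measurable_obsVec.comp (measurable_obsAt j i))

theorem measurable_histResid (j i : ℕ) :
    Measurable fun p : Param ds da × Hist ds da M.H k => R.histResid p.1 p.2 j i := by
  have h1 : ∀ i, Measurable fun p : Param ds da × Hist ds da M.H k => obsAt p.2 j i := fun i =>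
    (measurable_obsAt j i).comp measurable_snd
  exact (R.measurable_target.comp ((h1 i).prodMk (h1 (i + 1)))).sub
    (R.measurable_pred.comp (measurable_fst.prodMk (M.measurable_obsVec.comp (h1 i))))

theorem measurable_dotProduct {α : Type*} [MeasurableSpace α] {ν : Type*} [Fintype ν] (u : ν → ℝ)
    {f : α → ν → ℝ} (hf : Measurable f) : Measurable fun x => u ⬝ᵥ f x :=
  Finset.measurable_sum _ fun i _ => ((measurable_pi_apply i).comp hf).const_mul _

theorem measurable_gramQuad (q : ι → ℝ) :
    Measurable fun h : Hist ds da M.H k => gramQuad R.steps (R.histFeat h) k q :=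
  measurable_const.add (Finset.measurable_sum _ fun j _ => Finset.measurable_sum _ fun i _ =>
    (measurable_dotProduct q (R.measurable_histFeat j i)).pow_const 2)

theorem measurable_dotProduct_latent (u : κ → ℝ) (q : ι → ℝ) :
    Measurable fun θ => u ⬝ᵥ (R.latent θ).mulVec q :=
  Finset.measurable_sum _ fun a _ => Measurable.const_mul (Finset.measurable_sum _ fun b _ =>
    (R.measurable_latent a b).mul_const _) _

theorem measurable_expScore (s : ℝ) (u : κ → ℝ) (q : ι → ℝ) :
    Measurable fun p : Param ds da × Hist ds da M.H k => R.expScore s u q p.1 p.2 := by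
  unfold expScore
  refine Real.measurable_exp.comp (Measurable.sub (Measurable.const_mul ?_ _)
    (((R.measurable_gramQuad q).comp measurable_snd).const_mul _))
  simp only [dotProduct_score]
  refine ((R.measurable_dotProduct_latent u q).comp measurable_fst).sub
    (Finset.measurable_sum _ fun j _ => Finset.measurable_sum _ fun i _ => Measurable.mul ?_ ?_)
  · exact measurable_dotProduct u (R.measurable_histResid j i)
  · exact measurable_dotProduct q ((R.measurable_histFeat j i).comp measurable_snd)

end Measurability

/-! ### The exponential supermartingale of the score. -/

section Supermartingale

/-- Features of step `i` of an episode. -/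
noncomputable def stepFeat (θ : Param ds da) (μ : ℕ → Vec ds → Vec da) (ξ : EpisodeNoise ds)
    (i : ℕ) : ι → ℝ :=
  R.feat (M.obsVec (M.observation θ μ ξ i))

theorem stepFeat_update (θ : Param ds da) (μ : ℕ → Vec ds → Vec da) (ξ : EpisodeNoise ds)
    {i j : ℕ} (hij : j ≤ i) (e : Vec ds × ℝ) :
    R.stepFeat θ μ (ξ.1, Function.update ξ.2 i e) j = R.stepFeat θ μ ξ j := by
  simp only [stepFeat, observation, obsVec, M.rawState_update θ μ ξ hij]

theorem measurable_stepFeat {α : Type*} [MeasurableSpace α] {θ : α → Param ds da}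
    {μ : α → ℕ → Vec ds → Vec da} {ξ : α → EpisodeNoise ds} (hθ : Measurable θ)
    (hμ : ∀ i, Measurable fun p : α × Vec ds => μ p.1 i p.2) (hξ : Measurable ξ) (i : ℕ) :
    Measurable fun x => R.stepFeat (θ x) (μ x) (ξ x) i :=
  R.measurable_feat.comp (M.measurable_obsVec.comp (M.measurable_observation hθ hμ hξ i))

/-- Factor of step `i` of an episode in the exponential of the score. -/
noncomputable def stepExponent (s : ℝ) (u : κ → ℝ) (q : ι → ℝ) (θ : Param ds da)
    (μ : ℕ → Vec ds → Vec da) (ξ : EpisodeNoise ds) (i : ℕ) : ℝ :=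
  -(s * ((u ⬝ᵥ R.noise (ξ.2 i)) * (q ⬝ᵥ R.stepFeat θ μ ξ i))) -
    s ^ 2 / 2 * (u ⬝ᵥ u) * (q ⬝ᵥ R.stepFeat θ μ ξ i) ^ 2

theorem measurable_stepExponent (s : ℝ) (u : κ → ℝ) (q : ι → ℝ) {α : Type*} [MeasurableSpace α]
    {θ : α → Param ds da} {μ : α → ℕ → Vec ds → Vec da} {ξ : α → EpisodeNoise ds}
    (hθ : Measurable θ) (hμ : ∀ i, Measurable fun p : α × Vec ds => μ p.1 i p.2)
    (hξ : Measurable ξ) (i : ℕ) :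
    Measurable fun x => R.stepExponent s u q (θ x) (μ x) (ξ x) i := by
  have h1 := measurable_dotProduct q (R.measurable_stepFeat hθ hμ hξ i)
  have h2 := measurable_dotProduct u (R.measurable_noise.comp
    ((measurable_pi_apply i).comp (measurable_snd.comp hξ)))
  exact (((h2.mul h1).const_mul s).neg).sub ((h1.pow_const 2).const_mul _)

/-- The features of step `m` and all earlier factors are determined before the noise of step `m`.
That noise is therefore integrated alone, and the compensator cancels the bound on its exponential
moment exactly. -/
theorem lintegral_prod_stepExponent_le (s : ℝ) (u : κ → ℝ) (q : ι → ℝ) (θ : Param ds da)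
    {μ : ℕ → Vec ds → Vec da} (hμ : ∀ i, Measurable (μ i)) (m : ℕ) :
    ∫⁻ ξ, ∏ i ∈ Finset.range m, ENNReal.ofReal (Real.exp (R.stepExponent s u q θ μ ξ i))
      ∂M.episodeLaw ≤ 1 := by
  have hμ' : ∀ {α : Type} [MeasurableSpace α] (i : ℕ),
      Measurable fun p : α × Vec ds => μ i p.2 := fun i => (hμ i).comp measurable_snd
  induction m with
  | zero => simp
  | succ m ih =>
    set w : EpisodeNoise ds → ℝ≥0∞ := fun ξ =>
      ∏ i ∈ Finset.range m, ENNReal.ofReal (Real.exp (R.stepExponent s u q θ μ ξ i)) with hw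
    set a : EpisodeNoise ds → ℝ := fun ξ => q ⬝ᵥ R.stepFeat θ μ ξ m with ha
    have hwm : Measurable w := Finset.measurable_prod _ fun i _ =>
      ENNReal.measurable_ofReal.comp (Real.measurable_exp.comp
        (R.measurable_stepExponent s u q measurable_const hμ' measurable_id i))
    have ham : Measurable a :=
      measurable_dotProduct q (R.measurable_stepFeat measurable_const hμ' measurable_id m)
    have hnm : Measurable fun e => u ⬝ᵥ R.noise e := measurable_dotProduct u R.measurable_noise
    have h1 := M.lintegral_episodeLaw_resample m
      (F := fun p => w p.1 * ENNReal.ofReal (Real.exp (-(s * ((u ⬝ᵥ R.noise p.2) * a p.1)) -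
        s ^ 2 / 2 * (u ⬝ᵥ u) * a p.1 ^ 2)))
      ((hwm.comp measurable_fst).mul (ENNReal.measurable_ofReal.comp (Real.measurable_exp.comp
        (((((hnm.comp measurable_snd).mul (ham.comp measurable_fst)).const_mul s).neg).sub
          (((ham.comp measurable_fst).pow_const 2).const_mul _))))) (by
        intro ξ e e'
        have e1 : a (ξ.1, Function.update ξ.2 m e') = a ξ := by
          simp only [ha, R.stepFeat_update θ μ ξ le_rfl]
        have e2 : w (ξ.1, Function.update ξ.2 m e') = w ξ := by
          refine Finset.prod_congr rfl fun i hi => ?_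
          have him : i < m := Finset.mem_range.1 hi
          simp only [stepExponent, R.stepFeat_update θ μ ξ him.le, Function.update_of_ne him.ne]
        simp only [e1, e2])
    have h2 : ∀ ξ, ∫⁻ e, w ξ * ENNReal.ofReal (Real.exp (-(s * ((u ⬝ᵥ R.noise e) * a ξ)) -
        s ^ 2 / 2 * (u ⬝ᵥ u) * a ξ ^ 2)) ∂(M.noiseF.prod M.noiseR) ≤ w ξ := by
      intro ξ
      have h3 : ∀ e, ENNReal.ofReal (Real.exp (-(s * ((u ⬝ᵥ R.noise e) * a ξ)) -
          s ^ 2 / 2 * (u ⬝ᵥ u) * a ξ ^ 2)) =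
          ENNReal.ofReal (Real.exp (((-(s * a ξ)) • u) ⬝ᵥ R.noise e)) *
            ENNReal.ofReal (Real.exp (-(s ^ 2 / 2 * (u ⬝ᵥ u) * a ξ ^ 2))) := by
        intro e
        rw [← ENNReal.ofReal_mul (Real.exp_pos _).le, ← Real.exp_add, smul_dotProduct,
          smul_eq_mul]
        congr 2; ring
      simp_rw [h3]
      have hm1 : Measurable fun e => ENNReal.ofReal
          (Real.exp (((-(s * a ξ)) • u) ⬝ᵥ R.noise e)) :=
        ENNReal.measurable_ofReal.comp (Real.measurable_exp.comp
          (measurable_dotProduct _ R.measurable_noise))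
      rw [lintegral_const_mul _ (hm1.mul_const _), lintegral_mul_const _ hm1]
      calc _ ≤ w ξ * (ENNReal.ofReal (Real.exp ((((-(s * a ξ)) • u) ⬝ᵥ ((-(s * a ξ)) • u)) / 2)) *
            ENNReal.ofReal (Real.exp (-(s ^ 2 / 2 * (u ⬝ᵥ u) * a ξ ^ 2)))) := by
            gcongr
            exact R.lintegral_noise _
        _ = w ξ := by
            rw [← ENNReal.ofReal_mul (Real.exp_pos _).le, ← Real.exp_add]
            have : (((-(s * a ξ)) • u) ⬝ᵥ ((-(s * a ξ)) • u)) / 2 +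
                -(s ^ 2 / 2 * (u ⬝ᵥ u) * a ξ ^ 2) = 0 := by
              simp only [smul_dotProduct, dotProduct_smul, smul_eq_mul]; ring
            rw [this]; simp
    simp only [Finset.prod_range_succ]
    refine le_trans (le_of_eq h1) (le_trans (lintegral_mono h2) ih)

variable {Ω : Type*} {plan : Param ds da → ℕ → Vec ds → Vec da} {θ : Ω → Param ds da}
  {θs : ℕ → Ω → Param ds da} {ξ : ℕ → Ω → EpisodeNoise ds}
  [MeasurableSpace Ω] {P : Measure Ω} [IsProbabilityMeasure P]

theorem obsAt_history {k j i : ℕ} (hj : j < k) (hi : i < M.H) (ω : Ω) :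
    obsAt (M.history plan θ θs ξ k ω) j i =
      M.observation (θ ω) (plan (θs j ω)) (ξ j ω) i := by
  simp [obsAt, hj, hi, history]

/-- At the true parameter the residuals are the noises, so the exponent splits over the steps. The
summand `q ⬝ᵥ q` of `gramQuad`, from the identity in the Gram matrix, becomes the compensator of the
prior term. -/
theorem expScore_history (s : ℝ) (u : κ → ℝ) (q : ι → ℝ) (k : ℕ) (ω : Ω) :
    R.expScore s u q (θ ω) (M.history plan θ θs ξ k ω) =
      Real.exp (s * (u ⬝ᵥ (R.latent (θ ω)).mulVec q) - s ^ 2 / 2 * (u ⬝ᵥ u) * (q ⬝ᵥ q)) *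
        ∏ j ∈ Finset.range k, ∏ i ∈ Finset.range R.steps,
          Real.exp (R.stepExponent s u q (θ ω) (plan (θs j ω)) (ξ j ω) i) := by
  simp only [← Real.exp_sum, ← Real.exp_add, expScore, dotProduct_score, gramQuad]
  congr 1
  have h : ∀ j ∈ Finset.range k, ∀ i ∈ Finset.range R.steps,
      R.stepExponent s u q (θ ω) (plan (θs j ω)) (ξ j ω) i =
      -(s * ((u ⬝ᵥ R.histResid (θ ω) (M.history plan θ θs ξ k ω) j i) *
        (q ⬝ᵥ R.histFeat (M.history plan θ θs ξ k ω) j i))) -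
      s ^ 2 / 2 * (u ⬝ᵥ u) * (q ⬝ᵥ R.histFeat (M.history plan θ θs ξ k ω) j i) ^ 2 := by
    intro j hj i hi
    have hj' := Finset.mem_range.1 hj
    have hi' := Finset.mem_range.1 hi
    have hiH : i < M.H := hi'.trans_le R.steps_le
    have e1 : R.histFeat (M.history plan θ θs ξ k ω) j i =
        R.stepFeat (θ ω) (plan (θs j ω)) (ξ j ω) i := by
      rw [histFeat, obsAt_history hj' hiH]; rfl
    have e2 : R.histResid (θ ω) (M.history plan θ θs ξ k ω) j i = R.noise ((ξ j ω).2 i) := by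
      rw [histResid, obsAt_history hj' hiH]
      exact R.target_sub _ _ _ i hi' _ fun h => obsAt_history hj' h ω
    rw [e1, e2]; rfl
  rw [Finset.sum_congr rfl fun j hj => Finset.sum_congr rfl (h j hj)]
  simp only [Finset.sum_sub_distrib, Finset.sum_neg_distrib, ← Finset.mul_sum]
  ring

/-- The prior acts like one more observation: the factor of the coefficients has mean at most one
under `π`, and the factors of the episodes do not increase it. -/
theorem lintegral_expScore_le (hP : M.IsPSRL plan θ θs ξ π P)
    (hplan : ∀ i, Measurable fun p : Param ds da × Vec ds => plan p.1 i p.2) (k : ℕ) (s : ℝ)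
    (u : κ → ℝ) (q : ι → ℝ) :
    ∫⁻ ω, ENNReal.ofReal (R.expScore s u q (θ ω) (M.history plan θ θs ξ k ω)) ∂P ≤ 1 := by
  have hΓ : Measurable fun p : Param ds da × Param ds da × EpisodeNoise ds =>
      ∏ i ∈ Finset.range R.steps,
        ENNReal.ofReal (Real.exp (R.stepExponent s u q p.1 (plan p.2.1) p.2.2 i)) := by
    refine Finset.measurable_prod _ fun i _ => ENNReal.measurable_ofReal.comp
      (Real.measurable_exp.comp (R.measurable_stepExponent s u q (by fun_prop) (fun n => ?_)
        (by fun_prop) i))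
    exact (hplan n).comp (f := fun p : (Param ds da × Param ds da × EpisodeNoise ds) × Vec ds =>
      (p.1.2.1, p.2)) (by fun_prop)
  have h := hP.lintegral_mul_prod_le hplan
    (Φ := fun t => ENNReal.ofReal (Real.exp (s * (u ⬝ᵥ (R.latent t).mulVec q) -
      s ^ 2 / 2 * (u ⬝ᵥ u) * (q ⬝ᵥ q))))
    (ENNReal.measurable_ofReal.comp (Real.measurable_exp.comp
      (((R.measurable_dotProduct_latent u q).const_mul s).sub_const _))) hΓ
    (fun t t' => R.lintegral_prod_stepExponent_le s u q t (μ := plan t')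
      (fun i => (hplan i).comp (f := fun x => (t', x)) (by fun_prop)) R.steps) k
  refine le_trans (le_of_eq ?_) (h.trans ?_)
  · refine lintegral_congr fun ω => ?_
    rw [expScore_history, ENNReal.ofReal_mul (Real.exp_pos _).le, ENNReal.ofReal_prod_of_nonneg
      fun j _ => Finset.prod_nonneg fun i _ => (Real.exp_pos _).le]
    congr 1
    refine Finset.prod_congr rfl fun j _ => ?_
    rw [ENNReal.ofReal_prod_of_nonneg fun i _ => (Real.exp_pos _).le]
  · have h3 : ∀ t, ENNReal.ofReal (Real.exp (s * (u ⬝ᵥ (R.latent t).mulVec q) -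
        s ^ 2 / 2 * (u ⬝ᵥ u) * (q ⬝ᵥ q))) =
        ENNReal.ofReal (Real.exp ((s • u) ⬝ᵥ (R.latent t).mulVec q)) *
          ENNReal.ofReal (Real.exp (-(s ^ 2 / 2 * (u ⬝ᵥ u) * (q ⬝ᵥ q)))) := by
      intro t
      rw [← ENNReal.ofReal_mul (Real.exp_pos _).le, ← Real.exp_add, smul_dotProduct,
        smul_eq_mul]
      congr 2
    simp_rw [h3]
    have hm : Measurable fun t => ENNReal.ofReal (Real.exp ((s • u) ⬝ᵥ (R.latent t).mulVec q)) :=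
      ENNReal.measurable_ofReal.comp (Real.measurable_exp.comp
        (R.measurable_dotProduct_latent _ q))
    rw [lintegral_mul_const _ hm]
    calc _ ≤ ENNReal.ofReal (Real.exp (((s • u) ⬝ᵥ (s • u)) * (q ⬝ᵥ q) / 2)) *
          ENNReal.ofReal (Real.exp (-(s ^ 2 / 2 * (u ⬝ᵥ u) * (q ⬝ᵥ q)))) := by
          gcongr
          exact R.lintegral_latent _ _
      _ = 1 := by
          rw [← ENNReal.ofReal_mul (Real.exp_pos _).le, ← Real.exp_add]
          have : ((s • u) ⬝ᵥ (s • u)) * (q ⬝ᵥ q) / 2 +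
              -(s ^ 2 / 2 * (u ⬝ᵥ u) * (q ⬝ᵥ q)) = 0 := by
            simp only [smul_dotProduct, dotProduct_smul, smul_eq_mul]; ring
          rw [this]; simp

end Supermartingale

end Regression

end ControlProblem

/-! ### Confidence widths and their fourth moments. -/

theorem Real.log_one_add_pow_four_le {z : ℝ} (hz : 0 ≤ z) :
    Real.log (1 + z) ^ 4 ≤ 24 * (1 + z) := by
  have h := Real.pow_div_factorial_le_exp (Real.log (1 + z)) (Real.log_nonneg (by linarith)) 4
  rw [Real.exp_log (by linarith)] at h
  have h4 : ((Nat.factorial 4 : ℕ) : ℝ) = 24 := by norm_num [Nat.factorial]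
  rw [h4, div_le_iff₀ (by norm_num)] at h
  linarith

theorem add_pow_four_le (a b : ℝ) : (a + b) ^ 4 ≤ 8 * (a ^ 4 + b ^ 4) := by
  nlinarith [sq_nonneg (a - b), sq_nonneg (a ^ 2 - b ^ 2), mul_nonneg (sq_nonneg (a - b))
    (sq_nonneg (a + b)), mul_nonneg (sq_nonneg (a - b)) (sq_nonneg (a - b))]

namespace ControlProblem

variable {ds da : ℕ}

namespace Regression

variable {M : ControlProblem ds da} {π : Measure (Param ds da)} {κ ι : Type} [Fintype κ]
  [Fintype ι] (R : Regression M π κ ι)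

theorem expScore_nonneg {k : ℕ} (s : ℝ) (u : κ → ℝ) (q : ι → ℝ) (θ : Param ds da)
    (h : Hist ds da M.H k) : 0 ≤ R.expScore s u q θ h := (Real.exp_pos _).le

variable [DecidableEq ι]

/-- With linear predictions the score is `latent θ * gramMat` minus a matrix built from the targets
only, and that matrix cancels in the difference. -/
theorem score_sub_score {k : ℕ} {θ θ' : Param ds da} (h : Hist ds da M.H k)
    (hθ : ∀ x, R.pred θ x = (R.latent θ).mulVec (R.feat x))
    (hθ' : ∀ x, R.pred θ' x = (R.latent θ').mulVec (R.feat x)) :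
    R.score θ h - R.score θ' h =
      (R.latent θ - R.latent θ') * gramMat R.steps (R.histFeat h) k := by
  have h1 : ∀ j i, Matrix.vecMulVec (R.histResid θ' h j i) (R.histFeat h j i) -
      Matrix.vecMulVec (R.histResid θ h j i) (R.histFeat h j i) =
      (R.latent θ - R.latent θ') * Matrix.vecMulVec (R.histFeat h j i) (R.histFeat h j i) := by
    intro j i
    have : R.histResid θ' h j i - R.histResid θ h j i =
        (R.latent θ - R.latent θ').mulVec (R.histFeat h j i) := by
      simp only [histResid, hθ, hθ', Matrix.sub_mulVec, histFeat]
      abel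
    rw [Matrix.mul_vecMulVec, ← this, Matrix.sub_vecMulVec]
  simp only [gramMat, Matrix.mul_add, Matrix.mul_one, Matrix.mul_sum, ← h1,
    Finset.sum_sub_distrib, score]
  abel

variable [DecidableEq κ]

/-- Sum of the exponentials of the score over a grid of directions. -/
noncomputable def gridSum (m : ℕ) {k : ℕ} (θ : Param ds da) (h : Hist ds da M.H k) : ℝ :=
  ∑ p : κ → Fin (2 * m + 1), ∑ l : ι → Fin (2 * m + 1),
    R.expScore √(Fintype.card ι) (gridVec m p) (gridVec m l) θ h

/-- Logarithm of the size of the grid, up to constants. -/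
noncomputable def gridLog (m : ℕ) : ℝ := 8 + 2 * Real.log (2 * m + 1)

theorem le_gridLog (m : ℕ) : 8 ≤ gridLog m := by
  have : 0 ≤ Real.log (2 * m + 1) := Real.log_nonneg (by linarith [m.cast_nonneg (α := ℝ)])
  unfold gridLog; linarith

/-- Width of the confidence ellipsoid that contains a parameter. -/
noncomputable def width (m : ℕ) {k : ℕ} (θ : Param ds da) (h : Hist ds da M.H k) : ℝ :=
  √(Fintype.card ι) * (gridLog m +
    Real.log (1 + R.gridSum m θ h / (2 * m + 1) ^ (2 * Fintype.card ι)))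

theorem gridSum_nonneg (m : ℕ) {k : ℕ} (θ : Param ds da) (h : Hist ds da M.H k) :
    0 ≤ R.gridSum m θ h :=
  Finset.sum_nonneg fun _ _ => Finset.sum_nonneg fun _ _ => (Real.exp_pos _).le

theorem width_nonneg (m : ℕ) {k : ℕ} (θ : Param ds da) (h : Hist ds da M.H k) :
    0 ≤ R.width m θ h := by
  have h1 := R.gridSum_nonneg m θ h
  have h2 : 0 ≤ Real.log (1 + R.gridSum m θ h / (2 * m + 1) ^ (2 * Fintype.card ι)) :=
    Real.log_nonneg (by linarith [div_nonneg h1 (by positivity :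
      (0 : ℝ) ≤ (2 * m + 1) ^ (2 * Fintype.card ι))])
  exact mul_nonneg (Real.sqrt_nonneg _) (by linarith [le_gridLog m])

theorem measurable_gridSum (m k : ℕ) :
    Measurable fun p : Param ds da × Hist ds da M.H k => R.gridSum m p.1 p.2 :=
  Finset.measurable_sum _ fun _ _ => Finset.measurable_sum _ fun _ _ => R.measurable_expScore _ _ _

theorem measurable_width (m k : ℕ) :
    Measurable fun p : Param ds da × Hist ds da M.H k => R.width m p.1 p.2 :=
  (((Real.measurable_log.comp (((R.measurable_gridSum m k).div_const _).const_add _))).const_add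
    _).const_mul _

/-- The score is bounded by the width in the norm of the Gram matrix of the features. -/
theorem dotProduct_score_le {m k : ℕ} (hd : 1 ≤ Fintype.card ι)
    (hκ : Fintype.card κ ≤ Fintype.card ι) (θ : Param ds da) {h : Hist ds da M.H k}
    (hz : ∀ j < k, ∀ i < R.steps, R.histFeat h j i ⬝ᵥ R.histFeat h j i ≤ R.c)
    (hm : Fintype.card ι * (1 + k * R.steps * R.c) ≤ m) (u : κ → ℝ) (q : ι → ℝ) :
    u ⬝ᵥ (R.score θ h).mulVec q ≤
      R.width m θ h * √(u ⬝ᵥ u) * √(gramQuad R.steps (R.histFeat h) k q) := by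
  have hc := R.c_nonneg
  have hd' : (1 : ℝ) ≤ Fintype.card ι := by exact_mod_cast hd
  have hmd : (Fintype.card ι : ℝ) ≤ m := by
    refine le_trans ?_ hm
    have : 0 ≤ (k : ℝ) * R.steps * R.c := by positivity
    nlinarith
  have hm0 : 0 < m := by
    have : (0 : ℝ) < m := by linarith
    exact_mod_cast this
  have hg0 := gramQuad_nonneg R.steps (R.histFeat h) k q
  rcases eq_or_lt_of_le (dotProduct_self_nonneg' u) with hu | hu
  · have : u = 0 := by
      rwa [eq_comm, dotProduct_self_eq_zero] at hu
    simp [this]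
  rcases eq_or_lt_of_le hg0 with hq | hq
  · have h1 := dotProduct_self_le_gramQuad R.steps (R.histFeat h) k q
    have h2 := dotProduct_self_nonneg' q
    have : q = 0 := dotProduct_self_eq_zero.1 (by linarith)
    subst this
    simp [← hq]
  have hsu := Real.sqrt_pos.2 hu
  have hsq := Real.sqrt_pos.2 hq
  have hu1 : ((√(u ⬝ᵥ u))⁻¹ • u) ⬝ᵥ ((√(u ⬝ᵥ u))⁻¹ • u) ≤ 1 := by
    rw [smul_dotProduct, dotProduct_smul, smul_eq_mul, smul_eq_mul, ← mul_assoc, ← mul_inv,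
      Real.mul_self_sqrt hu.le, inv_mul_cancel₀ hu.ne']
  have hq1 : gramQuad R.steps (R.histFeat h) k
      ((√(gramQuad R.steps (R.histFeat h) k q))⁻¹ • q) ≤ 1 := by
    rw [gramQuad_smul, inv_pow, Real.sq_sqrt hq.le, inv_mul_cancel₀ hq.ne']
  -- The discretised bound is applied to the normalised directions with `s = √d`, the scale at which
  -- `8 s²` and the logarithm of the grid size are both of order `d`.
  have key := bilin_le_of_grid hc hz hm0 hm ((by exact_mod_cast hκ :
    (Fintype.card κ : ℝ) ≤ Fintype.card ι).trans hmd) (R.score θ h)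
    (Real.sqrt_nonneg (Fintype.card ι)) hu1 hq1
  have hS : R.gridSum m θ h = ∑ p : κ → Fin (2 * m + 1), ∑ l : ι → Fin (2 * m + 1),
      Real.exp (√(Fintype.card ι) * (gridVec m p ⬝ᵥ (R.score θ h).mulVec (gridVec m l)) -
        √(Fintype.card ι) ^ 2 / 2 * (gridVec m p ⬝ᵥ gridVec m p) *
          gramQuad R.steps (R.histFeat h) k (gridVec m l)) := rfl
  rw [← hS] at key
  have hSpos : 0 < R.gridSum m θ h :=
    Finset.sum_pos (fun _ _ => Finset.sum_pos (fun _ _ => Real.exp_pos _) Finset.univ_nonempty)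
      Finset.univ_nonempty
  set D : ℝ := (2 * m + 1) ^ (2 * Fintype.card ι) with hD
  have hDpos : 0 < D := by positivity
  -- The bound `D` on the mean of the grid sum at the true parameter is split off; what remains is
  -- the logarithm of one plus a variable of mean at most one there.
  have hlog : Real.log (R.gridSum m θ h) ≤
      2 * Fintype.card ι * Real.log (2 * m + 1) + Real.log (1 + R.gridSum m θ h / D) := by
    have h1 : Real.log (R.gridSum m θ h) ≤ Real.log (D * (1 + R.gridSum m θ h / D)) := by
      refine Real.log_le_log hSpos ?_
      rw [mul_add, mul_div_cancel₀ _ hDpos.ne']; linarith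
    rw [Real.log_mul hDpos.ne' (by positivity), hD, Real.log_pow] at h1
    push_cast at h1
    exact h1
  rw [Real.sq_sqrt (by positivity), Matrix.mulVec_smul, dotProduct_smul, smul_dotProduct,
    smul_eq_mul, smul_eq_mul] at key
  set L := Real.log (1 + R.gridSum m θ h / D) with hL
  have hL0 : 0 ≤ L := Real.log_nonneg (by linarith [div_nonneg hSpos.le hDpos.le])
  set t := u ⬝ᵥ (R.score θ h).mulVec q
  set d : ℝ := ((Fintype.card ι : ℕ) : ℝ)
  have hsd : 0 < √d := Real.sqrt_pos.2 (by linarith)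
  -- The random logarithm `L` enters `√d * width` with the factor `d ≥ 1`, which only enlarges the
  -- bound.
  have h3 : √d * ((√(gramQuad R.steps (R.histFeat h) k q))⁻¹ * ((√(u ⬝ᵥ u))⁻¹ * t)) ≤
      √d * R.width m θ h := by
    refine key.trans ?_
    rw [width, ← mul_assoc, Real.mul_self_sqrt (by positivity), gridLog]
    nlinarith
  have h4 := le_of_mul_le_mul_left h3 hsd
  rw [← mul_assoc, ← mul_inv, inv_mul_le_iff₀ (by positivity)] at h4
  linarith

/-- Each summand has mean at most one. There are `(2m + 1)` to the power `card κ + card ι` of them,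
and `hκ` bounds this exponent by `2 card ι`. -/
theorem lintegral_gridSum_le {Ω : Type*} {plan : Param ds da → ℕ → Vec ds → Vec da}
    {θ : Ω → Param ds da} {θs : ℕ → Ω → Param ds da} {ξ : ℕ → Ω → EpisodeNoise ds}
    [MeasurableSpace Ω] {P : Measure Ω} [IsProbabilityMeasure P]
    (hP : M.IsPSRL plan θ θs ξ π P)
    (hplan : ∀ i, Measurable fun p : Param ds da × Vec ds => plan p.1 i p.2)
    (hκ : Fintype.card κ ≤ Fintype.card ι) (m k : ℕ) :
    ∫⁻ ω, ENNReal.ofReal (R.gridSum m (θ ω) (M.history plan θ θs ξ k ω)) ∂P ≤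
      ENNReal.ofReal ((2 * m + 1) ^ (2 * Fintype.card ι)) := by
  have hhist := hP.measurable_history hplan k
  have hmeas := hP.measurable_θ.prodMk hhist
  have hm (s : ℝ) (u : κ → ℝ) (q : ι → ℝ) : Measurable fun ω =>
      ENNReal.ofReal (R.expScore s u q (θ ω) (M.history plan θ θs ξ k ω)) := by
    have := (R.measurable_expScore (k := k) s u q).comp hmeas
    exact this.ennreal_ofReal
  generalize hs : √((Fintype.card ι : ℕ) : ℝ) = s
  have h1 : ∀ ω, ENNReal.ofReal (R.gridSum m (θ ω) (M.history plan θ θs ξ k ω)) =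
      ∑ p : κ → Fin (2 * m + 1), ∑ l : ι → Fin (2 * m + 1), ENNReal.ofReal
        (R.expScore s (gridVec m p) (gridVec m l) (θ ω) (M.history plan θ θs ξ k ω)) := by
    intro ω
    rw [gridSum, hs, ENNReal.ofReal_sum_of_nonneg fun _ _ =>
      Finset.sum_nonneg fun _ _ => R.expScore_nonneg _ _ _ _ _]
    refine Finset.sum_congr rfl fun p _ => ?_
    rw [ENNReal.ofReal_sum_of_nonneg fun _ _ => R.expScore_nonneg _ _ _ _ _]
  rw [lintegral_congr h1, lintegral_finsetSum _ fun p _ =>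
    Finset.measurable_sum _ fun l _ => hm s (gridVec m p) (gridVec m l)]
  calc _ ≤ ∑ p : κ → Fin (2 * m + 1), ∑ l : ι → Fin (2 * m + 1), (1 : ℝ≥0∞) := by
        refine Finset.sum_le_sum fun p _ => ?_
        rw [lintegral_finsetSum _ fun l _ => hm s (gridVec m p) (gridVec m l)]
        exact Finset.sum_le_sum fun l _ => R.lintegral_expScore_le hP hplan k _ _ _
    _ = (((2 * m + 1) ^ (Fintype.card κ + Fintype.card ι) : ℕ) : ℝ≥0∞) := by
        simp [pow_add]
    _ ≤ (((2 * m + 1) ^ (2 * Fintype.card ι) : ℕ) : ℝ≥0∞) :=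
        Nat.cast_le.2 (Nat.pow_le_pow_right (by omega) (by omega))
    _ = _ := by
        rw [← ENNReal.ofReal_natCast]; push_cast; rfl

/-- Since `log(1 + z)⁴ ≤ 24 (1 + z)`, a bound on the mean of the grid sum suffices. It gives `d² (8
L⁴ + 384)` with `L = gridLog m`, and `L ≥ 8` absorbs the constant into `9 d² L⁴`. -/
theorem lintegral_width_pow_four_le {Ω : Type*} {plan : Param ds da → ℕ → Vec ds → Vec da}
    {θ : Ω → Param ds da} {θs : ℕ → Ω → Param ds da} {ξ : ℕ → Ω → EpisodeNoise ds}
    [MeasurableSpace Ω] {P : Measure Ω} [IsProbabilityMeasure P]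
    (hP : M.IsPSRL plan θ θs ξ π P)
    (hplan : ∀ i, Measurable fun p : Param ds da × Vec ds => plan p.1 i p.2)
    (hκ : Fintype.card κ ≤ Fintype.card ι) (m k : ℕ) :
    ∫⁻ ω, ENNReal.ofReal (R.width m (θ ω) (M.history plan θ θs ξ k ω) ^ 4) ∂P ≤
      ENNReal.ofReal (9 * (Fintype.card ι : ℝ) ^ 2 * gridLog m ^ 4) := by
  set d : ℝ := ((Fintype.card ι : ℕ) : ℝ)
  set D : ℝ := (2 * m + 1) ^ (2 * Fintype.card ι) with hD
  have hDpos : 0 < D := by positivity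
  have hhist := hP.measurable_history hplan k
  have hmeas := hP.measurable_θ.prodMk hhist
  have hS := R.lintegral_gridSum_le hP hplan hκ m k
  have hpt : ∀ ω, ENNReal.ofReal (R.width m (θ ω) (M.history plan θ θs ξ k ω) ^ 4) ≤
      ENNReal.ofReal (d ^ 2 * 8 * (gridLog m ^ 4 + 24)) + ENNReal.ofReal (d ^ 2 * 192 / D) *
        ENNReal.ofReal (R.gridSum m (θ ω) (M.history plan θ θs ξ k ω)) := by
    intro ω
    have hS0 := R.gridSum_nonneg m (θ ω) (M.history plan θ θs ξ k ω)
    rw [← ENNReal.ofReal_mul (by positivity), ← ENNReal.ofReal_add (by positivity)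
      (by positivity)]
    refine ENNReal.ofReal_le_ofReal ?_
    have h1 := Real.log_one_add_pow_four_le (div_nonneg hS0 hDpos.le)
    have h2 := add_pow_four_le (gridLog m)
      (Real.log (1 + R.gridSum m (θ ω) (M.history plan θ θs ξ k ω) / D))
    have h3 : √d ^ 4 = d ^ 2 := by
      rw [show 4 = 2 * 2 from rfl, pow_mul, Real.sq_sqrt (by positivity)]
    rw [width, mul_pow, h3]
    calc d ^ 2 * _ ≤ d ^ 2 * (8 * (gridLog m ^ 4 +
          24 * (1 + R.gridSum m (θ ω) (M.history plan θ θs ξ k ω) / D))) := by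
          gcongr
          linarith
      _ = _ := by ring
  have hSm : Measurable fun ω =>
      ENNReal.ofReal (R.gridSum m (θ ω) (M.history plan θ θs ξ k ω)) := by
    have := (R.measurable_gridSum m k).comp hmeas
    exact this.ennreal_ofReal
  calc _ ≤ ∫⁻ ω, (ENNReal.ofReal (d ^ 2 * 8 * (gridLog m ^ 4 + 24)) +
        ENNReal.ofReal (d ^ 2 * 192 / D) *
          ENNReal.ofReal (R.gridSum m (θ ω) (M.history plan θ θs ξ k ω))) ∂P :=
        lintegral_mono hpt
    _ ≤ ENNReal.ofReal (d ^ 2 * 8 * (gridLog m ^ 4 + 24)) +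
        ENNReal.ofReal (d ^ 2 * 192 / D) * ENNReal.ofReal D := by
        rw [lintegral_add_left measurable_const, lintegral_const_mul _ hSm, lintegral_const,
          measure_univ, mul_one]
        gcongr
    _ ≤ _ := by
        rw [← ENNReal.ofReal_mul (by positivity), ← ENNReal.ofReal_add (by positivity)
          (by positivity)]
        refine ENNReal.ofReal_le_ofReal ?_
        rw [div_mul_cancel₀ _ hDpos.ne']
        have h8 : (8 : ℝ) ^ 4 ≤ gridLog m ^ 4 := by
          have := le_gridLog m; gcongr
        nlinarith [sq_nonneg d]

/-- The difference of predictions is `v = (N' - N) q` with `N, N'` the scores and `q = V⁻¹ feat x`.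
Testing it against `v` itself uses each score bound once, and the Gram norm of `q` is the square
root on the right. -/
theorem sqrt_dotProduct_le_width {m k : ℕ} (hd : 1 ≤ Fintype.card ι)
    (hκ : Fintype.card κ ≤ Fintype.card ι) {θ θ' : Param ds da} {h : Hist ds da M.H k}
    (hθ : ∀ x, R.pred θ x = (R.latent θ).mulVec (R.feat x))
    (hθ' : ∀ x, R.pred θ' x = (R.latent θ').mulVec (R.feat x))
    (hz : ∀ j < k, ∀ i < R.steps, R.histFeat h j i ⬝ᵥ R.histFeat h j i ≤ R.c)
    (hm : Fintype.card ι * (1 + k * R.steps * R.c) ≤ m) (x : SAVec ds da) :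
    √((R.pred θ' x - R.pred θ x) ⬝ᵥ (R.pred θ' x - R.pred θ x)) ≤
      (R.width m θ h + R.width m θ' h) * √(R.feat x ⬝ᵥ
        ((gramMat R.steps (R.histFeat h) k)⁻¹.mulVec (R.feat x))) := by
  set V := gramMat R.steps (R.histFeat h) k
  have hV : V.PosDef := posDef_gram _ _ _
  set q := V⁻¹.mulVec (R.feat x)
  set v := R.pred θ' x - R.pred θ x with hv
  have hq : gramQuad R.steps (R.histFeat h) k q = R.feat x ⬝ᵥ q := by
    rw [← gram_quad, mulVec_inv_mulVec hV, dotProduct_comm]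
  have h1 : (R.score θ' h - R.score θ h).mulVec q = v := by
    rw [R.score_sub_score h hθ' hθ, ← Matrix.mulVec_mulVec, mulVec_inv_mulVec hV,
      Matrix.sub_mulVec, hv, hθ, hθ']
  have h2 := R.dotProduct_score_le hd hκ θ' hz hm v q
  have h3 := R.dotProduct_score_le hd hκ θ hz hm (-v) q
  rw [neg_dotProduct_neg, neg_dotProduct] at h3
  have h4 : v ⬝ᵥ v = v ⬝ᵥ (R.score θ' h).mulVec q - v ⬝ᵥ (R.score θ h).mulVec q := by
    rw [← dotProduct_sub, ← Matrix.sub_mulVec, h1]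
  rw [hq] at h2 h3
  have hvv := dotProduct_self_nonneg' v
  rcases eq_or_lt_of_le (Real.sqrt_nonneg (v ⬝ᵥ v)) with h0 | h0
  · rw [← h0]
    exact mul_nonneg (add_nonneg (R.width_nonneg _ _ _) (R.width_nonneg _ _ _))
      (Real.sqrt_nonneg _)
  · have h5 := Real.mul_self_sqrt hvv
    refine le_of_mul_le_mul_left ?_ h0
    rw [h5]
    linarith

end Regression

end ControlProblem

/-! ### Sums of prediction errors over all episodes. -/

/-- The weight `r`, the widths `b, b'` and the potential `y` will be dependent random variables. Two
weighted AM–GM inequalities separate them: `y` is then summed pathwise, and the others need only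
their fourth moments. The parameters `l` and `m` are left free for balancing. -/
theorem mul_le_of_le_mul_sqrt {r t b b' y l m : ℝ} (hr : 0 ≤ r) (hy : 0 ≤ y)
    (ht : t ≤ (b + b') * √y) (hl : 0 < l) (hm : 0 < m) :
    r * t ≤ l / 2 * y + 1 / (4 * l) * (m * r ^ 4 + 8 / m * (b ^ 4 + b' ^ 4)) := by
  have h1 : r * t ≤ r * ((b + b') * √y) := by gcongr
  have h2 : r * ((b + b') * √y) ≤ l / 2 * y + 1 / (2 * l) * (r * (b + b')) ^ 2 := by
    have hs := Real.sq_sqrt hy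
    have h := sq_nonneg (l * √y - r * (b + b'))
    have h' : 0 ≤ 1 / (2 * l) * (l * √y - r * (b + b')) ^ 2 := by positivity
    have e : 1 / (2 * l) * (l * √y - r * (b + b')) ^ 2 =
        l / 2 * √y ^ 2 + 1 / (2 * l) * (r * (b + b')) ^ 2 - r * ((b + b') * √y) := by
      field_simp; ring
    rw [hs] at e
    linarith
  have h3 : (r * (b + b')) ^ 2 ≤ 1 / 2 * (m * r ^ 4 + 8 / m * (b ^ 4 + b' ^ 4)) := by
    have h := add_pow_four_le b b'
    have h' : 0 ≤ 1 / (2 * m) * (m * r ^ 2 - (b + b') ^ 2) ^ 2 := by positivity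
    have e : 1 / (2 * m) * (m * r ^ 2 - (b + b') ^ 2) ^ 2 =
        1 / 2 * (m * r ^ 4 + 1 / m * (b + b') ^ 4) - (r * (b + b')) ^ 2 := by
      field_simp; ring
    have h5 : 1 / m * (b + b') ^ 4 ≤ 1 / m * (8 * (b ^ 4 + b' ^ 4)) := by gcongr
    have h6 : 1 / m * (8 * (b ^ 4 + b' ^ 4)) = 8 / m * (b ^ 4 + b' ^ 4) := by ring
    linarith
  have h4 : 1 / (2 * l) * (r * (b + b')) ^ 2 ≤
      1 / (2 * l) * (1 / 2 * (m * r ^ 4 + 8 / m * (b ^ 4 + b' ^ 4))) := by gcongr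
  have e : 1 / (2 * l) * (1 / 2 * (m * r ^ 4 + 8 / m * (b ^ 4 + b' ^ 4))) =
      1 / (4 * l) * (m * r ^ 4 + 8 / m * (b ^ 4 + b' ^ 4)) := by field_simp; ring
  linarith

namespace ControlProblem

variable {ds da : ℕ} {M : ControlProblem ds da} {π : Measure (Param ds da)}
  {Ω : Type*} {plan : Param ds da → ℕ → Vec ds → Vec da} {θ : Ω → Param ds da}
  {θs : ℕ → Ω → Param ds da} {ξ : ℕ → Ω → EpisodeNoise ds}
  [MeasurableSpace Ω] {P : Measure Ω} [IsProbabilityMeasure P]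

theorem IsPSRL.law_sample (hP : M.IsPSRL plan θ θs ξ π P)
    (hplan : ∀ i, Measurable fun p : Param ds da × Vec ds => plan p.1 i p.2) (k : ℕ) :
    P.map (θs k) = π := by
  have h := congrArg (Measure.map Prod.fst) (hP.map_sample_history hplan k)
  have hh := hP.measurable_history hplan k
  rw [Measure.map_map measurable_fst ((hP.measurable_θs k).prodMk hh),
    Measure.map_map measurable_fst (hP.measurable_θ.prodMk hh)] at h
  rw [← hP.law_θ]
  exact h

theorem IsPSRL.ae_sample (hP : M.IsPSRL plan θ θs ξ π P)
    (hplan : ∀ i, Measurable fun p : Param ds da × Vec ds => plan p.1 i p.2)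
    {p : Param ds da → Prop} (hp : ∀ᵐ t ∂π, p t) : ∀ᵐ ω ∂P, p (θ ω) ∧ ∀ k, p (θs k ω) := by
  refine Filter.Eventually.and ?_ (ae_all_iff.2 fun k => ?_)
  · exact ae_of_ae_map hP.measurable_θ.aemeasurable (hP.law_θ.symm ▸ hp)
  · exact ae_of_ae_map (hP.measurable_θs k).aemeasurable ((hP.law_sample hplan k).symm ▸ hp)

namespace Regression

variable {κ ι : Type} [Fintype κ] [Fintype ι] (R : Regression M π κ ι)

/-- Norm of the difference of the predictions with two parameters. -/
noncomputable def gap (θ' θ : Param ds da) (x : SAVec ds da) : ℝ :=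
  √((R.pred θ' x - R.pred θ x) ⬝ᵥ (R.pred θ' x - R.pred θ x))

theorem measurable_gap {α : Type*} [MeasurableSpace α] {θ' θ : α → Param ds da}
    {x : α → SAVec ds da} (hθ' : Measurable θ') (hθ : Measurable θ) (hx : Measurable x) :
    Measurable fun a => R.gap (θ' a) (θ a) (x a) := by
  have h1 := (R.measurable_pred.comp (hθ'.prodMk hx)).sub (R.measurable_pred.comp (hθ.prodMk hx))
  exact (Finset.measurable_sum _ fun i _ =>
    ((measurable_pi_apply i).comp h1).mul ((measurable_pi_apply i).comp h1)).sqrt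

/-- Deviation of the predictions of the sampled parameter at step `i` of episode `k`. -/
noncomputable def sampleGap (R : Regression M π κ ι) (plan : Param ds da → ℕ → Vec ds → Vec da)
    (θ : Ω → Param ds da) (θs : ℕ → Ω → Param ds da) (ξ : ℕ → Ω → EpisodeNoise ds)
    (k i : ℕ) (ω : Ω) : ℝ :=
  R.gap (θs k ω) (θ ω) (M.obsVec (M.observation (θ ω) (plan (θs k ω)) (ξ k ω) i))

theorem stepFeat_le (θ : Param ds da) {μ : ℕ → Vec ds → Vec da} (hμ : M.IsPolicy μ)
    (ξ : EpisodeNoise ds) (i : ℕ) : R.stepFeat θ μ ξ i ⬝ᵥ R.stepFeat θ μ ξ i ≤ R.c :=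
  R.feat_le _ (M.proj_mem _) _ ((hμ i).2 _ (M.proj_mem _))

theorem histFeat_history {k j i : ℕ} (hj : j < k) (hi : i < R.steps) (ω : Ω) :
    R.histFeat (M.history plan θ θs ξ k ω) j i =
      R.stepFeat (θ ω) (plan (θs j ω)) (ξ j ω) i := by
  rw [histFeat, obsAt_history hj (hi.trans_le R.steps_le)]; rfl

variable [DecidableEq ι] [DecidableEq κ]

theorem lintegral_width_sample (hP : M.IsPSRL plan θ θs ξ π P)
    (hplan : ∀ i, Measurable fun p : Param ds da × Vec ds => plan p.1 i p.2) (m k : ℕ) :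
    ∫⁻ ω, ENNReal.ofReal (R.width m (θs k ω) (M.history plan θ θs ξ k ω) ^ 4) ∂P =
      ∫⁻ ω, ENNReal.ofReal (R.width m (θ ω) (M.history plan θ θs ξ k ω) ^ 4) ∂P := by
  have hh := hP.measurable_history hplan k
  have hw := ((R.measurable_width m k).pow_const 4).ennreal_ofReal
  have h1 := lintegral_map (μ := P) hw ((hP.measurable_θs k).prodMk hh)
  have h2 := lintegral_map (μ := P) hw (hP.measurable_θ.prodMk hh)
  rw [hP.map_sample_history hplan k] at h1
  exact h1.symm.trans h2

theorem sum_mul_sampleGap_le {ρ : Param ds da → ℝ} (hρ : ∀ t, 0 ≤ ρ t)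
    (hd : 1 ≤ Fintype.card ι) (hκ : Fintype.card κ ≤ Fintype.card ι) {K m : ℕ}
    (hm : Fintype.card ι * (1 + K * R.steps * R.c) ≤ m) {l r : ℝ} (hl : 0 < l) (hr : 0 < r) {ω : Ω}
    (hθ : ∀ x, R.pred (θ ω) x = (R.latent (θ ω)).mulVec (R.feat x))
    (hθs : ∀ k x, R.pred (θs k ω) x = (R.latent (θs k ω)).mulVec (R.feat x))
    (hpol : ∀ k, M.IsPolicy (plan (θs k ω))) :
    ∑ k ∈ Finset.range K, ∑ i ∈ Finset.range R.steps,
      ρ (θs k ω) * R.sampleGap plan θ θs ξ k i ω ≤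
    l / 2 * ((1 + R.steps * R.c) * (1 + R.c) *
        (Fintype.card ι * Real.log (1 + K * R.steps * R.c))) +
      ∑ k ∈ Finset.range K, R.steps / (4 * l) * (r * ρ (θs k ω) ^ 4 +
        8 / r * (R.width m (θ ω) (M.history plan θ θs ξ k ω) ^ 4 +
          R.width m (θs k ω) (M.history plan θ θs ξ k ω) ^ 4)) := by
  have hc := R.c_nonneg
  set z : ℕ → ℕ → ι → ℝ := fun j i => R.stepFeat (θ ω) (plan (θs j ω)) (ξ j ω) i with hz
  have hzc : ∀ j i, z j i ⬝ᵥ z j i ≤ R.c := fun j i => R.stepFeat_le _ (hpol j) _ _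
  have hpot := sum_inv_gram_quad_le (n := R.steps) hc K (fun j _ i _ => hzc j i)
  -- The Gram matrices of the growing histories belong to one infinite array of features `z`, as the
  -- potential lemma requires.
  have hgram : ∀ k, gramMat R.steps (R.histFeat (M.history plan θ θs ξ k ω)) k =
      gramMat R.steps z k := by
    intro k
    unfold gramMat
    congr 1
    refine Finset.sum_congr rfl fun j hj => Finset.sum_congr rfl fun i hi => ?_
    rw [R.histFeat_history (Finset.mem_range.1 hj) (Finset.mem_range.1 hi)]
  have key : ∀ k ∈ Finset.range K, ∀ i ∈ Finset.range R.steps,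
      ρ (θs k ω) * R.sampleGap plan θ θs ξ k i ω ≤
        l / 2 * (z k i ⬝ᵥ (gramMat R.steps z k)⁻¹.mulVec (z k i)) +
        1 / (4 * l) * (r * ρ (θs k ω) ^ 4 +
        8 / r * (R.width m (θ ω) (M.history plan θ θs ξ k ω) ^ 4 +
          R.width m (θs k ω) (M.history plan θ θs ξ k ω) ^ 4)) := by
    intro k hk i _
    have hkK : (k : ℝ) ≤ K := by exact_mod_cast (Finset.mem_range.1 hk).le
    refine mul_le_of_le_mul_sqrt (hρ _) (inv_quad_nonneg (posDef_gram _ _ _) _) ?_ hl hr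
    rw [← hgram k]
    refine R.sqrt_dotProduct_le_width hd hκ hθ (hθs k) ?_ (le_trans ?_ hm) _
    · intro j hj i hi
      rw [R.histFeat_history hj hi]
      exact hzc j i
    · gcongr
  refine (Finset.sum_le_sum fun k hk => Finset.sum_le_sum (key k hk)).trans ?_
  simp only [Finset.sum_add_distrib, ← Finset.mul_sum, Finset.sum_const, Finset.card_range,
    nsmul_eq_mul]
  refine add_le_add (by gcongr) (le_of_eq ?_)
  ring

/-- The expected sum of the weighted deviations of the predictions of the sampled parameters. -/
theorem lintegral_sum_mul_sampleGap_le (hP : M.IsPSRL plan θ θs ξ π P)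
    (hplan : ∀ i, Measurable fun p : Param ds da × Vec ds => plan p.1 i p.2)
    (hpol : ∀ᵐ t ∂π, M.IsPolicy (plan t)) {ρ : Param ds da → ℝ} (hρm : Measurable ρ)
    (hρ : ∀ t, 0 ≤ ρ t) {a : ℝ} (ha : 0 < a)
    (hρa : ∫⁻ t, ENNReal.ofReal (ρ t ^ 4) ∂π ≤ ENNReal.ofReal (a ^ 4))
    (hd : 1 ≤ Fintype.card ι) (hκ : Fintype.card κ ≤ Fintype.card ι) {K m : ℕ} (hK : 0 < K)
    (hm : Fintype.card ι * (1 + K * R.steps * R.c) ≤ m) :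
    ∫⁻ ω, ∑ k ∈ Finset.range K, ∑ i ∈ Finset.range R.steps,
      ENNReal.ofReal (ρ (θs k ω) * R.sampleGap plan θ θs ξ k i ω) ∂P ≤
    ENNReal.ofReal (a * √K * Fintype.card ι * ((1 + R.steps * R.c) * (1 + R.c) *
      Real.log (1 + K * R.steps * R.c) / 2 + 6 * R.steps * gridLog m ^ 2)) := by
  have hc := R.c_nonneg
  have hK' : (0 : ℝ) < K := by exact_mod_cast hK
  have hsK : 0 < √(K : ℝ) := Real.sqrt_pos.2 hK'
  have hd' : (0 : ℝ) < Fintype.card ι := by exact_mod_cast hd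
  set d : ℝ := ((Fintype.card ι : ℕ) : ℝ) with hdd
  have hL := le_gridLog m
  set L := gridLog m
  -- `l` makes both halves of the first AM–GM proportional to `a √K d`. Below, `r` is chosen so that
  -- `r a⁴` and `(8/r) · 18 d² L⁴` both equal `12 a² d L²`.
  set l : ℝ := a * √K with hl
  have hl0 : 0 < l := by positivity
  set r : ℝ := 12 * d * L ^ 2 / a ^ 2 with hr
  have hL0 : 0 < L := by linarith
  have hr0 : 0 < r := by positivity
  set p : ℝ := l / 2 * ((1 + R.steps * R.c) * (1 + R.c) *
    (d * Real.log (1 + K * R.steps * R.c))) with hp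
  have hp0 : 0 ≤ p := by
    have : 0 ≤ Real.log (1 + K * R.steps * R.c) := Real.log_nonneg (by
      have : 0 ≤ K * R.steps * R.c := by positivity
      linarith)
    positivity
  set e : ℝ := R.steps / (4 * l) with he
  have he0 : 0 ≤ e := by positivity
  have hfeat := hP.ae_sample hplan R.pred_eq
  have hpol' := hP.ae_sample hplan hpol
  have hpt : ∀ᵐ ω ∂P, ∑ k ∈ Finset.range K, ∑ i ∈ Finset.range R.steps,
      ENNReal.ofReal (ρ (θs k ω) * R.sampleGap plan θ θs ξ k i ω) ≤
      ENNReal.ofReal p + ∑ k ∈ Finset.range K, (ENNReal.ofReal (e * r) *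
        ENNReal.ofReal (ρ (θs k ω) ^ 4) + ENNReal.ofReal (e * (8 / r)) *
          (ENNReal.ofReal (R.width m (θ ω) (M.history plan θ θs ξ k ω) ^ 4) +
          ENNReal.ofReal (R.width m (θs k ω) (M.history plan θ θs ξ k ω) ^ 4))) := by
    filter_upwards [hfeat, hpol'] with ω h1 h2
    have h3 := R.sum_mul_sampleGap_le (plan := plan) (ξ := ξ) hρ hd hκ hm hl0 hr0 h1.1 h1.2 h2.2
    have hg : ∀ k i, 0 ≤ ρ (θs k ω) * R.sampleGap plan θ θs ξ k i ω := fun k i =>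
      mul_nonneg (hρ _) (Real.sqrt_nonneg _)
    have h4 : ∑ k ∈ Finset.range K, ∑ i ∈ Finset.range R.steps,
        ENNReal.ofReal (ρ (θs k ω) * R.sampleGap plan θ θs ξ k i ω) =
        ENNReal.ofReal (∑ k ∈ Finset.range K, ∑ i ∈ Finset.range R.steps,
          ρ (θs k ω) * R.sampleGap plan θ θs ξ k i ω) := by
      rw [ENNReal.ofReal_sum_of_nonneg fun k _ => Finset.sum_nonneg fun i _ => hg k i]
      exact Finset.sum_congr rfl fun k _ => (ENNReal.ofReal_sum_of_nonneg fun i _ => hg k i).symm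
    rw [h4]
    refine (ENNReal.ofReal_le_ofReal h3).trans ?_
    have hw : ∀ t k, 0 ≤ R.width m t (M.history plan θ θs ξ k ω) ^ 4 := fun t k =>
      pow_nonneg (R.width_nonneg _ _ _) _
    have hr4 : ∀ k, 0 ≤ ρ (θs k ω) ^ 4 := fun k => pow_nonneg (hρ _) _
    refine ENNReal.ofReal_add_le.trans (add_le_add le_rfl ?_)
    rw [ENNReal.ofReal_sum_of_nonneg fun k _ => mul_nonneg he0 (add_nonneg
      (mul_nonneg hr0.le (hr4 k)) (mul_nonneg (by positivity) (add_nonneg (hw _ k) (hw _ k))))]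
    refine Finset.sum_le_sum fun k _ => le_of_eq ?_
    rw [← ENNReal.ofReal_add (hw _ k) (hw _ k), ← ENNReal.ofReal_mul (by positivity),
      ← ENNReal.ofReal_mul (by positivity), ← ENNReal.ofReal_add
      (mul_nonneg (by positivity) (hr4 k))
      (mul_nonneg (by positivity) (add_nonneg (hw _ k) (hw _ k)))]
    congr 1; ring
  have hρ4 : ∀ k, ∫⁻ ω, ENNReal.ofReal (ρ (θs k ω) ^ 4) ∂P ≤ ENNReal.ofReal (a ^ 4) := by
    intro k
    rw [← hP.law_sample hplan k, lintegral_map (hρm.pow_const 4).ennreal_ofReal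
      (hP.measurable_θs k)] at hρa
    exact hρa
  have hmρ : ∀ k, Measurable fun ω => ENNReal.ofReal (ρ (θs k ω) ^ 4) := fun k =>
    ((hρm.comp (hP.measurable_θs k)).pow_const 4).ennreal_ofReal
  have hmw : ∀ k, Measurable fun ω =>
      ENNReal.ofReal (R.width m (θ ω) (M.history plan θ θs ξ k ω) ^ 4) := by
    intro k
    have hh := hP.measurable_history hplan k
    have := (R.measurable_width m k).comp (hP.measurable_θ.prodMk hh)
    exact (this.pow_const 4).ennreal_ofReal
  have hmw' : ∀ k, Measurable fun ω =>
      ENNReal.ofReal (R.width m (θs k ω) (M.history plan θ θs ξ k ω) ^ 4) := by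
    intro k
    have hh := hP.measurable_history hplan k
    have := (R.measurable_width m k).comp ((hP.measurable_θs k).prodMk hh)
    exact (this.pow_const 4).ennreal_ofReal
  refine (lintegral_mono_ae hpt).trans ?_
  rw [lintegral_add_left measurable_const, lintegral_const, measure_univ, mul_one,
    lintegral_finsetSum]
  swap
  · exact fun k _ => ((hmρ k).const_mul _).add (((hmw k).add (hmw' k)).const_mul _)
  have hk : ∀ k ∈ Finset.range K, ∫⁻ ω, (ENNReal.ofReal (e * r) *
        ENNReal.ofReal (ρ (θs k ω) ^ 4) + ENNReal.ofReal (e * (8 / r)) *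
          (ENNReal.ofReal (R.width m (θ ω) (M.history plan θ θs ξ k ω) ^ 4) +
          ENNReal.ofReal (R.width m (θs k ω) (M.history plan θ θs ξ k ω) ^ 4))) ∂P ≤
      ENNReal.ofReal (e * (r * a ^ 4 + 8 / r * (2 * (9 * d ^ 2 * L ^ 4)))) := by
    intro k _
    have hw := R.lintegral_width_pow_four_le hP hplan hκ m k
    rw [lintegral_add_left ((hmρ k).const_mul _), lintegral_const_mul _ (hmρ k),
      lintegral_const_mul' _ _ ENNReal.ofReal_ne_top, lintegral_add_left (hmw k),
      R.lintegral_width_sample hP hplan]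
    calc _ ≤ ENNReal.ofReal (e * r) * ENNReal.ofReal (a ^ 4) + ENNReal.ofReal (e * (8 / r)) *
          (ENNReal.ofReal (9 * d ^ 2 * L ^ 4) + ENNReal.ofReal (9 * d ^ 2 * L ^ 4)) := by
          gcongr
          exact hρ4 k
      _ = _ := by
          rw [← ENNReal.ofReal_add (by positivity) (by positivity),
            ← ENNReal.ofReal_mul (by positivity), ← ENNReal.ofReal_mul (by positivity),
            ← ENNReal.ofReal_add (by positivity) (by positivity)]
          congr 1; ring
  refine (add_le_add le_rfl (Finset.sum_le_sum hk)).trans ?_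
  rw [Finset.sum_const, Finset.card_range, nsmul_eq_mul, ← ENNReal.ofReal_natCast,
    ← ENNReal.ofReal_mul hK'.le, ← ENNReal.ofReal_add hp0 (by positivity)]
  refine ENNReal.ofReal_le_ofReal (le_of_eq ?_)
  have hs2 : (K : ℝ) = √K ^ 2 := (Real.sq_sqrt hK'.le).symm
  have h9 : (K : ℝ) * (e * (r * a ^ 4 + 8 / r * (2 * (9 * d ^ 2 * L ^ 4)))) =
      a * √K * d * (6 * R.steps * L ^ 2) := by
    rw [he, hr, hl]
    generalize √(K : ℝ) = x at hs2 hsK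
    rw [hs2]
    field_simp
    ring
  rw [h9, hp, hl]
  ring

end Regression

end ControlProblem

/-! ### Whitening of a possibly degenerate Gaussian vector. -/

section Whitening

open scoped RealInnerProductSpace

variable {ι : Type*} [Fintype ι] [DecidableEq ι] {K : Matrix ι ι ℝ} (hK : K.PosSemidef)

namespace Matrix.PosSemidef

/-- Coordinates, in an eigenbasis, of the vectors scaled by the square root of the matrix. -/
noncomputable def rootCoord (x : EuclideanSpace ℝ ι) (i : ι) : ℝ :=
  √(hK.isHermitian.eigenvalues i) * ⟪hK.isHermitian.eigenvectorBasis i, x⟫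

/-- Coordinates, in an eigenbasis, of the vectors scaled by the inverse square root of the
matrix. -/
noncomputable def whiteCoord (w : EuclideanSpace ℝ ι) (i : ι) : ℝ :=
  (√(hK.isHermitian.eigenvalues i))⁻¹ * ⟪hK.isHermitian.eigenvectorBasis i, w⟫

theorem measurable_rootCoord : Measurable hK.rootCoord :=
  measurable_pi_iff.2 fun i => by unfold rootCoord; fun_prop

theorem measurable_whiteCoord : Measurable hK.whiteCoord :=
  measurable_pi_iff.2 fun i => by unfold whiteCoord; fun_prop

theorem quad_eq_sum (a : EuclideanSpace ℝ ι) :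
    a.ofLp ⬝ᵥ K.mulVec a.ofLp = ∑ i, hK.isHermitian.eigenvalues i *
      ⟪hK.isHermitian.eigenvectorBasis i, a⟫ ^ 2 := by
  set b := hK.isHermitian.eigenvectorBasis
  have h1 : a.ofLp ⬝ᵥ K.mulVec a.ofLp = ⟪a, WithLp.toLp 2 (K.mulVec a.ofLp)⟫ := by
    rw [EuclideanSpace.inner_eq_star_dotProduct, dotProduct_comm]; simp
  have h2 : ∀ i, ⟪b i, WithLp.toLp 2 (K.mulVec a.ofLp)⟫ =
      hK.isHermitian.eigenvalues i * ⟪b i, a⟫ := by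
    intro i
    rw [EuclideanSpace.inner_eq_star_dotProduct, EuclideanSpace.inner_eq_star_dotProduct]
    simp only [star_trivial]
    rw [dotProduct_comm, dotProduct_mulVec_symm hK.isHermitian,
      hK.isHermitian.mulVec_eigenvectorBasis, dotProduct_smul, smul_eq_mul]
  rw [h1, ← b.sum_inner_mul_inner]
  refine Finset.sum_congr rfl fun i _ => ?_
  rw [h2, real_inner_comm]; ring

theorem rootCoord_dotProduct_self (x : EuclideanSpace ℝ ι) :
    hK.rootCoord x ⬝ᵥ hK.rootCoord x = x.ofLp ⬝ᵥ K.mulVec x.ofLp := by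
  rw [hK.quad_eq_sum]
  refine Finset.sum_congr rfl fun i _ => ?_
  have := Real.mul_self_sqrt (hK.eigenvalues_nonneg i)
  rw [rootCoord]
  linear_combination ⟪hK.isHermitian.eigenvectorBasis i, x⟫ ^ 2 * this

/-- Coordinates with eigenvalue zero vanish, because `(√0)⁻¹ = 0`, while `q ⬝ᵥ q` still counts them:
hence an inequality, with equality for nondegenerate `K`. -/
theorem lintegral_exp_whiteCoord_le (q : ι → ℝ) :
    ∫⁻ w, ENNReal.ofReal (Real.exp (q ⬝ᵥ hK.whiteCoord w)) ∂(multivariateGaussian 0 K) ≤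
      ENNReal.ofReal (Real.exp ((q ⬝ᵥ q) / 2)) := by
  set b := hK.isHermitian.eigenvectorBasis with hb
  set a : EuclideanSpace ℝ ι := ∑ i, (q i * (√(hK.isHermitian.eigenvalues i))⁻¹) • b i
  have h1 : ∀ w, q ⬝ᵥ hK.whiteCoord w = ⟪a, w⟫ := by
    intro w
    simp only [a, sum_inner, inner_smul_left, dotProduct, whiteCoord]
    simp [mul_assoc, hb]
  have h2 : ∀ i, ⟪b i, a⟫ = q i * (√(hK.isHermitian.eigenvalues i))⁻¹ := by
    intro i
    simp only [a, inner_sum, inner_smul_right, orthonormal_iff_ite.1 b.orthonormal]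
    simp
  simp_rw [h1]
  rw [lintegral_exp_inner_multivariateGaussian hK]
  refine ENNReal.ofReal_le_ofReal (Real.exp_le_exp.2 ?_)
  refine div_le_div_of_nonneg_right ?_ (by norm_num)
  rw [hK.quad_eq_sum]
  refine Finset.sum_le_sum fun i _ => ?_
  rw [h2, mul_pow, inv_pow, Real.sq_sqrt (hK.eigenvalues_nonneg i)]
  rcases eq_or_ne (hK.isHermitian.eigenvalues i) 0 with h0 | h0
  · rw [h0]; simpa using mul_self_nonneg (q i)
  · rw [mul_left_comm, mul_inv_cancel₀ h0, mul_one, sq]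

/-- Along a null eigenvector the Gaussian coordinate has variance zero. There are finitely many
eigenvectors, so one exceptional set serves all `x`. -/
theorem ae_inner_eq : ∀ᵐ w ∂(multivariateGaussian 0 K), ∀ x : EuclideanSpace ℝ ι,
    ⟪w, x⟫ = hK.whiteCoord w ⬝ᵥ hK.rootCoord x := by
  set b := hK.isHermitian.eigenvectorBasis with hb
  have h1 : ∀ i, ∀ᵐ w ∂(multivariateGaussian 0 K),
      hK.isHermitian.eigenvalues i = 0 → ⟪b i, w⟫ = 0 := by
    intro i
    rcases eq_or_ne (hK.isHermitian.eigenvalues i) 0 with h0 | h0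
    · have h2 := lintegral_enorm_inner_sq_multivariateGaussian hK (b i)
      have h3 : (b i).ofLp ⬝ᵥ K.mulVec (b i).ofLp = 0 := by
        have := hK.isHermitian.mulVec_eigenvectorBasis i
        rw [h0, zero_smul] at this
        rw [hb, this, dotProduct_zero]
      rw [h3, ENNReal.ofReal_zero, lintegral_eq_zero_iff (by fun_prop)] at h2
      filter_upwards [h2] with w hw _
      simpa using hw
    · exact Filter.Eventually.of_forall fun w h => absurd h h0
  filter_upwards [ae_all_iff.2 h1] with w hw x
  rw [← b.sum_inner_mul_inner]
  refine Finset.sum_congr rfl fun i _ => ?_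
  rw [whiteCoord, rootCoord, real_inner_comm (b i) w]
  rcases eq_or_ne (hK.isHermitian.eigenvalues i) 0 with h0 | h0
  · rw [← hb, hw i h0]; simp
  · have : √(hK.isHermitian.eigenvalues i) ≠ 0 :=
      (Real.sqrt_pos.2 ((hK.eigenvalues_nonneg i).lt_of_ne h0.symm)).ne'
    rw [← hb]
    field_simp

end Matrix.PosSemidef

end Whitening

theorem linearKernel_eq {ds da : ℕ} (C : Matrix (Fin ds ⊕ Fin da) (Fin ds ⊕ Fin da) ℝ)
    (x : SAVec ds da) : linearKernel C x x = x.ofLp ⬝ᵥ C.mulVec x.ofLp := by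
  simp only [linearKernel, dotProduct, Matrix.mulVec, Finset.mul_sum, mul_assoc]

theorem lintegral_pi_prod {ι : Type*} [Fintype ι] {X : ι → Type*} [∀ i, MeasurableSpace (X i)]
    (μ : ∀ i, Measure (X i)) [∀ i, IsProbabilityMeasure (μ i)] {f : ∀ i, X i → ℝ≥0∞}
    (hf : ∀ i, Measurable (f i)) :
    ∫⁻ x, ∏ i, f i (x i) ∂(Measure.pi μ) = ∏ i, ∫⁻ x, f i x ∂(μ i) := by
  have h := lintegral_prod_eq_prod_lintegral_of_indepFun Finset.univ
    (fun i (x : ∀ i, X i) => f i (x i)) (iIndepFun_pi (μ := μ) fun i => (hf i).aemeasurable)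
    (fun i => (hf i).comp (measurable_pi_apply i))
  rw [h]
  exact Finset.prod_congr rfl fun i _ => (measurePreserving_eval μ i).lintegral_comp (hf i)

/-! ### The reward regression and the transition regression. -/

namespace ControlProblem

variable {ds da : ℕ} (M : ControlProblem ds da)
  {Kr Kf : Matrix (Fin ds ⊕ Fin da) (Fin ds ⊕ Fin da) ℝ}

theorem lintegral_fst {α β : Type*} [MeasurableSpace α] [MeasurableSpace β] (μ : Measure α)
    (ν : Measure β) [IsProbabilityMeasure μ] [IsProbabilityMeasure ν] {f : α → ℝ≥0∞}
    (hf : Measurable f) : ∫⁻ p, f p.1 ∂(μ.prod ν) = ∫⁻ x, f x ∂μ :=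
  (measurePreserving_fst (μ := μ) (ν := ν)).lintegral_comp hf

theorem lintegral_snd {α β : Type*} [MeasurableSpace α] [MeasurableSpace β] (μ : Measure α)
    (ν : Measure β) [IsProbabilityMeasure μ] [IsProbabilityMeasure ν] {f : β → ℝ≥0∞}
    (hf : Measurable f) : ∫⁻ p, f p.2 ∂(μ.prod ν) = ∫⁻ x, f x ∂ν :=
  (measurePreserving_snd (μ := μ) (ν := ν)).lintegral_comp hf

/-- The regression of the rewards on the state-action vectors. -/
noncomputable def rewardRegression (hKr : Kr.PosSemidef) {c : ℝ} (hc : 0 ≤ c)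
    (hb : ∀ s ∈ M.S, ∀ a ∈ M.A, linearKernel Kr (stateAction s a) (stateAction s a) ≤ c) :
    Regression M (blrPrior Kr Kf) Unit (Fin ds ⊕ Fin da) where
  steps := M.H
  steps_le := le_rfl
  target o _ := fun _ => o.2.2 / M.σr
  pred θ x := fun _ => inner ℝ θ.1 x / M.σr
  latent θ := Matrix.of fun _ i => hKr.whiteCoord θ.1 i
  feat x := (M.σr)⁻¹ • hKr.rootCoord x
  noise e := fun _ => e.2 / M.σr
  c := c / M.σr ^ 2
  c_nonneg := by positivity
  measurable_target := by fun_prop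
  measurable_pred := by fun_prop
  measurable_latent _ i := (measurable_pi_apply i).comp
    (hKr.measurable_whiteCoord.comp measurable_fst)
  measurable_feat := hKr.measurable_rootCoord.const_smul (M.σr)⁻¹
  measurable_noise := by fun_prop
  target_sub θ μ ξ i _ o' _ := by
    funext _
    simp only [observation, obsVec, meanReward, Pi.sub_apply]
    ring
  pred_eq := by
    have h : ∀ᵐ θ ∂(blrPrior Kr Kf), ∀ x, inner ℝ θ.1 x =
        hKr.whiteCoord θ.1 ⬝ᵥ hKr.rootCoord x :=
      Measure.quasiMeasurePreserving_fst.ae hKr.ae_inner_eq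
    filter_upwards [h] with θ hθ x
    funext _
    rw [hθ, Matrix.mulVec_smul, Pi.smul_apply, smul_eq_mul, div_eq_inv_mul]
    rfl
  feat_le s hs a ha := by
    have h := hb s hs a ha
    rw [linearKernel_eq, ← hKr.rootCoord_dotProduct_self] at h
    rw [smul_dotProduct, dotProduct_smul, smul_eq_mul, smul_eq_mul, ← mul_assoc, ← mul_inv,
      ← sq, inv_mul_eq_div]
    gcongr
  lintegral_noise u := by
    have hu : ∀ v : Unit → ℝ, u ⬝ᵥ v = u () * v () := fun v => by simp [dotProduct]
    have h := lintegral_exp_gaussianReal (M.σr ^ 2).toNNReal (u () / M.σr)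
    have h1 : ∀ e : Vec ds × ℝ, u ⬝ᵥ (fun _ => e.2 / M.σr) = u () / M.σr * e.2 := fun e => by
      rw [hu]; ring
    simp only [h1, hu]
    have h2 := lintegral_snd M.noiseF M.noiseR
      (f := fun y => ENNReal.ofReal (Real.exp (u () / M.σr * y))) (by fun_prop)
    refine (h2.trans h).le.trans (le_of_eq ?_)
    have hσ := M.σr_pos
    rw [Real.coe_toNNReal _ (sq_nonneg _)]
    congr 2
    field_simp
  lintegral_latent u q := by
    have hu : ∀ v : Unit → ℝ, u ⬝ᵥ v = u () * v () := fun v => by simp [dotProduct]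
    have h1 : ∀ w : SAVec ds da, u ⬝ᵥ (Matrix.of fun (_ : Unit) i => hKr.whiteCoord w i).mulVec q =
        (u () • q) ⬝ᵥ hKr.whiteCoord w := by
      intro w
      rw [hu, smul_dotProduct, smul_eq_mul, dotProduct_comm]
      rfl
    simp only [h1]
    have hm : Measurable fun w => ENNReal.ofReal (Real.exp ((u () • q) ⬝ᵥ hKr.whiteCoord w)) :=
      (Real.measurable_exp.comp
        (Regression.measurable_dotProduct _ hKr.measurable_whiteCoord)).ennreal_ofReal
    have h2 := lintegral_fst (multivariateGaussian 0 Kr)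
      (Measure.pi fun _ : Fin ds => multivariateGaussian 0 Kf) hm
    refine (le_of_eq h2).trans ((hKr.lintegral_exp_whiteCoord_le _).trans (le_of_eq ?_))
    rw [hu, smul_dotProduct, dotProduct_smul, smul_eq_mul, smul_eq_mul]
    congr 2
    ring

/-- The regression of the transitions on the state-action vectors. -/
noncomputable def transitionRegression (hKf : Kf.PosSemidef) {c : ℝ} (hc : 0 ≤ c)
    (hb : ∀ s ∈ M.S, ∀ a ∈ M.A, linearKernel Kf (stateAction s a) (stateAction s a) ≤ c) :
    Regression M (blrPrior Kr Kf) (Fin ds) (Fin ds ⊕ Fin da) where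
  -- The outcome of the last transition of an episode is not part of the history.
  steps := M.H - 1
  steps_le := Nat.sub_le _ _
  target _ o' j := o'.1 j / M.σf
  pred θ x j := inner ℝ (θ.2 j) x / M.σf
  latent θ := Matrix.of fun j i => hKf.whiteCoord (θ.2 j) i
  feat x := (M.σf)⁻¹ • hKf.rootCoord x
  noise e j := e.1 j / M.σf
  c := c / M.σf ^ 2
  c_nonneg := by positivity
  measurable_target := by fun_prop
  measurable_pred := by fun_prop
  measurable_latent j i := (measurable_pi_apply i).comp
    (hKf.measurable_whiteCoord.comp ((measurable_pi_apply j).comp measurable_snd))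
  measurable_feat := hKf.measurable_rootCoord.const_smul (M.σf)⁻¹
  measurable_noise := by fun_prop
  target_sub θ μ ξ i hi o' ho' := by
    rw [ho' (by omega)]
    funext j
    simp only [observation, obsVec, Pi.sub_apply, rawState, meanNext, PiLp.add_apply]
    ring
  pred_eq := by
    have h1 : ∀ j : Fin ds, ∀ᵐ f ∂(Measure.pi fun _ : Fin ds => multivariateGaussian 0 Kf),
        ∀ x, inner ℝ (f j) x = hKf.whiteCoord (f j) ⬝ᵥ hKf.rootCoord x := fun j =>
      (Measure.quasiMeasurePreserving_eval (fun _ : Fin ds => multivariateGaussian 0 Kf) j).ae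
        hKf.ae_inner_eq
    have h : ∀ᵐ θ ∂(blrPrior Kr Kf), ∀ (j : Fin ds) x, inner ℝ (θ.2 j) x =
        hKf.whiteCoord (θ.2 j) ⬝ᵥ hKf.rootCoord x :=
      Measure.quasiMeasurePreserving_snd.ae (ae_all_iff.2 h1)
    filter_upwards [h] with θ hθ x
    funext j
    rw [hθ, Matrix.mulVec_smul, Pi.smul_apply, smul_eq_mul, div_eq_inv_mul]
    rfl
  feat_le s hs a ha := by
    have h := hb s hs a ha
    rw [linearKernel_eq, ← hKf.rootCoord_dotProduct_self] at h
    rw [smul_dotProduct, dotProduct_smul, smul_eq_mul, smul_eq_mul, ← mul_assoc, ← mul_inv,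
      ← sq, inv_mul_eq_div]
    gcongr
  lintegral_noise u := by
    set a : Vec ds := WithLp.toLp 2 ((M.σf)⁻¹ • u) with ha
    have h := lintegral_exp_inner_isoGaussian M.σf a
    have h1 : ∀ e : Vec ds × ℝ, u ⬝ᵥ (fun j => e.1 j / M.σf) = inner ℝ a e.1 := fun e => by
      simp only [dotProduct, ha, PiLp.inner_apply, Pi.smul_apply, smul_eq_mul,
        RCLike.inner_apply, conj_trivial]
      exact Finset.sum_congr rfl fun j _ => by ring
    simp only [h1]
    have h2 := lintegral_fst M.noiseF M.noiseR
      (f := fun y => ENNReal.ofReal (Real.exp (inner ℝ a y))) (by fun_prop)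
    refine (h2.trans h).le.trans (le_of_eq ?_)
    have hσ := M.σf_pos
    have h3 : M.σf ^ 2 * ‖a‖ ^ 2 = u ⬝ᵥ u := by
      rw [EuclideanSpace.real_norm_sq_eq, Finset.mul_sum]
      refine Finset.sum_congr rfl fun j _ => ?_
      simp only [ha, Pi.smul_apply, smul_eq_mul]
      field_simp
    rw [h3]
  lintegral_latent u q := by
    -- The bilinear form splits into one linear form per output coordinate. These are independent
    -- under the prior, so the exponential moment is a product.
    have h1 : ∀ f : Fin ds → SAVec ds da,
        u ⬝ᵥ (Matrix.of fun j i => hKf.whiteCoord (f j) i).mulVec q =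
        ∑ j, (u j • q) ⬝ᵥ hKf.whiteCoord (f j) := by
      intro f
      refine Finset.sum_congr rfl fun j _ => ?_
      rw [smul_dotProduct, smul_eq_mul, dotProduct_comm q]
      rfl
    simp only [h1, ENNReal.ofReal_exp_sum]
    have hm : ∀ j, Measurable fun w =>
        ENNReal.ofReal (Real.exp ((u j • q) ⬝ᵥ hKf.whiteCoord w)) := fun j =>
      (Real.measurable_exp.comp
        (Regression.measurable_dotProduct _ hKf.measurable_whiteCoord)).ennreal_ofReal
    have h2 := lintegral_snd (multivariateGaussian 0 Kr)
      (Measure.pi fun _ : Fin ds => multivariateGaussian 0 Kf)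
      (Finset.measurable_prod Finset.univ fun j _ => (hm j).comp (measurable_pi_apply j))
    refine (le_of_eq h2).trans ?_
    refine (le_of_eq (lintegral_pi_prod (fun _ : Fin ds => multivariateGaussian 0 Kf) hm)).trans ?_
    refine (Finset.prod_le_prod' fun j _ => hKf.lintegral_exp_whiteCoord_le _).trans
      (le_of_eq ?_)
    rw [← ENNReal.ofReal_exp_sum]
    congr 2
    simp only [smul_dotProduct, dotProduct_smul, smul_eq_mul]
    rw [← Finset.sum_div, dotProduct.eq_1 u u, Finset.sum_mul]
    congr 1
    exact Finset.sum_congr rfl fun j _ => by ring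

end ControlProblem

/-! ### Moments of the largest mean reward, and reduction of the regret to model errors. -/

namespace ControlProblem

variable {ds da : ℕ} {M : ControlProblem ds da}
  {Kr Kf : Matrix (Fin ds ⊕ Fin da) (Fin ds ⊕ Fin da) ℝ}

instance isProbabilityMeasure_blrPrior : IsProbabilityMeasure (blrPrior Kr Kf) := by
  unfold blrPrior; infer_instance

section SupReward

theorem enorm_inner_le_supReward (θ : Param ds da) {s : Vec ds} (hs : s ∈ M.S) {a : Vec da}
    (ha : a ∈ M.A) : ‖(inner ℝ θ.1 (stateAction s a) : ℝ)‖ₑ ≤ M.supReward θ :=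
  le_iSup₂_of_le s hs (le_iSup₂_of_le a ha le_rfl)

theorem supReward_le {θ : Param ds da} {b : ℝ≥0∞}
    (h : ∀ s ∈ M.S, ∀ a ∈ M.A, ‖(inner ℝ θ.1 (stateAction s a) : ℝ)‖ₑ ≤ b) :
    M.supReward θ ≤ b :=
  iSup₂_le fun s hs => iSup₂_le fun a ha => h s hs a ha

/-- `supReward` depends only on the reward weights and is an extended seminorm of them; these
weights are a centred Gaussian vector, so the rotation argument applies. -/
theorem lintegral_supReward_pow_four_le {b : ℝ≥0∞} (hb0 : b ≠ 0) (hb : b ≠ ∞)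
    (h2 : ∫⁻ θ, M.supReward θ ^ 2 ∂(blrPrior Kr Kf) ≤ b ^ 2) :
    ∫⁻ θ, M.supReward θ ^ 4 ∂(blrPrior Kr Kf) ≤ (4 * b) ^ 4 := by
  set N : SAVec ds da → ℝ≥0∞ := fun w => M.supReward (w, 0) with hN
  have hNm : Measurable N := M.measurable_supReward.comp (measurable_id.prodMk measurable_const)
  have hpow : ∀ n : ℕ, ∫⁻ θ, M.supReward θ ^ n ∂(blrPrior Kr Kf) =
      ∫⁻ w, N w ^ n ∂(multivariateGaussian 0 Kr) := fun n =>
    lintegral_fst (multivariateGaussian 0 Kr)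
      (Measure.pi fun _ : Fin ds => multivariateGaussian 0 Kf) (hNm.pow_const n)
  rw [hpow] at h2 ⊢
  refine lintegral_pow_four_le_of_rotation (IsGaussian.map_rotation_eq_self (by simp) _) hNm
    ?_ ?_ hb0 hb h2
  · intro x y
    refine supReward_le fun s hs a ha => ?_
    rw [inner_add_left]
    exact (enorm_add_le _ _).trans (add_le_add (enorm_inner_le_supReward (x, 0) hs ha)
      (enorm_inner_le_supReward (y, 0) hs ha))
  · intro c x
    simp only [hN, supReward, meanReward, ENNReal.mul_iSup, inner_smul_left, enorm_mul,
      RCLike.conj_to_real]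

/-- The kernel at a point is the prior variance of the mean reward there, at most the second moment
of the supremum. This supplies the feature bound for the reward regression. -/
theorem linearKernel_le_of_lintegral_supReward (hKr : Kr.PosSemidef) {r : ℝ} (hr : 0 ≤ r)
    (h2 : ∫⁻ θ, M.supReward θ ^ 2 ∂(blrPrior Kr Kf) ≤ ENNReal.ofReal r) {s : Vec ds}
    (hs : s ∈ M.S) {a : Vec da} (ha : a ∈ M.A) :
    linearKernel Kr (stateAction s a) (stateAction s a) ≤ r := by
  rw [linearKernel_eq, ← ENNReal.ofReal_le_ofReal_iff hr,
    ← lintegral_enorm_inner_sq_multivariateGaussian hKr]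
  refine le_trans ?_ h2
  have h := lintegral_fst (multivariateGaussian 0 Kr)
    (Measure.pi fun _ : Fin ds => multivariateGaussian 0 Kf)
    (f := fun w => ‖(inner ℝ (stateAction s a) w : ℝ)‖ₑ ^ 2) (by fun_prop)
  rw [← h]
  refine lintegral_mono fun θ => ?_
  rw [real_inner_comm]
  exact pow_le_pow_left' (enorm_inner_le_supReward θ hs ha) 2

theorem ae_supReward_ne_top {r : ℝ}
    (h2 : ∫⁻ θ, M.supReward θ ^ 2 ∂(blrPrior Kr Kf) ≤ ENNReal.ofReal r) :
    ∀ᵐ θ ∂(blrPrior Kr Kf), M.supReward θ ≠ ∞ := by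
  have h := ae_lt_top (M.measurable_supReward.pow_const 2)
    (h2.trans_lt ENNReal.ofReal_lt_top).ne
  filter_upwards [h] with θ hθ
  intro h
  simp [h] at hθ

theorem integrable_supReward {r : ℝ}
    (h2 : ∫⁻ θ, M.supReward θ ^ 2 ∂(blrPrior Kr Kf) ≤ ENNReal.ofReal r) :
    Integrable (fun θ => (M.supReward θ).toReal) (blrPrior Kr Kf) := by
  refine integrable_toReal_of_lintegral_ne_top M.measurable_supReward.aemeasurable ?_
  refine ((lintegral_mono (g := fun θ => 1 + M.supReward θ ^ 2) fun θ => ?_).trans_lt ?_).ne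
  · rcases le_total (M.supReward θ) 1 with h | h
    · exact h.trans le_self_add
    · exact (le_self_pow₀ h two_ne_zero).trans le_add_self
  · rw [lintegral_add_left measurable_const]
    simpa using h2.trans_lt ENNReal.ofReal_lt_top

theorem integral_supReward_le {r : ℝ} (hr : 0 ≤ r)
    (h2 : ∫⁻ θ, M.supReward θ ^ 2 ∂(blrPrior Kr Kf) ≤ ENNReal.ofReal r) :
    ∫ θ, (M.supReward θ).toReal ∂(blrPrior Kr Kf) ≤ 1 + r := by
  rw [integral_toReal M.measurable_supReward.aemeasurable
    ((ae_supReward_ne_top h2).mono fun _ h => lt_top_iff_ne_top.2 h)]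
  refine ENNReal.toReal_le_of_le_ofReal (by linarith) ?_
  refine (lintegral_mono (g := fun θ => 1 + M.supReward θ ^ 2) fun θ => ?_).trans ?_
  · rcases le_total (M.supReward θ) 1 with h | h
    · exact h.trans le_self_add
    · exact (le_self_pow₀ h two_ne_zero).trans le_add_self
  · rw [lintegral_add_left measurable_const, ENNReal.ofReal_add zero_le_one hr]
    simpa using h2

end SupReward

section Regret

variable {Ω : Type*} {plan : Param ds da → ℕ → Vec ds → Vec da} {θ : Ω → Param ds da}
  {θs : ℕ → Ω → Param ds da} {ξ : ℕ → Ω → EpisodeNoise ds} {π : Measure (Param ds da)}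

theorem value_zero (t : Param ds da) (μ : ℕ → Vec ds → Vec da) (s : Vec ds) :
    M.value t μ 0 s = M.valueSteps t μ M.H 0 s := by
  simp [value, valueSteps]

/-- Mean value of the policy for the second parameter in the model with the first parameter. -/
noncomputable def meanValue (M : ControlProblem ds da)
    (plan : Param ds da → ℕ → Vec ds → Vec da) (t t' : Param ds da) : ℝ :=
  ∫ s, M.value t (plan t') 0 s ∂M.ρ

theorem measurable_meanValue
    (hplan : ∀ i, Measurable fun p : Param ds da × Vec ds => plan p.1 i p.2) :
    Measurable fun p : Param ds da × Param ds da => M.meanValue plan p.1 p.2 := by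
  have h : Measurable fun q : (Param ds da × Param ds da) × Vec ds =>
      M.value q.1.1 (plan q.1.2) 0 q.2 := by
    simp only [value_zero]
    refine M.measurable_valueSteps (by fun_prop) (fun i => ?_) _ _ measurable_snd
    exact (hplan i).comp (f := fun p : ((Param ds da × Param ds da) × Vec ds) × Vec ds =>
      (p.1.1.2, p.2)) (by fun_prop)
  exact (h.stronglyMeasurable.integral_prod_right (ν := M.ρ)).measurable

theorem ae_abs_value_le {t : Param ds da} (ht : M.supReward t ≠ ∞) {μ : ℕ → Vec ds → Vec da}
    (hμ : M.IsPolicy μ) : ∀ᵐ s ∂M.ρ, ‖M.value t μ 0 s‖ ≤ M.H * (M.supReward t).toReal := by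
  filter_upwards [M.ρ_mem] with s hs
  rw [value_zero]
  exact abs_valueSteps_le ht hμ _ _ hs

theorem integrable_value {t : Param ds da} (ht : M.supReward t ≠ ∞) {μ : ℕ → Vec ds → Vec da}
    (hμ : M.IsPolicy μ) : Integrable (fun s => M.value t μ 0 s) M.ρ := by
  refine Integrable.of_bound ?_ _ (ae_abs_value_le ht hμ)
  simp only [value_zero]
  exact (M.measurable_valueSteps measurable_const (fun j => hμ.measurable_uncurry j) _ _
    measurable_id).aestronglyMeasurable

theorem abs_meanValue_le {t t' : Param ds da} (ht : M.supReward t ≠ ∞)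
    (ht' : M.IsPolicy (plan t')) :
    |M.meanValue plan t t'| ≤ M.H * (M.supReward t).toReal := by
  have := norm_integral_le_of_norm_le_const (ae_abs_value_le ht ht')
  simpa [meanValue] using this

theorem episodeRegret_eq {k : ℕ} {ω : Ω} (hθ : M.supReward (θ ω) ≠ ∞)
    (h1 : M.IsPolicy (plan (θ ω))) (h2 : M.IsPolicy (plan (θs k ω))) :
    M.episodeRegret plan θ θs k ω =
      M.meanValue plan (θ ω) (θ ω) - M.meanValue plan (θ ω) (θs k ω) :=
  integral_sub (integrable_value hθ h1) (integrable_value hθ h2)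

variable [MeasurableSpace Ω] {P : Measure Ω} [IsProbabilityMeasure P]

theorem IsPSRL.integrable_meanValue (hP : M.IsPSRL plan θ θs ξ π P)
    (hplan : ∀ i, Measurable fun p : Param ds da × Vec ds => plan p.1 i p.2)
    (hpol : ∀ᵐ t ∂π, M.IsPolicy (plan t)) (hsup : ∀ᵐ t ∂π, M.supReward t ≠ ∞)
    (hint : Integrable (fun t => (M.supReward t).toReal) π) (k : ℕ) :
    Integrable (fun ω => M.meanValue plan (θ ω) (θs k ω)) P := by
  have hint' : Integrable (fun ω => M.H * (M.supReward (θ ω)).toReal) P := by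
    rw [← hP.law_θ] at hint
    exact (hint.comp_measurable hP.measurable_θ).const_mul _
  refine hint'.mono' ((measurable_meanValue hplan).comp
    (hP.measurable_θ.prodMk (hP.measurable_θs k))).aestronglyMeasurable ?_
  filter_upwards [hP.ae_sample hplan hpol, hP.ae_sample hplan hsup] with ω h1 h2
  exact abs_meanValue_le h2.1 (h1.2 k)

theorem integrable_meanValue_self
    (hplan : ∀ i, Measurable fun p : Param ds da × Vec ds => plan p.1 i p.2)
    (hpol : ∀ᵐ t ∂π, M.IsPolicy (plan t)) (hsup : ∀ᵐ t ∂π, M.supReward t ≠ ∞)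
    (hint : Integrable (fun t => (M.supReward t).toReal) π) :
    Integrable (fun t => M.meanValue plan t t) π := by
  refine (hint.const_mul (M.H : ℝ)).mono' ((measurable_meanValue hplan).comp
    (measurable_id.prodMk measurable_id)).aestronglyMeasurable ?_
  filter_upwards [hpol, hsup] with t h1 h2
  exact abs_meanValue_le h2 h1

theorem IsPSRL.ae_episodeRegret_eq (hP : M.IsPSRL plan θ θs ξ π P)
    (hplan : ∀ i, Measurable fun p : Param ds da × Vec ds => plan p.1 i p.2)
    (hpol : ∀ᵐ t ∂π, M.IsPolicy (plan t)) (hsup : ∀ᵐ t ∂π, M.supReward t ≠ ∞) (k : ℕ) :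
    M.episodeRegret plan θ θs k =ᵐ[P]
      fun ω => M.meanValue plan (θ ω) (θ ω) - M.meanValue plan (θ ω) (θs k ω) := by
  filter_upwards [hP.ae_sample hplan hpol, hP.ae_sample hplan hsup] with ω h1 h2
  exact episodeRegret_eq h2.1 h1.1 (h1.2 k)

theorem IsPSRL.integrable_episodeRegret (hP : M.IsPSRL plan θ θs ξ π P)
    (hplan : ∀ i, Measurable fun p : Param ds da × Vec ds => plan p.1 i p.2)
    (hpol : ∀ᵐ t ∂π, M.IsPolicy (plan t)) (hsup : ∀ᵐ t ∂π, M.supReward t ≠ ∞)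
    (hint : Integrable (fun t => (M.supReward t).toReal) π) (k : ℕ) :
    Integrable (M.episodeRegret plan θ θs k) P := by
  refine Integrable.congr ?_ (hP.ae_episodeRegret_eq hplan hpol hsup k).symm
  have h := integrable_meanValue_self hplan hpol hsup hint
  rw [← hP.law_θ] at h
  exact (h.comp_measurable hP.measurable_θ).sub
    (hP.integrable_meanValue hplan hpol hsup hint k)

theorem IsPSRL.integrable_regret (hP : M.IsPSRL plan θ θs ξ π P)
    (hplan : ∀ i, Measurable fun p : Param ds da × Vec ds => plan p.1 i p.2)
    (hpol : ∀ᵐ t ∂π, M.IsPolicy (plan t)) (hsup : ∀ᵐ t ∂π, M.supReward t ≠ ∞)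
    (hint : Integrable (fun t => (M.supReward t).toReal) π) (T : ℕ) :
    Integrable (M.regret plan θ θs T) P :=
  integrable_finsetSum _ fun k _ => hP.integrable_episodeRegret hplan hpol hsup hint k

/-- The crude bound by the size of the rewards, for horizons too short for the main argument. -/
theorem IsPSRL.integral_regret_le_mul (hP : M.IsPSRL plan θ θs ξ π P)
    (hplan : ∀ i, Measurable fun p : Param ds da × Vec ds => plan p.1 i p.2)
    (hpol : ∀ᵐ t ∂π, M.IsPolicy (plan t)) (hsup : ∀ᵐ t ∂π, M.supReward t ≠ ∞)
    (hint : Integrable (fun t => (M.supReward t).toReal) π) (T : ℕ) :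
    ∫ ω, M.regret plan θ θs T ω ∂P ≤
      ⌈(T : ℝ) / M.H⌉₊ * (2 * M.H * ∫ t, (M.supReward t).toReal ∂π) := by
  have hint' : Integrable (fun ω => (M.supReward (θ ω)).toReal) P := by
    rw [← hP.law_θ] at hint
    exact hint.comp_measurable hP.measurable_θ
  have hk : ∀ k, ∫ ω, M.episodeRegret plan θ θs k ω ∂P ≤
      2 * M.H * ∫ t, (M.supReward t).toReal ∂π := by
    intro k
    have e : ∫ t, (M.supReward t).toReal ∂π = ∫ ω, (M.supReward (θ ω)).toReal ∂P := by
      rw [← hP.law_θ, integral_map hP.measurable_θ.aemeasurable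
        M.measurable_supReward.ennreal_toReal.aestronglyMeasurable]
    rw [e, ← integral_const_mul]
    refine integral_mono_ae (hP.integrable_episodeRegret hplan hpol hsup hint k)
      (hint'.const_mul _) ?_
    filter_upwards [hP.ae_sample hplan hpol, hP.ae_sample hplan hsup] with ω h1 h2
    rw [episodeRegret_eq h2.1 h1.1 (h1.2 k)]
    have h3 := (abs_le.1 (abs_meanValue_le (plan := plan) h2.1 h1.1)).2
    have h4 := (abs_le.1 (abs_meanValue_le (plan := plan) h2.1 (h1.2 k))).1
    linarith
  unfold regret
  rw [integral_finsetSum _ fun k _ => hP.integrable_episodeRegret hplan hpol hsup hint k]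
  refine (Finset.sum_le_sum fun k _ => hk k).trans ?_
  simp

/-- The deviation of the sampled model from the true model at step `i` of episode `k`. -/
noncomputable def sampleModelGap (M : ControlProblem ds da)
    (plan : Param ds da → ℕ → Vec ds → Vec da) (θ : Ω → Param ds da)
    (θs : ℕ → Ω → Param ds da) (ξ : ℕ → Ω → EpisodeNoise ds) (k i : ℕ) (ω : Ω) : ℝ≥0∞ :=
  M.modelGap (θs k ω) (θ ω) (plan (θs k ω)) (M.H - 1 - i) i
    (M.proj (M.rawState (θ ω) (plan (θs k ω)) (ξ k ω) i))

/-- The expected regret of an episode of posterior sampling is at most the expected deviation of the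
sampled model from the true model along the trajectory of the episode. -/
theorem IsPSRL.ofReal_integral_episodeRegret_le (hP : M.IsPSRL plan θ θs ξ π P)
    (hplan : ∀ i, Measurable fun p : Param ds da × Vec ds => plan p.1 i p.2)
    (hpol : ∀ᵐ t ∂π, M.IsPolicy (plan t)) (hsup : ∀ᵐ t ∂π, M.supReward t ≠ ∞)
    (hint : Integrable (fun t => (M.supReward t).toReal) π) (k : ℕ) :
    ENNReal.ofReal (∫ ω, M.episodeRegret plan θ θs k ω ∂P) ≤
      ∫⁻ ω, ∑ i ∈ Finset.range M.H, M.sampleModelGap plan θ θs ξ k i ω ∂P := by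
  have hself := integrable_meanValue_self hplan hpol hsup hint
  have hselfm : Measurable fun t => M.meanValue plan t t :=
    (measurable_meanValue hplan).comp (measurable_id.prodMk measurable_id)
  have hi1 : Integrable (fun ω => M.meanValue plan (θ ω) (θ ω)) P := by
    have h := hself
    rw [← hP.law_θ] at h
    exact h.comp_measurable hP.measurable_θ
  have hi2 : Integrable (fun ω => M.meanValue plan (θs k ω) (θs k ω)) P := by
    have h := hself
    rw [← hP.law_sample hplan k] at h
    exact h.comp_measurable (hP.measurable_θs k)
  have hi3 := hP.integrable_meanValue hplan hpol hsup hint k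
  -- The value of the planned policy in its own model is one function of the parameter, and `θ` and
  -- `θs k` have the same law. The optimal value is thus replaced in the mean by the value in the
  -- sampled model.
  have e1 : ∫ ω, M.meanValue plan (θ ω) (θ ω) ∂P =
      ∫ ω, M.meanValue plan (θs k ω) (θs k ω) ∂P := by
    have h1 := integral_map (μ := P) hP.measurable_θ.aemeasurable
      hselfm.aestronglyMeasurable
    have h2 := integral_map (μ := P) (hP.measurable_θs k).aemeasurable
      hselfm.aestronglyMeasurable
    rw [hP.law_θ] at h1
    rw [hP.law_sample hplan k] at h2
    exact h1.symm.trans h2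
  have e2 : ∫ ω, M.episodeRegret plan θ θs k ω ∂P =
      ∫ ω, (M.meanValue plan (θs k ω) (θs k ω) - M.meanValue plan (θ ω) (θs k ω)) ∂P := by
    rw [integral_congr_ae (hP.ae_episodeRegret_eq hplan hpol hsup k), integral_sub hi1 hi3,
      integral_sub hi2 hi3, e1]
  -- The noise of the episode is made independent of both parameters, so that the simulation lemma
  -- can be applied with the parameters fixed.
  have e3 : ∫⁻ ω, ∑ i ∈ Finset.range M.H, M.sampleModelGap plan θ θs ξ k i ω ∂P =
      ∫⁻ ω, ∫⁻ x, ∑ i ∈ Finset.range M.H, M.modelGap (θs k ω) (θ ω) (plan (θs k ω))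
        (M.H - 1 - i) i (M.proj (M.rawState (θ ω) (plan (θs k ω)) x i)) ∂M.episodeLaw ∂P := by
    have hF : Measurable (Function.uncurry fun
        (p : (Param ds da × (Fin k → EpisodeNoise ds) × (Fin k → Param ds da)) × Param ds da)
        (x : EpisodeNoise ds) => ∑ i ∈ Finset.range M.H, M.modelGap p.2 p.1.1 (plan p.2)
          (M.H - 1 - i) i (M.proj (M.rawState p.1.1 (plan p.2) x i))) := by
      refine Finset.measurable_sum _ fun i _ => ?_
      have hpl : ∀ i, Measurable fun q : (((Param ds da × (Fin k → EpisodeNoise ds) ×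
          (Fin k → Param ds da)) × Param ds da) × EpisodeNoise ds) × Vec ds =>
          plan q.1.1.2 i q.2 := fun i =>
        (hplan i).comp (f := fun q : (((Param ds da × (Fin k → EpisodeNoise ds) ×
          (Fin k → Param ds da)) × Param ds da) × EpisodeNoise ds) × Vec ds =>
          (q.1.1.2, q.2)) (by fun_prop)
      exact M.measurable_modelGap (by fun_prop) (by fun_prop) hpl _ i
        (M.measurable_proj.comp (M.measurable_rawState (by fun_prop) hpl (by fun_prop) i))
    exact hP.lintegral_episode hplan k hF
  rw [e2, e3]
  refine (ENNReal.ofReal_le_of_le_toReal ((le_abs_self _).trans ?_ :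
    _ ≤ (‖∫ ω, (M.meanValue plan (θs k ω) (θs k ω) - M.meanValue plan (θ ω) (θs k ω)) ∂P‖ₑ).toReal
    )).trans ((enorm_integral_le_lintegral_enorm _).trans (lintegral_mono_ae ?_))
  · rw [toReal_enorm, Real.norm_eq_abs]
  · filter_upwards [hP.ae_sample hplan hpol, hP.ae_sample hplan hsup] with ω h1 h2
    refine le_trans ?_ (lintegral_enorm_value_sub_le h2.1 (h2.2 k) (h1.2 k))
    rw [meanValue, meanValue, ← integral_sub (integrable_value (h2.2 k) (h1.2 k))
      (integrable_value h2.1 (h1.2 k))]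
    exact enorm_integral_le_lintegral_enorm _

theorem IsPSRL.ofReal_integral_regret_le (hP : M.IsPSRL plan θ θs ξ π P)
    (hplan : ∀ i, Measurable fun p : Param ds da × Vec ds => plan p.1 i p.2)
    (hpol : ∀ᵐ t ∂π, M.IsPolicy (plan t)) (hsup : ∀ᵐ t ∂π, M.supReward t ≠ ∞)
    (hint : Integrable (fun t => (M.supReward t).toReal) π) (T : ℕ) :
    ENNReal.ofReal (∫ ω, M.regret plan θ θs T ω ∂P) ≤
      ∫⁻ ω, ∑ k ∈ Finset.range ⌈(T : ℝ) / M.H⌉₊, ∑ i ∈ Finset.range M.H,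
        M.sampleModelGap plan θ θs ξ k i ω ∂P := by
  have hm : ∀ k i, Measurable (M.sampleModelGap plan θ θs ξ k i) := by
    intro k i
    have hpl : ∀ i, Measurable fun q : Ω × Vec ds => plan (θs k q.1) i q.2 := fun i =>
      (hplan i).comp (((hP.measurable_θs k).comp measurable_fst).prodMk measurable_snd)
    exact M.measurable_modelGap (hP.measurable_θs k) hP.measurable_θ hpl _ i
      (M.measurable_proj.comp (M.measurable_rawState hP.measurable_θ hpl (hP.measurable_ξ k) i))
  unfold regret
  rw [integral_finsetSum _ fun k _ => hP.integrable_episodeRegret hplan hpol hsup hint k,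
    lintegral_finsetSum _ fun k _ => Finset.measurable_sum _ fun i _ => hm k i]
  refine (le_trans ?_ (Finset.sum_le_sum fun k _ =>
    hP.ofReal_integral_episodeRegret_le hplan hpol hsup hint k))
  generalize Finset.range ⌈(T : ℝ) / M.H⌉₊ = F
  induction F using Finset.cons_induction with
  | empty => simp
  | cons a F ha ih =>
    rw [Finset.sum_cons, Finset.sum_cons]
    exact ENNReal.ofReal_add_le.trans (add_le_add le_rfl ih)

end Regret

end ControlProblem

/-! ### Rates, and the regret bound for long horizons. -/

namespace ControlProblem

variable {ds da : ℕ} {M : ControlProblem ds da}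
  {Kr Kf : Matrix (Fin ds ⊕ Fin da) (Fin ds ⊕ Fin da) ℝ}

theorem mul_gap_rewardRegression (hKr : Kr.PosSemidef) {c : ℝ} (hc : 0 ≤ c)
    (hb : ∀ s ∈ M.S, ∀ a ∈ M.A, linearKernel Kr (stateAction s a) (stateAction s a) ≤ c)
    (θ' θ : Param ds da) (s : Vec ds) (a : Vec da) :
    M.σr * (M.rewardRegression (Kf := Kf) hKr hc hb).gap θ' θ (stateAction s a) =
      |meanReward θ' s a - meanReward θ s a| := by
  have hσ := M.σr_pos
  have h : (M.rewardRegression (Kf := Kf) hKr hc hb).gap θ' θ (stateAction s a) =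
      |(meanReward θ' s a - meanReward θ s a) / M.σr| := by
    rw [← Real.sqrt_sq_eq_abs]
    simp only [Regression.gap, rewardRegression, dotProduct, Finset.univ_unique,
      Finset.sum_singleton, Pi.sub_apply, meanReward]
    congr 1; ring
  rw [h, abs_div, abs_of_pos hσ]
  field_simp

theorem gap_transitionRegression (hKf : Kf.PosSemidef) {c : ℝ} (hc : 0 ≤ c)
    (hb : ∀ s ∈ M.S, ∀ a ∈ M.A, linearKernel Kf (stateAction s a) (stateAction s a) ≤ c)
    (θ' θ : Param ds da) (s : Vec ds) (a : Vec da) :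
    (M.transitionRegression (Kr := Kr) hKf hc hb).gap θ' θ (stateAction s a) =
      ‖meanNext θ' s a - meanNext θ s a‖ / M.σf := by
  have hσ := M.σf_pos
  have hdiv : ∀ x : ℝ, √x / M.σf = √(x / M.σf ^ 2) := fun x => by
    rw [Real.sqrt_div' _ (sq_nonneg _), Real.sqrt_sq hσ.le]
  rw [EuclideanSpace.norm_eq, hdiv, Finset.sum_div]
  simp only [Regression.gap, transitionRegression, dotProduct, Pi.sub_apply, meanNext,
    PiLp.sub_apply, Real.norm_eq_abs, sq_abs]
  congr 1
  exact Finset.sum_congr rfl fun j _ => by ring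

section Rate

/-- The dependence of the regret on the bound for the features. -/
noncomputable def rateConst (c : ℝ) : ℝ := (1 + c) ^ 2 * (1 + 2 * c) / 2 + 6 * (16 + 8 * c) ^ 2

theorem rateConst_nonneg {c : ℝ} (hc : 0 ≤ c) : 0 ≤ rateConst c := by
  unfold rateConst; positivity

/-- Since `K n ≤ 2T` and `d ≤ T`, every quantity inside a logarithm is polynomial in `T` with
coefficients depending on `c` only; neither the dimension nor the episode length enters the
constant. -/
theorem rate_le {d K T H n : ℕ} {c : ℝ} (hc : 0 ≤ c) (hH : 1 ≤ H) (hn : n ≤ H) (hT : 1 ≤ T)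
    (hKH : (K : ℝ) * H ≤ 2 * T) (hd : d ≤ T) :
    (1 + n * c) * (1 + c) * Real.log (1 + K * n * c) / 2 +
      6 * n * Regression.gridLog ⌈d * (1 + K * n * c)⌉₊ ^ 2 ≤
    H * (1 + Real.log T) ^ 2 * rateConst c := by
  have hH' : (1 : ℝ) ≤ H := by exact_mod_cast hH
  have hn' : (n : ℝ) ≤ H := by exact_mod_cast hn
  have hT' : (1 : ℝ) ≤ T := by exact_mod_cast hT
  have hd' : (d : ℝ) ≤ T := by exact_mod_cast hd
  have hl : 0 ≤ Real.log T := Real.log_nonneg hT'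
  have hKn : K * n * c ≤ 2 * T * c := by
    refine mul_le_mul_of_nonneg_right (le_trans ?_ hKH) hc
    gcongr
  have hKn0 : 0 ≤ K * n * c := by positivity
  have hTpos : (0 : ℝ) < T := by linarith
  have h1 : Real.log (1 + K * n * c) ≤ (1 + 2 * c) * (1 + Real.log T) ^ 2 := by
    have h2 : Real.log (1 + K * n * c) ≤ Real.log (T * (1 + 2 * c)) :=
      Real.log_le_log (by linarith) (by nlinarith)
    rw [Real.log_mul hTpos.ne' (by positivity)] at h2
    have h3 := Real.log_le_sub_one_of_pos (show 0 < 1 + 2 * c by positivity)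
    have h4 : 0 ≤ c * Real.log T := mul_nonneg hc hl
    nlinarith [mul_nonneg hc (sq_nonneg (Real.log T))]
  have h5 : Regression.gridLog ⌈d * (1 + K * n * c)⌉₊ ≤ (16 + 8 * c) * (1 + Real.log T) := by
    have h6 := Nat.ceil_lt_add_one (show 0 ≤ d * (1 + K * n * c) by positivity)
    set m := ⌈d * (1 + K * n * c)⌉₊
    have h7 : d * (1 + K * n * c) ≤ T * (1 + 2 * T * c) := by gcongr
    have h8 : (2 * m + 1 : ℝ) ≤ T ^ 2 * (5 + 4 * c) := by nlinarith
    have h9 : Real.log (2 * m + 1) ≤ 2 * Real.log T + Real.log (5 + 4 * c) := by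
      refine (Real.log_le_log (by positivity) h8).trans (le_of_eq ?_)
      rw [Real.log_mul (by positivity) (by positivity), Real.log_pow]
      norm_num
    have h10 := Real.log_le_sub_one_of_pos (show 0 < 5 + 4 * c by positivity)
    unfold Regression.gridLog
    nlinarith [mul_nonneg hc hl]
  have h0 := Regression.le_gridLog ⌈d * (1 + K * n * c)⌉₊
  calc _ ≤ (H * (1 + c)) * (1 + c) * ((1 + 2 * c) * (1 + Real.log T) ^ 2) / 2 +
        6 * H * ((16 + 8 * c) * (1 + Real.log T)) ^ 2 := by
        have h11 : 1 + n * c ≤ H * (1 + c) := by nlinarith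
        have h12 : 0 ≤ Real.log (1 + K * n * c) := Real.log_nonneg (by linarith)
        gcongr
    _ = _ := by unfold rateConst; ring

end Rate

section Main

variable {Ω : Type*} {plan : Param ds da → ℕ → Vec ds → Vec da} {θ : Ω → Param ds da}
  {θs : ℕ → Ω → Param ds da} {ξ : ℕ → Ω → EpisodeNoise ds}

/-- After the last step of an episode no reward follows, so its transition error has weight zero.
This is why `H - 1` observed transitions per episode are enough. -/
theorem sum_sampleModelGap_le (hKr : Kr.PosSemidef) (hKf : Kf.PosSemidef) {cr cf : ℝ}
    (hcr : 0 ≤ cr) (hcf : 0 ≤ cf)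
    (hbr : ∀ s ∈ M.S, ∀ a ∈ M.A, linearKernel Kr (stateAction s a) (stateAction s a) ≤ cr)
    (hbf : ∀ s ∈ M.S, ∀ a ∈ M.A, linearKernel Kf (stateAction s a) (stateAction s a) ≤ cf)
    (k : ℕ) (ω : Ω) :
    ∑ i ∈ Finset.range M.H, M.sampleModelGap plan θ θs ξ k i ω ≤
      ∑ i ∈ Finset.range M.H, ENNReal.ofReal (M.σr *
        (M.rewardRegression (Kf := Kf) hKr hcr hbr).sampleGap plan θ θs ξ k i ω) +
      ∑ i ∈ Finset.range (M.H - 1), ENNReal.ofReal (2 * M.H * (M.supReward (θs k ω)).toReal *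
        (M.transitionRegression (Kr := Kr) hKf hcf hbf).sampleGap plan θ θs ξ k i ω) := by
  have h : ∀ i, M.sampleModelGap plan θ θs ξ k i ω ≤ ENNReal.ofReal (M.σr *
      (M.rewardRegression (Kf := Kf) hKr hcr hbr).sampleGap plan θ θs ξ k i ω) +
      ENNReal.ofReal (2 * ((M.H - 1 - i : ℕ) * (M.supReward (θs k ω)).toReal) *
        (M.transitionRegression (Kr := Kr) hKf hcf hbf).sampleGap plan θ θs ξ k i ω) := by
    intro i
    simp only [Regression.sampleGap, obsVec, observation, mul_gap_rewardRegression,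
      gap_transitionRegression]
    exact ENNReal.ofReal_add_le
  refine (Finset.sum_le_sum fun i _ => h i).trans ?_
  rw [Finset.sum_add_distrib]
  refine add_le_add le_rfl ?_
  obtain ⟨n, hn⟩ : ∃ n, M.H = n + 1 := ⟨M.H - 1, by have := M.H_pos; omega⟩
  simp only [hn, Nat.add_sub_cancel, Finset.sum_range_succ, Nat.sub_self]
  simp only [Nat.cast_zero, zero_mul, mul_zero, ENNReal.ofReal_zero, add_zero]
  refine Finset.sum_le_sum fun i _ => ENNReal.ofReal_le_ofReal ?_
  refine mul_le_mul_of_nonneg_right ?_ (Real.sqrt_nonneg _)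
  rw [mul_assoc]
  gcongr
  exact_mod_cast (by omega : n - i ≤ n + 1)

variable [MeasurableSpace Ω] {P : Measure Ω}

theorem Regression.measurable_sampleGap {κ ι : Type} [Fintype κ] [Fintype ι]
    {π : Measure (Param ds da)} (R : Regression M π κ ι) (hP : M.IsPSRL plan θ θs ξ π P)
    (hplan : ∀ i, Measurable fun p : Param ds da × Vec ds => plan p.1 i p.2) (k i : ℕ) :
    Measurable (R.sampleGap plan θ θs ξ k i) := by
  have hpl : ∀ i, Measurable fun q : Ω × Vec ds => plan (θs k q.1) i q.2 := fun i =>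
    (hplan i).comp (((hP.measurable_θs k).comp measurable_fst).prodMk measurable_snd)
  exact R.measurable_gap (hP.measurable_θs k) hP.measurable_θ (M.measurable_obsVec.comp
    (M.measurable_observation hP.measurable_θ hpl (hP.measurable_ξ k) i))

variable [IsProbabilityMeasure P]

theorem IsPSRL.integral_regret_le (hKr : Kr.PosSemidef) (hKf : Kf.PosSemidef)
    (hP : M.IsPSRL plan θ θs ξ (blrPrior Kr Kf) P)
    (hplan : ∀ i, Measurable fun p : Param ds da × Vec ds => plan p.1 i p.2)
    (hpol : ∀ᵐ t ∂(blrPrior Kr Kf), M.IsPolicy (plan t)) {r cf : ℝ} (hr : 0 ≤ r)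
    (h2 : ∫⁻ t, M.supReward t ^ 2 ∂(blrPrior Kr Kf) ≤ ENNReal.ofReal (r ^ 2)) (hcf : 0 ≤ cf)
    (hbf : ∀ s ∈ M.S, ∀ a ∈ M.A, linearKernel Kf (stateAction s a) (stateAction s a) ≤ cf)
    {T : ℕ} (hd : 1 ≤ ds + da) (hdT : ds + da ≤ T) (hHT : M.H ≤ T) :
    ∫ ω, M.regret plan θ θs T ω ∂P ≤
      2 * (M.σr * rateConst (r ^ 2 / M.σr ^ 2) + 8 * (r + 1) * rateConst (cf / M.σf ^ 2)) *
        (M.H * √M.H) * ((ds : ℝ) + da) * √T * (1 + Real.log T) ^ 2 := by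
  have hσr := M.σr_pos
  have hσf := M.σf_pos
  have hH : (1 : ℝ) ≤ M.H := by exact_mod_cast M.H_pos
  have hT : (1 : ℝ) ≤ T := by exact_mod_cast M.H_pos.trans hHT
  have hHT' : (M.H : ℝ) ≤ T := by exact_mod_cast hHT
  have hbr : ∀ s ∈ M.S, ∀ a ∈ M.A,
      linearKernel Kr (stateAction s a) (stateAction s a) ≤ r ^ 2 := fun s hs a ha =>
    linearKernel_le_of_lintegral_supReward hKr (sq_nonneg r) h2 hs ha
  have hsup := ae_supReward_ne_top h2
  have hint := integrable_supReward h2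
  set K := ⌈(T : ℝ) / M.H⌉₊ with hK
  have hK0 : 0 < K := Nat.ceil_pos.2 (by positivity)
  have hKH : (K : ℝ) * M.H ≤ 2 * T := by
    have h := (Nat.ceil_lt_add_one (show 0 ≤ (T : ℝ) / M.H by positivity)).le
    have : (K : ℝ) * M.H ≤ (T / M.H + 1) * M.H := by gcongr
    rw [add_mul, div_mul_cancel₀ _ (by positivity)] at this
    linarith
  set Rr := M.rewardRegression (Kf := Kf) hKr (sq_nonneg r) hbr
  set Rf := M.transitionRegression (Kr := Kr) hKf hcf hbf
  have hcard : Fintype.card (Fin ds ⊕ Fin da) = ds + da := by simp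
  have hsum : ∫⁻ ω, ∑ k ∈ Finset.range K, ∑ i ∈ Finset.range M.H,
        M.sampleModelGap plan θ θs ξ k i ω ∂P ≤
      ∫⁻ ω, ∑ k ∈ Finset.range K, ∑ i ∈ Finset.range M.H,
        ENNReal.ofReal (M.σr * Rr.sampleGap plan θ θs ξ k i ω) ∂P +
      ∫⁻ ω, ∑ k ∈ Finset.range K, ∑ i ∈ Finset.range (M.H - 1),
        ENNReal.ofReal (2 * M.H * (M.supReward (θs k ω)).toReal *
          Rf.sampleGap plan θ θs ξ k i ω) ∂P := by
    rw [← lintegral_add_left]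
    swap
    · exact Finset.measurable_sum _ fun k _ => Finset.measurable_sum _ fun i _ =>
        ((Rr.measurable_sampleGap hP hplan k i).const_mul _).ennreal_ofReal
    refine lintegral_mono fun ω => ?_
    rw [← Finset.sum_add_distrib]
    exact Finset.sum_le_sum fun k _ =>
      sum_sampleModelGap_le hKr hKf (sq_nonneg r) hcf hbr hbf k ω
  have hboundr := Rr.lintegral_sum_mul_sampleGap_le hP hplan hpol (ρ := fun _ => M.σr)
    measurable_const (fun _ => hσr.le) hσr (by simp) (by rw [hcard]; exact hd)
    (by rw [hcard]; simpa using hd) hK0 (Nat.le_ceil _)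
  -- `r + 1` replaces `r` because the moment comparison needs a positive bound and `r` may be zero.
  have hb4 : ∫⁻ t, ENNReal.ofReal ((2 * M.H * (M.supReward t).toReal) ^ 4)
      ∂(blrPrior Kr Kf) ≤ ENNReal.ofReal ((2 * M.H * (4 * (r + 1))) ^ 4) := by
    have h4 := lintegral_supReward_pow_four_le (M := M) (Kr := Kr) (Kf := Kf)
      (b := ENNReal.ofReal (r + 1)) (by simp; linarith) ENNReal.ofReal_ne_top
      (h2.trans (by
        rw [← ENNReal.ofReal_pow (by linarith)]
        exact ENNReal.ofReal_le_ofReal (by nlinarith)))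
    have h5 : ∀ t, ENNReal.ofReal ((2 * M.H * (M.supReward t).toReal) ^ 4) ≤
        ENNReal.ofReal ((2 * M.H) ^ 4) * M.supReward t ^ 4 := by
      intro t
      rw [mul_pow, ENNReal.ofReal_mul (by positivity), ENNReal.ofReal_pow ENNReal.toReal_nonneg]
      gcongr
      exact ENNReal.ofReal_toReal_le
    refine (lintegral_mono h5).trans ?_
    rw [lintegral_const_mul' _ _ ENNReal.ofReal_ne_top, mul_pow (2 * (M.H : ℝ)),
      ENNReal.ofReal_mul (by positivity)]
    gcongr
    refine h4.trans (le_of_eq ?_)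
    rw [ENNReal.ofReal_pow (by positivity), ENNReal.ofReal_mul (by norm_num)]
    norm_num
  have hboundf := Rf.lintegral_sum_mul_sampleGap_le hP hplan hpol
    (ρ := fun t => 2 * M.H * (M.supReward t).toReal)
    (M.measurable_supReward.ennreal_toReal.const_mul _)
    (fun _ => by positivity) (by positivity) hb4 (by rw [hcard]; exact hd)
    (by rw [hcard]; simp) hK0 (Nat.le_ceil _)
  have hcr' : 0 ≤ r ^ 2 / M.σr ^ 2 := by positivity
  have hcf' : 0 ≤ cf / M.σf ^ 2 := by positivity
  have hrr := rate_le (d := ds + da) (K := K) (n := M.H) hcr' M.H_pos le_rfl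
    (M.H_pos.trans hHT) hKH hdT
  have hrf := rate_le (d := ds + da) (K := K) (n := M.H - 1) hcf' M.H_pos (Nat.sub_le _ _)
    (M.H_pos.trans hHT) hKH hdT
  rw [hcard] at hboundr hboundf
  have hdpos : (0 : ℝ) ≤ ((ds + da : ℕ) : ℝ) := by positivity
  set L := Real.log T
  have hL : 0 ≤ L := Real.log_nonneg hT
  have hbr' := hboundr.trans (ENNReal.ofReal_le_ofReal (mul_le_mul_of_nonneg_left hrr
    (by positivity)))
  have hbf' := hboundf.trans (ENNReal.ofReal_le_ofReal (mul_le_mul_of_nonneg_left hrf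
    (by positivity)))
  have htot := (hP.ofReal_integral_regret_le hplan hpol hsup hint T).trans
    (hsum.trans (add_le_add hbr' hbf'))
  have hΓr := rateConst_nonneg hcr'
  have hΓf := rateConst_nonneg hcf'
  rw [← ENNReal.ofReal_add (by positivity) (by positivity),
    ENNReal.ofReal_le_ofReal_iff (by positivity)] at htot
  refine htot.trans ?_
  -- The transition part carries `√K H²`, of which `√K √H` becomes `√T` and leaves `H^{3/2}`; the
  -- reward part carries only `√K H`.
  have hKs : √K * √M.H ≤ 2 * √T := by
    rw [← Real.sqrt_mul (by positivity)]
    calc √(K * M.H) ≤ √(2 ^ 2 * T) := Real.sqrt_le_sqrt (by linarith)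
      _ = 2 * √T := by rw [Real.sqrt_mul (by norm_num), Real.sqrt_sq (by norm_num)]
  have hsH : √(M.H : ℝ) * √M.H = M.H := Real.mul_self_sqrt (by positivity)
  have e1 : √K * M.H ≤ 2 * √T * (M.H * √M.H) := by
    calc √K * M.H = (√K * √M.H) * √M.H := by rw [mul_assoc, hsH]
      _ ≤ (2 * √T) * (M.H * √M.H) := by
        refine mul_le_mul hKs (le_mul_of_one_le_left (Real.sqrt_nonneg _) hH)
          (Real.sqrt_nonneg _) (by positivity)
  have e2 : √K * (M.H * M.H) ≤ 2 * √T * (M.H * √M.H) := by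
    calc √K * (M.H * M.H) = (√K * √M.H) * (M.H * √M.H) := by
          nth_rw 1 [← hsH]; ring
      _ ≤ _ := by gcongr
  push_cast
  calc _ = M.σr * rateConst (r ^ 2 / M.σr ^ 2) * ((ds : ℝ) + da) * (1 + L) ^ 2 * (√K * M.H) +
        8 * (r + 1) * rateConst (cf / M.σf ^ 2) * ((ds : ℝ) + da) * (1 + L) ^ 2 *
          (√K * (M.H * M.H)) := by ring
    _ ≤ M.σr * rateConst (r ^ 2 / M.σr ^ 2) * ((ds : ℝ) + da) * (1 + L) ^ 2 *
          (2 * √T * (M.H * √M.H)) +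
        8 * (r + 1) * rateConst (cf / M.σf ^ 2) * ((ds : ℝ) + da) * (1 + L) ^ 2 *
          (2 * √T * (M.H * √M.H)) := by gcongr
    _ = _ := by ring

end Main

end ControlProblem

/-! ### Short horizons, and the theorem. -/

namespace ControlProblem

variable {ds da : ℕ} {M : ControlProblem ds da}
  {Kr Kf : Matrix (Fin ds ⊕ Fin da) (Fin ds ⊕ Fin da) ℝ}

theorem supReward_eq_zero (hd : ds + da = 0) (θ : Param ds da) : M.supReward θ = 0 := by
  have : IsEmpty (Fin ds ⊕ Fin da) := by
    obtain ⟨rfl, rfl⟩ : ds = 0 ∧ da = 0 := by omega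
    infer_instance
  refine le_antisymm (supReward_le fun s _ a _ => ?_) zero_le
  rw [Subsingleton.elim θ.1 0]
  simp

/-- In at most `d` steps, or in a single episode, the regret is bounded by the rewards. -/
theorem mul_integral_supReward_le {r : ℝ}
    (h2 : ∫⁻ t, M.supReward t ^ 2 ∂(blrPrior Kr Kf) ≤ ENNReal.ofReal (r ^ 2)) {T : ℕ}
    (h : ds + da = 0 ∨ T < ds + da ∨ T < M.H) :
    ⌈(T : ℝ) / M.H⌉₊ * (2 * M.H * ∫ t, (M.supReward t).toReal ∂(blrPrior Kr Kf)) ≤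
      4 * (1 + r ^ 2) * (M.H * √M.H) * ((ds : ℝ) + da) * √T := by
  have hH : (1 : ℝ) ≤ M.H := by exact_mod_cast M.H_pos
  have hI := integral_supReward_le (sq_nonneg r) h2
  set I := ∫ t, (M.supReward t).toReal ∂(blrPrior Kr Kf) with hIdef
  have hI0 : 0 ≤ I := integral_nonneg fun _ => ENNReal.toReal_nonneg
  rcases Nat.eq_zero_or_pos T with rfl | hT
  · simp
  rcases Nat.eq_zero_or_pos (ds + da) with hd | hd
  · have hI' : I = 0 := by simp [hIdef, supReward_eq_zero hd]
    rw [hI', mul_zero, mul_zero]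
    positivity
  have hd' : (1 : ℝ) ≤ (ds : ℝ) + da := by exact_mod_cast hd
  have hT' : (1 : ℝ) ≤ T := by exact_mod_cast hT
  have hsT : 1 ≤ √(T : ℝ) := Real.one_le_sqrt.2 hT'
  have hsH : 1 ≤ √(M.H : ℝ) := Real.one_le_sqrt.2 hH
  have hKH : (⌈(T : ℝ) / M.H⌉₊ : ℝ) * M.H ≤ T + M.H := by
    have h := (Nat.ceil_lt_add_one (show 0 ≤ (T : ℝ) / M.H by positivity)).le
    have : (⌈(T : ℝ) / M.H⌉₊ : ℝ) * M.H ≤ (T / M.H + 1) * M.H := by gcongr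
    rwa [add_mul, div_mul_cancel₀ _ (by positivity), one_mul] at this
  -- The left side is at most `T + H`. If `T < H` this is at most `2H`; otherwise `H ≤ T < d` and it
  -- is at most `2T ≤ 2d`.
  have key : (⌈(T : ℝ) / M.H⌉₊ : ℝ) * M.H ≤ 2 * ((M.H * √M.H) * ((ds : ℝ) + da) * √T) := by
    rcases lt_or_ge T M.H with hTH | hTH
    · have hTH' : (T : ℝ) ≤ M.H := by exact_mod_cast hTH.le
      have h1 : (M.H : ℝ) * 1 * 1 * 1 ≤ (M.H * √M.H) * ((ds : ℝ) + da) * √T := by gcongr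
      linarith
    · have hTd : T < ds + da := by omega
      have hTd' : (T : ℝ) ≤ (ds : ℝ) + da := by exact_mod_cast hTd.le
      have hTH' : (M.H : ℝ) ≤ T := by exact_mod_cast hTH
      have h1 : (1 : ℝ) * 1 * T * 1 ≤ (M.H * √M.H) * ((ds : ℝ) + da) * √T := by gcongr
      linarith
  calc _ = (⌈(T : ℝ) / M.H⌉₊ : ℝ) * M.H * (2 * I) := by ring
    _ ≤ 2 * ((M.H * √M.H) * ((ds : ℝ) + da) * √T) * (2 * (1 + r ^ 2)) := by gcongr
    _ = _ := by ring

end ControlProblem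

theorem theorem1 :
    ∃ (C : ℝ → ℝ → ℝ → ℝ → ℝ) (p : ℕ),
      ∀ (ds da : ℕ) (M : ControlProblem ds da)
        (Kr Kf : Matrix (Fin ds ⊕ Fin da) (Fin ds ⊕ Fin da) ℝ)
        (_ : Kr.PosSemidef) (_ : Kf.PosSemidef)
        (Rmax C₁ : ℝ)
        (_ : ∫⁻ θ, (⨆ s ∈ M.S, ⨆ a ∈ M.A, ‖meanReward θ s a‖ₑ) ^ 2 ∂(blrPrior Kr Kf) ≤
          ENNReal.ofReal (Rmax ^ 2))
        (_ : ∀ s ∈ M.S, ∀ a ∈ M.A,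
          linearKernel Kf (stateAction s a) (stateAction s a) ≤ C₁)
        (plan : Param ds da → ℕ → Vec ds → Vec da) (_ : M.IsPlanner (blrPrior Kr Kf) plan)
        (Ω : Type*) (_ : MeasurableSpace Ω) (P : Measure Ω) (_ : IsProbabilityMeasure P)
        (θ : Ω → Param ds da) (θs : ℕ → Ω → Param ds da)
        (ξ : ℕ → Ω → ControlProblem.EpisodeNoise ds)
        (_ : M.IsPSRL plan θ θs ξ (blrPrior Kr Kf) P)
        (T : ℕ),
        Integrable (M.regret plan θ θs T) P ∧
          ∫ ω, M.regret plan θ θs T ω ∂P ≤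
            C Rmax C₁ M.σr M.σf * (M.H : ℝ) ^ (3 / 2 : ℝ) * ((ds : ℝ) + da) * √(T : ℝ) *
              (1 + Real.log T) ^ p := by

  -- The absolute values are there because the signs of `Rmax` and `C₁` are not prescribed. The last
  -- summand pays for short horizons.
  refine ⟨fun r c sr sf => 2 * (sr * ControlProblem.rateConst (|r| ^ 2 / sr ^ 2) +
    8 * (|r| + 1) * ControlProblem.rateConst (|c| / sf ^ 2)) + 4 * (1 + |r| ^ 2), 2, ?_⟩
  intro ds da M Kr Kf hKr hKf Rmax C₁ h2 hC plan hplan Ω _ P _ θ θs ξ hP T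
  have hpol : ∀ᵐ t ∂(blrPrior Kr Kf), M.IsPolicy (plan t) := hplan.2.mono fun _ h => h.1
  rw [← sq_abs Rmax] at h2
  have hsup := ControlProblem.ae_supReward_ne_top h2
  have hint := ControlProblem.integrable_supReward h2
  refine ⟨hP.integrable_regret hplan.1 hpol hsup hint T, ?_⟩
  have hσr := M.σr_pos
  have hσf := M.σf_pos
  have hH : (0 : ℝ) < M.H := by exact_mod_cast M.H_pos
  have hpow : (M.H : ℝ) ^ (3 / 2 : ℝ) = M.H * √M.H := by
    rw [show (3 / 2 : ℝ) = 1 + 1 / 2 by norm_num, Real.rpow_add hH, Real.rpow_one,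
      Real.sqrt_eq_rpow]
  have hL : 0 ≤ Real.log T := Real.log_natCast_nonneg T
  have hΓr := ControlProblem.rateConst_nonneg (show 0 ≤ |Rmax| ^ 2 / M.σr ^ 2 by positivity)
  have hΓf := ControlProblem.rateConst_nonneg (show 0 ≤ |C₁| / M.σf ^ 2 by positivity)
  set A := 2 * (M.σr * ControlProblem.rateConst (|Rmax| ^ 2 / M.σr ^ 2) +
    8 * (|Rmax| + 1) * ControlProblem.rateConst (|C₁| / M.σf ^ 2)) with hA
  have hA0 : 0 ≤ A := by positivity
  set B := 4 * (1 + |Rmax| ^ 2)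
  have hB0 : 0 ≤ B := by positivity
  rw [hpow]
  change _ ≤ (A + B) * (M.H * √M.H) * ((ds : ℝ) + da) * √T * (1 + Real.log T) ^ 2
  -- The main bound needs `1 ≤ d ≤ T`, to absorb `log d` into `log T`, and `H ≤ T`, to have `K H ≤
  -- 2T`.
  by_cases h : ds + da = 0 ∨ T < ds + da ∨ T < M.H
  · refine (hP.integral_regret_le_mul hplan.1 hpol hsup hint T).trans
      ((ControlProblem.mul_integral_supReward_le h2 h).trans ?_)
    have h1 : (1 : ℝ) ≤ (1 + Real.log T) ^ 2 := one_le_pow₀ (by linarith)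
    calc B * (M.H * √M.H) * ((ds : ℝ) + da) * √T
        ≤ (A + B) * (M.H * √M.H) * ((ds : ℝ) + da) * √T := by
          gcongr
          exact le_add_of_nonneg_left hA0
      _ ≤ _ := le_mul_of_one_le_right (by positivity) h1
  · push Not at h
    refine (hP.integral_regret_le hKr hKf hplan.1 hpol (abs_nonneg Rmax) h2 (abs_nonneg C₁)
      (fun s hs a ha => (hC s hs a ha).trans (le_abs_self C₁)) (by omega) h.2.1 h.2.2).trans ?_
    gcongr
    exact le_add_of_nonneg_right hB0
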